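/- Let $k\ge 3$ be an integer. There are $\varepsilon_0>0$, an algorithm, and a constant $K$, all depending only on $k$, such that for every $0<\varepsilon\le\varepsilon_0$ there is $n_0=n_0(k,\varepsilon)$ for which the following holds for all $n\ge n_0$ divisible by $k$. Let $0\le c\le \varepsilon n/k$ be an integer and let $H$ be a $k$-uniform hypergraph on $n$ vertices, with vertex set $V=\{0,\dots,n-1\}$, in which every set of $k-1$ vertices is contained in at least $n/k-c$ edges. Let $S\subseteq V$ be a set containing no edge of $H$ with $|S|\ge(1-\varepsilon)\frac{k-1}{k}n$, and let $C\supseteq S$ be an inclusion-maximal set of vertices containing no edge of $H$. Put $\alpha=\varepsilon^{1/3}$; for $x\in V$ let $\deg(x,C)$ be the number of edges $e\ni x$ with $e\setminus\{x\}\subseteq C$; let $$A=\Big\{x\in V\setminus C:\ \deg(x,C)\ge(1-\alpha)\tbinom{|C|}{k-1}\Big\},\qquad B=V\setminus(A\cup C).$$ For a matching $M$ in $H$ (a set of pairwise disjoint edges), let $V(M)$ be the set of vertices that it covers and let $s_M=|(A\cup B)\setminus V(M)|-(n/k-|M|)$ be its slack. Call $M$ a cleaner if $B\subseteq V(M)$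 and $s_M$ is non-negative and even. If $M$ is a cleaner with $|M|\le|B|+\alpha^2 n$, then $H\setminus V(M)$, the subgraph of $H$ induced on $V\setminus V(M)$, has a perfect matching. Moreover, given $H$ (as an adjacency table), the partition $(A,B,C)$ and $M$ (as a list of edges), the algorithm outputs a list of the edges of such a perfect matching after at most $K\,n^{4(k-1)}$ steps, on a word RAM with words of $O(\log n)$ bits (with implied constant depending only on $k$) and unit cost per operation. -/

import Mathlib

/-! ## `k`-uniform hypergraphs and matchings -/

/-- A `k`-graph on the (finite) vertex set `V`: every edge is a `k`-element subset of `V`. -/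
structure KGraph (k : ℕ) (V : Type*) where
  edges : Finset (Finset V)
  card_eq : ∀ e ∈ edges, e.card = k

/-- `V(M)`: the set of vertices covered by a family `M` of edges. -/
def coveredBy {V : Type*} [DecidableEq V] (M : Finset (Finset V)) : Finset V := M.biUnion id

namespace KGraph

variable {k : ℕ} {V : Type*} [Fintype V] [DecidableEq V]

/-- `N_H(S)`: the sets `T` disjoint from `S` such that `S ∪ T` is an edge. -/
def neighbourhood (H : KGraph k V) (S : Finset V) : Finset (Finset V) :=
  (Finset.univ \ S).powerset.filter (fun T => S ∪ T ∈ H.edges)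

def degree (H : KGraph k V) (S : Finset V) : ℕ := (H.neighbourhood S).card

/-- The minimum `d`-degree `δ_d(H)`, the least degree of a `d`-element set of vertices. -/
noncomputable def minDegree (H : KGraph k V) (d : ℕ) : ℕ :=
  sInf {m | ∃ S : Finset V, S.card = d ∧ H.degree S = m}

/-- A set of vertices is independent if it contains no edge. -/
def IsIndep (H : KGraph k V) (S : Finset V) : Prop := ∀ e ∈ H.edges, ¬ e ⊆ S

/-- A matching is a set of pairwise disjoint edges. -/
def IsMatching (H : KGraph k V) (M : Finset (Finset V)) : Prop :=
  M ⊆ H.edges ∧ (M : Set (Finset V)).PairwiseDisjoint id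

/-- `N` is a perfect matching of the induced subgraph `H[U]`: a matching of `H` whose edges
cover exactly the vertices of `U`. -/
def IsPerfectMatchingOn (H : KGraph k V) (U : Finset V) (N : Finset (Finset V)) : Prop :=
  H.IsMatching N ∧ coveredBy N = U

/-- `deg(x, C)`: the number of edges `e` containing `x` with `e \ {x} ⊆ C`. -/
def degInto (H : KGraph k V) (x : V) (C : Finset V) : ℕ :=
  (H.edges.filter (fun e => x ∈ e ∧ e \ {x} ⊆ C)).card

open scoped Classical in
/-- The vertices outside `C` that form an edge with almost all `(k-1)`-subsets of `C`. -/
noncomputable def partA (H : KGraph k V) (α : ℝ) (C : Finset V) : Finset V :=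
  (Finset.univ \ C).filter
    (fun x => (1 - α) * (C.card.choose (k - 1) : ℝ) ≤ (H.degInto x C : ℝ))

/-- The remaining vertices. -/
noncomputable def partB (H : KGraph k V) (α : ℝ) (C : Finset V) : Finset V :=
  Finset.univ \ (H.partA α C ∪ C)

/-- The slack `s_M = |(A ∪ B) \ V(M)| - (n/k - |M|)`; it is used only when `k` divides `n`,
so that the integer division is exact. -/
noncomputable def slack (H : KGraph k V) (α : ℝ) (C : Finset V) (M : Finset (Finset V)) : ℤ :=
  (((H.partA α C ∪ H.partB α C) \ coveredBy M).card : ℤ)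
    - (((Fintype.card V / k : ℕ) : ℤ) - (M.card : ℤ))

/-- A cleaner is a matching that covers `B` and whose slack is non-negative and even. -/
def IsCleaner (H : KGraph k V) (α : ℝ) (C : Finset V) (M : Finset (Finset V)) : Prop :=
  H.IsMatching M ∧ H.partB α C ⊆ coveredBy M ∧ 0 ≤ H.slack α C M ∧ Even (H.slack α C M)

end KGraph

/-! ## The machine model: structured programs for a word RAM with unit costs

A memory state consists of registers and of arrays of registers.  A program is a finite text,
so it names only finitely many registers and arrays.  Every arithmetic operation, memory access,
assignment and test costs one unit.  The machine has a bound `W` on the numbers that it can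
handle (words of `log W` bits): an instruction in which a number `≥ W` would occur, as a value,
as an intermediate result or as an array index, cannot be executed. -/

namespace WordRAM

structure State where
  reg : ℕ → ℕ
  arr : ℕ → ℕ → ℕ

inductive Op where
  | add | sub | mul | div | mod | lt | eq

/-- Subtraction is truncated at `0`; comparisons return `1` (true) or `0` (false). -/
def Op.apply : Op → ℕ → ℕ → ℕ
  | .add, a, b => a + b
  | .sub, a, b => a - b
  | .mul, a, b => a * b
  | .div, a, b => a / b
  | .mod, a, b => a % b
  | .lt, a, b => if a < b then 1 else 0
  | .eq, a, b => if a = b then 1 else 0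

inductive Expr where
  | lit (c : ℕ)
  | reg (x : ℕ)
  | get (a : ℕ) (i : Expr)
  | op (o : Op) (e f : Expr)

namespace Expr

def val (s : State) : Expr → ℕ
  | lit c => c
  | reg x => s.reg x
  | get a i => s.arr a (i.val s)
  | op o e f => o.apply (e.val s) (f.val s)

def cost : Expr → ℕ
  | lit _ => 1
  | reg _ => 1
  | get _ i => i.cost + 1
  | op _ e f => e.cost + f.cost + 1

/-- Every number that occurs in the evaluation of the expression is below `W`. -/
def Fits (W : ℕ) (s : State) : Expr → Prop
  | lit c => c < W
  | reg x => s.reg x < W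
  | get a i => i.Fits W s ∧ s.arr a (i.val s) < W
  | op o e f => e.Fits W s ∧ f.Fits W s ∧ o.apply (e.val s) (f.val s) < W

end Expr

inductive Prog where
  | skip
  | set (x : ℕ) (e : Expr)
  | store (a : ℕ) (i e : Expr)
  | seq (p q : Prog)
  | ite (e : Expr) (p q : Prog)
  | while (e : Expr) (p : Prog)

def State.setReg (s : State) (x v : ℕ) : State :=
  { s with reg := Function.update s.reg x v }

def State.setArr (s : State) (a i v : ℕ) : State :=
  { s with arr := Function.update s.arr a (Function.update (s.arr a) i v) }

/-- `Exec W p s s' t`: on a machine with word bound `W`, the program `p` started in state `s`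
halts in state `s'` after exactly `t` steps. -/
inductive Exec (W : ℕ) : Prog → State → State → ℕ → Prop where
  | skip (s : State) : Exec W .skip s s 1
  | set (s : State) (x : ℕ) (e : Expr) : e.Fits W s →
      Exec W (.set x e) s (s.setReg x (e.val s)) (e.cost + 1)
  | store (s : State) (a : ℕ) (i e : Expr) : i.Fits W s → e.Fits W s →
      Exec W (.store a i e) s (s.setArr a (i.val s) (e.val s)) (i.cost + e.cost + 1)
  | seq (s s' s'' : State) (p q : Prog) (t t' : ℕ) : Exec W p s s' t → Exec W q s' s'' t' →
      Exec W (.seq p q) s s'' (t + t')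
  | ite_true (s s' : State) (e : Expr) (p q : Prog) (t : ℕ) : e.Fits W s → e.val s ≠ 0 →
      Exec W p s s' t → Exec W (.ite e p q) s s' (e.cost + 1 + t)
  | ite_false (s s' : State) (e : Expr) (p q : Prog) (t : ℕ) : e.Fits W s → e.val s = 0 →
      Exec W q s s' t → Exec W (.ite e p q) s s' (e.cost + 1 + t)
  | while_true (s s' s'' : State) (e : Expr) (p : Prog) (t t' : ℕ) : e.Fits W s → e.val s ≠ 0 →
      Exec W p s s' t → Exec W (.while e p) s' s'' t' →
      Exec W (.while e p) s s'' (e.cost + 1 + t + t')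
  | while_false (s : State) (e : Expr) (p : Prog) : e.Fits W s → e.val s = 0 →
      Exec W (.while e p) s s (e.cost + 1)

/-- The array `a` lists the `m` members of the family `M` of `k`-subsets of `{0, …, n-1}`, in
some order and without repetition: cells `i*k, …, i*k+k-1` hold the elements of the `i`-th
member, again in some order. -/
def Lists (k : ℕ) {n : ℕ} (a : ℕ → ℕ) (m : ℕ) (M : Finset (Finset (Fin n))) : Prop :=
  M.card = m ∧ ∀ e : Finset (Fin n),
    e ∈ M ↔ ∃ i < m, e.map Fin.valEmbedding = (Finset.range k).image (fun j => a (i * k + j))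

open scoped Classical in
/-- `s` is an initial memory state that encodes the following data: the number `n` (register 0);
the `k`-graph `H` on `{0, …, n-1}` by its `k`-dimensional adjacency table (array 0); the
partition into `A`, `B` and the remaining vertices, by labels 0, 1, 2 (array 1); a
matching `M` as a list of edges (array 2), and its size (register 1).  All other memory
cells hold zero. -/
structure IsInput {k n : ℕ} (H : KGraph k (Fin n)) (A B : Finset (Fin n))
    (M : Finset (Finset (Fin n))) (s : State) : Prop where
  reg_zero : s.reg 0 = n
  reg_one : s.reg 1 = M.card
  reg_other : ∀ x, 2 ≤ x → s.reg x = 0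
  table : ∀ v : Fin k → Fin n, s.arr 0 (∑ j : Fin k, (v j : ℕ) * n ^ (j : ℕ)) =
    if Finset.univ.image v ∈ H.edges then 1 else 0
  table_other : ∀ i, n ^ k ≤ i → s.arr 0 i = 0
  label : ∀ v : Fin n, s.arr 1 v = if v ∈ A then 0 else if v ∈ B then 1 else 2
  label_other : ∀ i, n ≤ i → s.arr 1 i = 0
  list : Lists k (s.arr 2) M.card M
  list_other : ∀ i, M.card * k ≤ i → s.arr 2 i = 0
  arr_other : ∀ a, 3 ≤ a → ∀ i, s.arr a i = 0

/-- The output family of edges: a list in array 3, its length in register 2. -/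
def IsOutput (k : ℕ) {n : ℕ} (N : Finset (Finset (Fin n))) (s : State) : Prop :=
  Lists k (s.arr 3) (s.reg 2) N

end WordRAM

/-! Write U = V \ V(M) and let the slack of M be 2r. Since M covers B, U lies in A ∪ C, and the
slack condition says that (k-1)|U ∩ A| exceeds |U \ A| by 2kr. If r = 0, then U splits into blocks
consisting of one vertex of A and k-1 vertices of C. Almost all sets of this form are edges, so a
split can be repaired locally until every block is an edge.

Structure (`extremal_of_minDegree`): a (k-1)-subset of C has at least (1-α³)n/k neighbours, all
outside the independent set C, whose complement has at most n/k + α³n vertices. Double counting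
edges with one vertex outside C gives |B| ≤ α²n. Hence |M| ≤ 2α²n and 2r ≤ 3α²n, so M and the edges
that remove the slack cover only a small part of V.

Slack (`Extremal.exists_pair`): two disjoint edges with four vertices in A altogether lower the
surplus by 4(k-1) - (2k-4) = 2k. Two vertices of A and k-3 of C extend to an edge, but it is not
known whether the last vertex falls in A. So the edge has two or three vertices in A. Two edges of
the first kind form a pair, and an edge of the second kind forms one with an edge that has a single
vertex in A. This is why the slack has to be even.

Exchange (`Extremal.exists_exchange`): given a block j, there are k-1 further blocks such that a
fixed rearrangement of the vertices of these k blocks turns all k of them into edges. A random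
choice works by a union bound. The new block 0 takes the A-vertex of block j and one C-vertex from
each other block, and it is an edge because that A-vertex lies in an edge with almost all
(k-1)-subsets of C. Each other new block keeps k-2 of its C-vertices, takes one from block j, and
receives the A-vertex of the next block, which almost always works by the codegree condition. As all
k blocks become edges, no edge is ever destroyed.

Algorithm: each object is found by an exhaustive scan over tuples, encoded as numbers in base n. One
scan over n^(2k) tuples removes the slack and one over n^k tuples forms the blocks, because a tuple
that was rejected stays unusable as the available set shrinks. Each of the at most n blocks then
takes a scan over n^(k-1) tuples. All this is within n^(4(k-1)). `KGraph.Prepared` is the interface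
between the combinatorics and `WordRAM.program_correct`, and the existence of a perfect matching is
itself read off from a run of the program. -/

namespace WordRAM

/-! ### Evaluation of expressions -/

/-- The expression `e` can be evaluated in the state `s`, with value `v`. -/
def Evals (W : ℕ) (s : State) (e : Expr) (v : ℕ) : Prop := e.Fits W s ∧ e.val s = v

section Evals
variable {W : ℕ} {s : State}

theorem Evals.lit {c : ℕ} (h : c < W) : Evals W s (.lit c) c := ⟨h, rfl⟩

theorem Evals.reg {x v : ℕ} (h : s.reg x = v) (hv : v < W) : Evals W s (.reg x) v :=
  ⟨by simpa [Expr.Fits, h] using hv, h⟩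

theorem Evals.get {a i v : ℕ} {e : Expr} (he : Evals W s e i) (h : s.arr a i = v) (hv : v < W) :
    Evals W s (.get a e) v := by
  obtain ⟨h1, rfl⟩ := he
  exact ⟨⟨h1, by rwa [h]⟩, h⟩

theorem Evals.op {o : Op} {e f : Expr} {a b v : ℕ} (he : Evals W s e a) (hf : Evals W s f b)
    (h : o.apply a b = v) (hv : v < W) : Evals W s (.op o e f) v := by
  obtain ⟨h1, rfl⟩ := he
  obtain ⟨h2, rfl⟩ := hf
  exact ⟨⟨h1, h2, by rwa [h]⟩, h⟩

theorem Evals.add {e f : Expr} {a b : ℕ} (he : Evals W s e a) (hf : Evals W s f b)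
    (hv : a + b < W) : Evals W s (.op .add e f) (a + b) := he.op hf rfl hv

theorem Evals.mul {e f : Expr} {a b : ℕ} (he : Evals W s e a) (hf : Evals W s f b)
    (hv : a * b < W) : Evals W s (.op .mul e f) (a * b) := he.op hf rfl hv

theorem Evals.sub {e f : Expr} {a b : ℕ} (he : Evals W s e a) (hf : Evals W s f b)
    (hv : a < W) : Evals W s (.op .sub e f) (a - b) :=
  he.op hf rfl (lt_of_le_of_lt (Nat.sub_le _ _) hv)

theorem Evals.div {e f : Expr} {a b : ℕ} (he : Evals W s e a) (hf : Evals W s f b)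
    (hv : a < W) : Evals W s (.op .div e f) (a / b) :=
  he.op hf rfl (lt_of_le_of_lt (Nat.div_le_self _ _) hv)

theorem Evals.mod {e f : Expr} {a b : ℕ} (he : Evals W s e a) (hf : Evals W s f b)
    (hv : a < W) : Evals W s (.op .mod e f) (a % b) :=
  he.op hf rfl (lt_of_le_of_lt (Nat.mod_le _ _) hv)

theorem Evals.lt {e f : Expr} {a b : ℕ} (he : Evals W s e a) (hf : Evals W s f b)
    (hv : 1 < W) : Evals W s (.op .lt e f) (if a < b then 1 else 0) :=
  he.op hf rfl (by split_ifs <;> omega)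

theorem Evals.eq {e f : Expr} {a b : ℕ} (he : Evals W s e a) (hf : Evals W s f b)
    (hv : 1 < W) : Evals W s (.op .eq e f) (if a = b then 1 else 0) :=
  he.op hf rfl (by split_ifs <;> omega)

end Evals

/-! ### Compound expressions -/

namespace Expr

/-- `n ^ t`, where `n` is in register 0. -/
def pow : ℕ → Expr
  | 0 => lit 1
  | t + 1 => op .mul (pow t) (reg 0)

/-- `τ / n ^ t`, where `n` is in register 0 and `τ` in register 3. -/
def shift : ℕ → Expr
  | 0 => reg 3
  | t + 1 => op .div (shift t) (reg 0)

/-- The `t`-th digit of `τ` in base `n`, where `n` is in register 0 and `τ` in register 3. -/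
def digit (t : ℕ) : Expr := op .mod (shift t) (reg 0)

/-- The number with digits `c 0, c 1, …, c (m - 1)` in base `n`, with `n` in register 0. -/
def horner (c : ℕ → Expr) : ℕ → Expr
  | 0 => lit 0
  | m + 1 => op .add (horner c m) (op .mul (c m) (pow m))

/-- The sum `c 0 + ⋯ + c (m - 1)`. -/
def sum (c : ℕ → Expr) : ℕ → Expr
  | 0 => lit 0
  | m + 1 => op .add (sum c m) (c m)

end Expr

/-- `n` is in register 0 and all numbers up to `n ^ D` are below the word bound. -/
theorem Evals.pow {W n t : ℕ} {s : State} (hn : s.reg 0 = n) (hn0 : 2 ≤ n) (hW : n ^ t < W)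
    (hnW : n < W) : Evals W s (.pow t) (n ^ t) := by
  induction t with
  | zero => exact .lit (by omega)
  | succ t ih =>
    rw [pow_succ] at hW ⊢
    exact (ih (lt_of_le_of_lt (Nat.le_mul_of_pos_right _ (by omega)) hW)).mul (.reg hn hnW) hW

theorem Evals.shift {W n τ t : ℕ} {s : State} (hn : s.reg 0 = n) (hτ : s.reg 3 = τ)
    (hnW : n < W) (hW : τ < W) : Evals W s (.shift t) (τ / n ^ t) := by
  induction t with
  | zero => simpa using! Evals.reg hτ hW
  | succ t ih =>
    rw [pow_succ, ← Nat.div_div_eq_div_mul]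
    exact ih.div (.reg hn hnW) (lt_of_le_of_lt (Nat.div_le_self _ _) hW)

theorem Evals.digit {W n τ t : ℕ} {s : State} (hn : s.reg 0 = n) (hτ : s.reg 3 = τ)
    (hnW : n < W) (hW : τ < W) : Evals W s (.digit t) (τ / n ^ t % n) :=
  (Evals.shift hn hτ hnW hW).mod (.reg hn hnW) (lt_of_le_of_lt (Nat.div_le_self _ _) hW)

theorem sum_digits_lt {n m : ℕ} {v : ℕ → ℕ} (hv : ∀ j < m, v j < n) :
    ∑ j ∈ Finset.range m, v j * n ^ j < n ^ m := by
  induction m with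
  | zero => simp
  | succ m ih =>
    rw [Finset.sum_range_succ, pow_succ]
    have h1 := ih fun j hj => hv j (by omega)
    have h2 : (v m + 1) * n ^ m ≤ n * n ^ m := Nat.mul_le_mul_right _ (hv m (by omega))
    nlinarith

theorem Evals.horner {W n m : ℕ} {s : State} {c : ℕ → Expr} {v : ℕ → ℕ} (hn : s.reg 0 = n)
    (hn0 : 2 ≤ n) (hnW : n < W) (hW : n ^ m < W) (hc : ∀ j < m, Evals W s (c j) (v j))
    (hv : ∀ j < m, v j < n) :
    Evals W s (.horner c m) (∑ j ∈ Finset.range m, v j * n ^ j) := by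
  induction m with
  | zero => simpa using! Evals.lit (by omega)
  | succ m ih =>
    have h0 := sum_digits_lt hv
    have hle : n ^ m ≤ n ^ (m + 1) := Nat.pow_le_pow_right (by omega) (by omega)
    rw [Finset.sum_range_succ] at h0 ⊢
    exact (ih (by omega) (fun j hj => hc j (by omega)) (fun j hj => hv j (by omega))).add
      ((hc m (by omega)).mul (.pow hn hn0 (by omega) hnW) (by omega)) (by omega)

theorem Evals.sum {W m : ℕ} {s : State} {c : ℕ → Expr} {v : ℕ → ℕ}
    (hW : ∑ j ∈ Finset.range m, v j < W) (hc : ∀ j < m, Evals W s (c j) (v j)) :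
    Evals W s (.sum c m) (∑ j ∈ Finset.range m, v j) := by
  induction m with
  | zero => exact .lit hW
  | succ m ih =>
    rw [Finset.sum_range_succ] at hW ⊢
    exact (ih (by omega) (fun j hj => hc j (by omega))).add (hc m (by omega)) hW

/-! ### Rules for programs -/

/-- The program `p` started in `s` halts in a state that satisfies `Q`. -/
def Runs (W : ℕ) (p : Prog) (s : State) (Q : State → Prop) : Prop :=
  ∃ s' t, Exec W p s s' t ∧ Q s'

/-- The program `p` started in `s` halts after at most `T` steps in a state satisfying `Q`. -/
def RunsIn (W T : ℕ) (p : Prog) (s : State) (Q : State → Prop) : Prop :=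
  ∃ s' t, Exec W p s s' t ∧ t ≤ T ∧ Q s'

/-- Such programs have a running time bounded by their text alone. Loop bodies without inner loops
can therefore be analysed with the untimed `Runs`, and the time is added by `Runs.runsIn`. -/
def Prog.LoopFree : Prog → Prop
  | skip => True
  | set _ _ => True
  | store _ _ _ => True
  | seq p q => p.LoopFree ∧ q.LoopFree
  | ite _ p q => p.LoopFree ∧ q.LoopFree
  | .while _ _ => False

/-- An upper bound for the running time of a program without loops. -/
def Prog.bound : Prog → ℕ
  | skip => 1
  | set _ e => e.cost + 1
  | store _ i e => i.cost + e.cost + 1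
  | seq p q => p.bound + q.bound
  | ite e p q => e.cost + 1 + p.bound + q.bound
  | .while _ _ => 0

theorem Exec.le_bound {W : ℕ} {p : Prog} {s s' : State} {t : ℕ} (h : Exec W p s s' t)
    (hp : p.LoopFree) : t ≤ p.bound := by
  induction h with
  | skip => exact le_rfl
  | set => exact le_rfl
  | store => exact le_rfl
  | seq _ _ _ _ _ _ _ _ _ ih1 ih2 =>
    exact Nat.add_le_add (ih1 hp.1) (ih2 hp.2)
  | ite_true _ _ _ _ _ _ _ _ _ ih =>
    have := ih hp.1; simp only [Prog.bound]; omega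
  | ite_false _ _ _ _ _ _ _ _ _ ih =>
    have := ih hp.2; simp only [Prog.bound]; omega
  | while_true => exact hp.elim
  | while_false => exact hp.elim

section Rules
variable {W : ℕ} {s : State} {Q : State → Prop}

theorem Runs.mono {p : Prog} {Q' : State → Prop} (h : Runs W p s Q) (hQ : ∀ s, Q s → Q' s) :
    Runs W p s Q' := by
  obtain ⟨s', t, h1, h2⟩ := h
  exact ⟨s', t, h1, hQ _ h2⟩

theorem RunsIn.mono {p : Prog} {T T' : ℕ} {Q' : State → Prop} (h : RunsIn W T p s Q)
    (hT : T ≤ T') (hQ : ∀ s, Q s → Q' s) : RunsIn W T' p s Q' := by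
  obtain ⟨s', t, h1, h2, h3⟩ := h
  exact ⟨s', t, h1, h2.trans hT, hQ _ h3⟩

theorem Runs.runsIn {p : Prog} (h : Runs W p s Q) (hp : p.LoopFree) : RunsIn W p.bound p s Q := by
  obtain ⟨s', t, h1, h2⟩ := h
  exact ⟨s', t, h1, h1.le_bound hp, h2⟩

theorem Runs.skip (h : Q s) : Runs W .skip s Q := ⟨s, 1, .skip s, h⟩

theorem Runs.set {x v : ℕ} {e : Expr} (he : Evals W s e v) (h : Q (s.setReg x v)) :
    Runs W (.set x e) s Q := by
  obtain ⟨h1, rfl⟩ := he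
  exact ⟨_, _, .set s x e h1, h⟩

theorem Runs.store {a j v : ℕ} {i e : Expr} (hi : Evals W s i j) (he : Evals W s e v)
    (h : Q (s.setArr a j v)) : Runs W (.store a i e) s Q := by
  obtain ⟨h1, rfl⟩ := he
  obtain ⟨h2, rfl⟩ := hi
  exact ⟨_, _, .store s a i e h2 h1, h⟩

theorem Runs.seq {p q : Prog} (h : Runs W p s fun s' => Runs W q s' Q) :
    Runs W (.seq p q) s Q := by
  obtain ⟨s', t, h1, s'', t', h2, h3⟩ := h
  exact ⟨s'', t + t', .seq _ _ _ _ _ _ _ h1 h2, h3⟩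

theorem RunsIn.seq {p q : Prog} {T T' : ℕ}
    (h : RunsIn W T p s fun s' => RunsIn W T' q s' Q) : RunsIn W (T + T') (.seq p q) s Q := by
  obtain ⟨s', t, h1, ht, s'', t', h2, ht', h3⟩ := h
  exact ⟨s'', t + t', .seq _ _ _ _ _ _ _ h1 h2, by omega, h3⟩

/-- `p` is executed if all the expressions in the list are nonzero. -/
def guards : List Expr → Prog → Prog
  | [], p => p
  | e :: l, p => .ite e (guards l p) .skip

theorem guards_loopFree {p : Prog} (hp : p.LoopFree) (l : List Expr) :
    (guards l p).LoopFree := by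
  induction l with
  | nil => exact hp
  | cons e l ih => exact ⟨ih, trivial⟩

theorem Runs.guards {p : Prog} {l : List Expr} (hfit : ∀ e ∈ l, e.Fits W s)
    (hyes : (∀ e ∈ l, e.val s ≠ 0) → Runs W p s Q)
    (hno : (∃ e ∈ l, e.val s = 0) → Q s) : Runs W (guards l p) s Q := by
  induction l with
  | nil => exact hyes (by simp)
  | cons e l ih =>
    by_cases h : e.val s = 0
    · exact ⟨s, _, .ite_false s s e _ _ 1 (hfit e (by simp)) h (.skip s),
        hno ⟨e, by simp, h⟩⟩
    · obtain ⟨s', t, h1, h2⟩ := ih (fun e he => hfit e (by simp [he]))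
        (fun h' => hyes (by simpa [h] using h'))
        (fun ⟨e', he', h'⟩ => hno ⟨e', by simp [he'], h'⟩)
      exact ⟨s', _, .ite_true s s' e _ _ t (hfit e (by simp)) h h1, h2⟩

/-- The assignments `a[idx i] := val i` for `i < N`. -/
def storeMany (a : ℕ) (idx val : ℕ → Expr) : ℕ → Prog
  | 0 => .skip
  | N + 1 => .seq (storeMany a idx val N) (.store a (idx N) (val N))

theorem storeMany_loopFree (a : ℕ) (idx val : ℕ → Expr) (N : ℕ) :
    (storeMany a idx val N).LoopFree := by
  induction N with
  | zero => trivial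
  | succ N ih => exact ⟨ih, trivial⟩

/-- The expressions are evaluated while array `a` is being overwritten. Hence `h` asks for their
values in every state that agrees with `s` outside `a`, and `hI` ensures that no stored value is
overwritten. -/
theorem Runs.storeMany {a N : ℕ} {idx val : ℕ → Expr} {I V : ℕ → ℕ}
    (h : ∀ i < N, ∀ s' : State, s'.reg = s.reg → (∀ b ≠ a, s'.arr b = s.arr b) →
      Evals W s' (idx i) (I i) ∧ Evals W s' (val i) (V i))
    (hI : ∀ i < N, ∀ j < N, I i = I j → i = j) :
    Runs W (storeMany a idx val N) s fun s' => s'.reg = s.reg ∧ (∀ b ≠ a, s'.arr b = s.arr b) ∧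
      (∀ i < N, s'.arr a (I i) = V i) ∧ ∀ x, (∀ i < N, I i ≠ x) → s'.arr a x = s.arr a x := by
  induction N with
  | zero => exact .skip ⟨rfl, fun _ _ => rfl, by simp, fun _ _ => rfl⟩
  | succ N ih =>
    refine .seq ((ih (fun i hi => h i (by omega))
      (fun i hi j hj => hI i (by omega) j (by omega))).mono ?_)
    rintro s' ⟨h1, h2, h3, h4⟩
    obtain ⟨h5, h6⟩ := h N (by omega) s' h1 h2
    refine .store h5 h6 ⟨h1, fun b hb => ?_, fun i hi => ?_, fun x hx => ?_⟩
    · simp [State.setArr, Function.update_of_ne hb, h2 b hb]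
    · rcases Nat.lt_succ_iff_lt_or_eq.1 hi with hi' | rfl
      · have : I i ≠ I N := fun e => by have := hI i (by omega) N (by omega) e; omega
        simp [State.setArr, Function.update_of_ne this, h3 i hi']
      · simp [State.setArr]
    · have : x ≠ I N := fun e => hx N (by omega) e.symm
      simp only [State.setArr, Function.update_self, Function.update_of_ne this]
      exact h4 x fun i hi => hx i (by omega)

/-- `for x = 0, …, b - 1 do p`. -/
def forTo (x : ℕ) (b : Expr) (p : Prog) : Prog :=
  .seq (.set x (.lit 0))
    (.while (.op .lt (.reg x) b) (.seq p (.set x (.op .add (.reg x) (.lit 1)))))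

/-- Induction on the number of remaining rounds. A round costs at most `T` for the body, `b.cost +
3` for the test and 4 for the increment. The constant 9 leaves room for the initial assignment and
the final test. -/
theorem RunsIn.forTo {x N T : ℕ} {b : Expr} {p : Prog} {Inv : ℕ → State → Prop}
    (hN : N + 1 < W) (h0 : Inv 0 (s.setReg x 0))
    (hb : ∀ i s, i ≤ N → Inv i s → s.reg x = i ∧ Evals W s b N)
    (hstep : ∀ i s, i < N → Inv i s →
      RunsIn W T p s fun s' => s'.reg x = i ∧ Inv (i + 1) (s'.setReg x (i + 1))) :
    RunsIn W ((N + 1) * (T + b.cost + 9)) (forTo x b p) s (Inv N) := by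
  have key : ∀ d ≤ N, ∀ s, Inv (N - d) s →
      RunsIn W (d * (T + b.cost + 9) + (b.cost + 3))
        (.while (.op .lt (.reg x) b) (.seq p (.set x (.op .add (.reg x) (.lit 1))))) s
        (Inv N) := by
    intro d
    induction d with
    | zero =>
      intro _ s hs
      obtain ⟨h1, h2⟩ := hb _ s (by omega) hs
      have h3 : Evals W s (.op .lt (.reg x) b) (if N - 0 < N then 1 else 0) :=
        Evals.lt (.reg h1 (by omega)) h2 (by omega)
      refine ⟨s, _, .while_false s _ _ h3.1 (by simp [h3.2]), ?_, hs⟩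
      simp only [Expr.cost]; omega
    | succ d ih =>
      intro hd s hs
      obtain ⟨h1, h2⟩ := hb _ s (by omega) hs
      have h3 : Evals W s (.op .lt (.reg x) b) (if N - (d + 1) < N then 1 else 0) :=
        Evals.lt (.reg h1 (by omega)) h2 (by omega)
      obtain ⟨s', t, h4, h5, h6, h7⟩ := hstep _ s (by omega) hs
      have h8 : Evals W s' (.op .add (.reg x) (.lit 1)) (N - (d + 1) + 1) :=
        Evals.add (.reg h6 (by omega)) (.lit (by omega)) (by omega)
      have h9 := Exec.set s' x _ h8.1
      rw [h8.2] at h9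
      have hd' : N - (d + 1) + 1 = N - d := by omega
      rw [hd'] at h7 h9
      obtain ⟨s'', t', h10, h11, h12⟩ := ih (by omega) _ h7
      refine ⟨s'', _, .while_true _ _ _ _ _ _ _ h3.1 ?_ (.seq _ _ _ _ _ _ _ h4 h9) h10, ?_, h12⟩
      · rw [h3.2, if_pos (by omega)]; omega
      · simp only [Expr.cost, Nat.add_mul, Nat.one_mul] at h11 ⊢; omega
  have h1 : RunsIn W 2 (.set x (.lit 0)) s
      fun s' => RunsIn W (N * (T + b.cost + 9) + (b.cost + 3)) _ s' (Inv N) :=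
    ⟨_, _, .set s x _ (Evals.lit (by omega)).1, le_rfl, key N le_rfl _ (by rw [Nat.sub_self]; exact h0)⟩
  refine (RunsIn.seq h1).mono ?_ fun _ h => h
  rw [Nat.add_mul]; omega

end Rules
end WordRAM

namespace WordRAM

/-! ### Tests -/

/-- All expressions in the list `l` can be evaluated, and they are all nonzero iff `P` holds. -/
def Tests (W : ℕ) (s : State) (l : List Expr) (P : Prop) : Prop :=
  (∀ e ∈ l, e.Fits W s) ∧ ((∀ e ∈ l, e.val s ≠ 0) ↔ P)

section Tests
variable {W : ℕ} {s : State}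

theorem Tests.congr {l : List Expr} {P Q : Prop} (h : Tests W s l P) (hPQ : P ↔ Q) :
    Tests W s l Q := ⟨h.1, h.2.trans hPQ⟩

theorem Tests.append {l l' : List Expr} {P Q : Prop} (h : Tests W s l P) (h' : Tests W s l' Q) :
    Tests W s (l ++ l') (P ∧ Q) := by
  refine ⟨fun e he => (List.mem_append.1 he).elim (h.1 e) (h'.1 e), ?_⟩
  rw [← h.2, ← h'.2]
  simp only [List.mem_append]
  exact ⟨fun H => ⟨fun e he => H e (.inl he), fun e he => H e (.inr he)⟩,
    fun H e he => he.elim (H.1 e) (H.2 e)⟩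

theorem Tests.nonzero {e : Expr} {v : ℕ} (h : Evals W s e v) : Tests W s [e] (v ≠ 0) := by
  refine ⟨by simpa using h.1, by simp [h.2]⟩

theorem Tests.eq {e f : Expr} {a b : ℕ} (he : Evals W s e a) (hf : Evals W s f b) (hW : 1 < W) :
    Tests W s [.op .eq e f] (a = b) :=
  (Tests.nonzero (he.eq hf hW)).congr (by split_ifs <;> simp_all)

theorem Tests.lt {e f : Expr} {a b : ℕ} (he : Evals W s e a) (hf : Evals W s f b) (hW : 1 < W) :
    Tests W s [.op .lt e f] (a < b) :=
  (Tests.nonzero (he.lt hf hW)).congr (by split_ifs <;> simp_all)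

theorem Tests.ofFn {m : ℕ} {l : ℕ → List Expr} {P : ℕ → Prop}
    (h : ∀ t < m, Tests W s (l t) (P t)) :
    Tests W s ((List.range m).flatMap l) (∀ t < m, P t) := by
  refine ⟨fun e he => ?_, ?_⟩
  · obtain ⟨t, ht, he⟩ := List.mem_flatMap.1 he
    exact (h t (List.mem_range.1 ht)).1 e he
  · refine ⟨fun H t ht => (h t ht).2.1 fun e he => H e ?_, fun H e he => ?_⟩
    · exact List.mem_flatMap.2 ⟨t, List.mem_range.2 ht, he⟩
    · obtain ⟨t, ht, he⟩ := List.mem_flatMap.1 he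
      have ht := List.mem_range.1 ht
      exact (h t ht).2.2 (H t ht) e he

/-- Tests that the values `c 0, …, c (m - 1)` are distinct. -/
def distinct (c : ℕ → Expr) (m : ℕ) : List Expr :=
  (List.range m).flatMap fun i => (List.range i).flatMap fun j =>
    [.op .eq (.op .eq (c i) (c j)) (.lit 0)]

theorem Tests.distinct {c : ℕ → Expr} {m : ℕ} {v : ℕ → ℕ} (h : ∀ i < m, Evals W s (c i) (v i))
    (hW : 1 < W) :
    Tests W s (distinct c m) (∀ i < m, ∀ j < m, v i = v j → i = j) := by
  have h1 : Tests W s (WordRAM.distinct c m) (∀ i < m, ∀ j < i, v i ≠ v j) :=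
    Tests.ofFn fun i hi => Tests.ofFn fun j hj =>
      (Tests.eq ((h i hi).eq (h j (by omega)) hW) (.lit (by omega)) hW).congr (by simp)
  refine h1.congr ⟨fun H i hi j hj hij => ?_, fun H i hi j hj hij => ?_⟩
  · rcases lt_trichotomy i j with hlt | rfl | hlt
    · exact (H j hj i hlt hij.symm).elim
    · rfl
    · exact (H i hi j hlt hij).elim
  · have := H i hi j (by omega) hij; omega

theorem Runs.tests {p : Prog} {l : List Expr} {P : Prop} {Q : State → Prop}
    (h : Tests W s l P) (hyes : P → Runs W p s Q) (hno : ¬ P → Q s) :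
    Runs W (WordRAM.guards l p) s Q :=
  Runs.guards h.1 (fun H => hyes (h.2.1 H)) fun ⟨e, he, h0⟩ =>
    hno fun hP => h.2.2 hP e he h0

end Tests
end WordRAM

/-! ### The block exchange -/

/-- In an exchange between `k` blocks of size `k`, position `p` of the new block `b` is filled
with position `srcPos b p` of the old block `srcBlock k b p`. -/
def srcBlock (k b p : ℕ) : ℕ :=
  if b = 0 then p else if p = 0 then (if b + 1 < k then b + 1 else 1) else if p = 1 then 0 else b

/-- The position from which position `p` of the new block `b` is filled; see `srcBlock`. -/
def srcPos (b p : ℕ) : ℕ :=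
  if b = 0 then (if p = 0 then 0 else 1) else if p = 0 then 0 else if p = 1 then b else p

theorem srcBlock_lt {k b p : ℕ} (hk : 3 ≤ k) (hb : b < k) (hp : p < k) : srcBlock k b p < k := by
  unfold srcBlock; split_ifs <;> omega

theorem srcPos_lt {k b p : ℕ} (hk : 3 ≤ k) (hb : b < k) (hp : p < k) : srcPos b p < k := by
  unfold srcPos; split_ifs <;> omega

theorem srcPos_eq_zero_iff {b p : ℕ} : srcPos b p = 0 ↔ p = 0 := by
  unfold srcPos; split_ifs <;> simp_all

/-- Block 0 keeps its position 0, and the other positions 0 move cyclically among the blocks 1, …,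
k-1. Position 1 of block p and position p of block 0 trade places for p ≥ 1, with the latter
arriving at position 1 of block p. Everything else stays, so the exchange loses and duplicates
nothing. -/
theorem src_injective {k b p b' p' : ℕ} (hb : b < k) (hb' : b' < k)
    (h : srcBlock k b p = srcBlock k b' p') (h' : srcPos b p = srcPos b' p') :
    b = b' ∧ p = p' := by
  unfold srcBlock at h; unfold srcPos at h'; split_ifs at h h' <;> omega

/-! ### The interface between combinatorics and algorithm -/

namespace KGraph

/-- The vertices outside a cleaner with slack `2 r`, with what the algorithm needs to know
about them. -/
structure Prepared {k n : ℕ} (H : KGraph k (Fin n)) (A C U : Finset (Fin n)) (r : ℕ) : Prop where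
  sub : U ⊆ A ∪ C
  balance : (k - 1) * (U ∩ A).card = (U \ A).card + 2 * k * r
  pair : ∀ Y ⊆ U, Y.card < 2 * k * r → ∃ e₁ ∈ H.edges, ∃ e₂ ∈ H.edges, Disjoint e₁ e₂ ∧
    e₁ ∪ e₂ ⊆ U \ Y ∧ ((e₁ ∪ e₂) ∩ A).card = 4
  exchange : ∀ (m : ℕ) (g : ℕ → ℕ → Fin n), k * m + 2 * k * r = U.card →
    (∀ b < m, ∀ p < k, ∀ b' < m, ∀ p' < k, g b p = g b' p' → b = b' ∧ p = p') →
    (∀ b < m, g b 0 ∈ A) → (∀ b < m, ∀ p < k, p ≠ 0 → g b p ∈ C) →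
    ∀ j < m, ∃ i : ℕ → ℕ, i 0 = j ∧ (∀ t < k, i t < m) ∧ (∀ s < k, ∀ t < k, i s = i t → s = t) ∧
      ∀ b < k, (Finset.range k).image (fun p => g (i (srcBlock k b p)) (srcPos b p)) ∈ H.edges

/-- The vertices with numbers `c 0, …, c (k - 1)` form an edge. -/
def IsEdge {k n : ℕ} [NeZero n] (H : KGraph k (Fin n)) (c : ℕ → ℕ) : Prop :=
  (Finset.range k).image (fun j => Fin.ofNat n (c j)) ∈ H.edges

theorem IsEdge.congr {k n : ℕ} [NeZero n] {H : KGraph k (Fin n)} {c d : ℕ → ℕ}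
    (h : H.IsEdge c) (hcd : ∀ j < k, d j = c j) : H.IsEdge d := by
  unfold IsEdge
  rwa [Finset.image_congr (g := fun j => Fin.ofNat n (c j))]
  intro j hj
  simp [hcd j (by simpa using hj)]

end KGraph

/-! ### The graph and the list of blocks in memory -/

namespace WordRAM
open scoped Classical in
/-- The state contains `n` and the adjacency table of `H`. -/
structure HasGraph {k n : ℕ} [NeZero n] (H : KGraph k (Fin n)) (s : State) : Prop where
  card : s.reg 0 = n
  table : ∀ c : ℕ → ℕ, (∀ j < k, c j < n) →
    s.arr 0 (∑ j ∈ Finset.range k, c j * n ^ j) = if H.IsEdge c then 1 else 0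

theorem HasGraph.congr {k n : ℕ} [NeZero n] {H : KGraph k (Fin n)} {s s' : State}
    (h : HasGraph H s) (h0 : s'.reg 0 = s.reg 0) (h1 : s'.arr 0 = s.arr 0) : HasGraph H s' :=
  ⟨h0 ▸ h.card, fun c hc => h1 ▸ h.table c hc⟩

theorem IsInput.hasGraph {k n : ℕ} [NeZero n] {H : KGraph k (Fin n)} {A B : Finset (Fin n)}
    {M : Finset (Finset (Fin n))} {s : State} (h : IsInput H A B M s) : HasGraph H s := by
  classical
  refine ⟨h.reg_zero, fun c hc => ?_⟩
  have h1 := h.table fun j => ⟨c j, hc j j.2⟩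
  rw [Finset.sum_range]
  refine h1.trans ?_
  have : Finset.univ.image (fun j : Fin k => (⟨c j, hc j j.2⟩ : Fin n)) =
      (Finset.range k).image (fun j => Fin.ofNat n (c j)) := by
    ext v
    simp only [Finset.mem_image, Finset.mem_univ, true_and, Finset.mem_range]
    constructor
    · rintro ⟨j, rfl⟩
      exact ⟨j, j.2, by ext; simp [Nat.mod_eq_of_lt (hc j j.2)]⟩
    · rintro ⟨j, hj, rfl⟩
      exact ⟨⟨j, hj⟩, by ext; simp [Nat.mod_eq_of_lt (hc j hj)]⟩
  unfold KGraph.IsEdge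
  rw [this]
  split_ifs <;> rfl

/-- The entry of the adjacency table at `c 0, …, c (k - 1)`. -/
def Expr.edge (k : ℕ) (c : ℕ → Expr) : Expr := .get 0 (.horner c k)

/-- The numerical conditions under which the program works: the word bound is large. -/
structure Large (k n W : ℕ) : Prop where
  three_le : 3 ≤ k
  le : 8 * k ^ 2 + 8 * k ≤ n
  lt : n ^ (2 * k + 1) < W

section
variable {k n W : ℕ} 

theorem Large.pow_lt (h : Large k n W) {m : ℕ} (hm : m ≤ 2 * k + 1) : n ^ m < W :=
  lt_of_le_of_lt (Nat.pow_le_pow_right (by have := h.le; have := h.three_le; nlinarith) hm) h.lt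

theorem Large.n_le (h : Large k n W) : 8 * k ≤ n := by have := h.le; omega

theorem Large.two_le (h : Large k n W) : 2 ≤ n := by have := h.n_le; have := h.three_le; omega

theorem Large.sq_lt (h : Large k n W) : n ^ 2 < W := h.pow_lt (by have := h.three_le; omega)

theorem Large.n_lt (h : Large k n W) : n < W := by
  have := h.pow_lt (m := 1) (by omega); simpa using this

theorem Large.two_mul_lt (h : Large k n W) : 2 * n < W := by
  have := h.sq_lt; have := h.two_le; nlinarith

open scoped Classical in
theorem HasGraph.evals_edge [NeZero n] {H : KGraph k (Fin n)} {s : State} (h : HasGraph H s)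
    (hW : Large k n W) {c : ℕ → Expr} {v : ℕ → ℕ} (hc : ∀ j < k, Evals W s (c j) (v j))
    (hv : ∀ j < k, v j < n) : Evals W s (.edge k c) (if H.IsEdge v then 1 else 0) :=
  .get (.horner h.card hW.two_le hW.n_lt (hW.pow_lt (by omega)) hc hv) (h.table v hv)
    (by have := hW.two_le; have := hW.n_lt; split_ifs <;> omega)

theorem HasGraph.tests_edge [NeZero n] {H : KGraph k (Fin n)} {s : State} (h : HasGraph H s)
    (hW : Large k n W) {c : ℕ → Expr} {v : ℕ → ℕ} (hc : ∀ j < k, Evals W s (c j) (v j))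
    (hv : ∀ j < k, v j < n) : Tests W s [.edge k c] (H.IsEdge v) := by
  classical
  exact (Tests.nonzero (h.evals_edge hW hc hv)).congr (by split_ifs <;> simp_all)

/-- The `t`-th digit of `τ` in base `n`. -/
def dig (n τ t : ℕ) : ℕ := τ / n ^ t % n

theorem dig_lt [NeZero n] (τ t : ℕ) : dig n τ t < n := Nat.mod_lt _ (Nat.pos_of_neZero n)

/-- By base-n expansion, a counter running up to n^m meets every m-tuple, so an exhaustive scan
misses nothing. -/
theorem exists_dig_eq [NeZero n] (m : ℕ) (d : ℕ → ℕ) (hd : ∀ t < m, d t < n) :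
    ∃ τ < n ^ m, ∀ t < m, dig n τ t = d t := by
  refine ⟨finFunctionFinEquiv (fun t : Fin m => (⟨d t, hd t t.2⟩ : Fin n)), Fin.is_lt _,
    fun t ht => ?_⟩
  have h := congrArg (fun f : Fin m → Fin n => (f ⟨t, ht⟩ : ℕ))
    (finFunctionFinEquiv.symm_apply_apply (fun t : Fin m => (⟨d t, hd t t.2⟩ : Fin n)))
  exact h

/-- The state at a time when a family of blocks has been written: register 2 holds their number,
array 3 their vertices, and array 1 the labels of the vertices: `4 k` for a vertex that is not
available any more, and otherwise `0` or `2`. -/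
structure Emitted [NeZero n] (H : KGraph k (Fin n)) (A U avail : Finset (Fin n)) (s : State) :
    Prop extends HasGraph H s where
  avail_sub : avail ⊆ U
  label : ∀ v : Fin n, s.arr 1 v = if v ∈ avail then (if v ∈ A then 0 else 2) else 4 * k
  -- This is demanded of all cells and not only of those in use, because the search for exchanges
  -- reads cells before the block numbers have been checked.
  lt : ∀ x, s.arr 3 x < n
  inj : ∀ x < s.reg 2 * k, ∀ y < s.reg 2 * k, s.arr 3 x = s.arr 3 y → x = y
  mem : ∀ v : Fin n, (v ∈ U ∧ v ∉ avail) ↔ ∃ x < s.reg 2 * k, s.arr 3 x = v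

variable [NeZero n] {H : KGraph k (Fin n)} {A U avail : Finset (Fin n)} {s s' : State}

theorem Emitted.congr (h : Emitted H A U avail s) (h0 : s'.reg 0 = s.reg 0)
    (h2 : s'.reg 2 = s.reg 2) (ha0 : s'.arr 0 = s.arr 0) (ha1 : s'.arr 1 = s.arr 1)
    (ha3 : s'.arr 3 = s.arr 3) : Emitted H A U avail s' where
  toHasGraph := h.toHasGraph.congr h0 ha0
  avail_sub := h.avail_sub
  label := ha1 ▸ h.label
  lt := ha3 ▸ h.lt
  inj := by rw [h2, ha3]; exact h.inj
  mem := by rw [h2, ha3]; exact h.mem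

theorem Emitted.setReg (h : Emitted H A U avail s) {x v : ℕ} (h0 : x ≠ 0) (h2 : x ≠ 2) :
    Emitted H A U avail (s.setReg x v) :=
  h.congr (by simp [State.setReg, Function.update_of_ne h0.symm])
    (by simp [State.setReg, Function.update_of_ne h2.symm]) rfl rfl rfl

theorem Emitted.card_used (h : Emitted H A U avail s) : (U \ avail).card = s.reg 2 * k := by
  have : U \ avail = (Finset.range (s.reg 2 * k)).image (fun x => Fin.ofNat n (s.arr 3 x)) := by
    ext v
    rw [Finset.mem_sdiff, h.mem]
    simp only [Finset.mem_image, Finset.mem_range]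
    refine exists_congr fun x => and_congr_right fun _ => ?_
    rw [Fin.ext_iff, Fin.val_ofNat, Nat.mod_eq_of_lt (h.lt x)]
  rw [this, Finset.card_image_of_injOn, Finset.card_range]
  intro x hx y hy hxy
  simp only [Fin.ext_iff, Fin.val_ofNat, Nat.mod_eq_of_lt (h.lt _)] at hxy
  exact h.inj x (by simpa using hx) y (by simpa using hy) hxy

theorem Emitted.card_add (h : Emitted H A U avail s) : s.reg 2 * k + avail.card = U.card := by
  rw [← h.card_used, Finset.card_sdiff_add_card_eq_card h.avail_sub]

theorem Emitted.reg_two_mul_le (h : Emitted H A U avail s) : s.reg 2 * k ≤ n := by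
  rw [← h.card_used]; exact (Finset.card_le_univ _).trans (by simp)

/-- Write the blocks given by the first `μ k` digits of the number in register 3. -/
def emit (k μ : ℕ) : Prog :=
  .seq (storeMany 3 (fun t => .op .add (.op .mul (.reg 2) (.lit k)) (.lit t)) .digit (μ * k))
    (.seq (storeMany 1 .digit (fun _ => .lit (4 * k)) (μ * k))
      (.set 2 (.op .add (.reg 2) (.lit μ))))

theorem emit_loopFree (μ : ℕ) : (emit k μ).LoopFree :=
  ⟨storeMany_loopFree _ _ _ _, storeMany_loopFree _ _ _ _, trivial⟩

/-- The vertices listed earlier are unavailable and the new ones are available, so the list stays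
free of repetitions. Marking the new vertices keeps the list and the labels in step. -/
theorem Emitted.emit (hW : Large k n W) (h : Emitted H A U avail s) {τ μ : ℕ} (hμ : μ ≤ 2)
    (hτ : s.reg 3 = τ) (hτW : τ < W)
    (hinj : ∀ i < μ * k, ∀ j < μ * k, dig n τ i = dig n τ j → i = j)
    (hav : ∀ t < μ * k, Fin.ofNat n (dig n τ t) ∈ avail) :
    Runs W (emit k μ) s fun s' =>
      Emitted H A U (avail \ (Finset.range (μ * k)).image (fun t => Fin.ofNat n (dig n τ t))) s' ∧
      s'.reg = Function.update s.reg 2 (s.reg 2 + μ) ∧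
      (∀ x < s.reg 2 * k, s'.arr 3 x = s.arr 3 x) ∧
      ∀ t < μ * k, s'.arr 3 (s.reg 2 * k + t) = dig n τ t := by
  have hRk := h.reg_two_mul_le
  have h3 := hW.three_le
  have hn8 := hW.n_le
  have hn2 := hW.two_mul_lt
  have hR : s.reg 2 ≤ n := le_trans (Nat.le_mul_of_pos_right _ (by omega)) hRk
  have hμk : μ * k ≤ 2 * k := Nat.mul_le_mul_right _ hμ
  have hval : ∀ t, (Fin.ofNat n (dig n τ t) : ℕ) = dig n τ t := fun t => by
    rw [Fin.val_ofNat, Nat.mod_eq_of_lt (dig_lt _ _)]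
  refine .seq ((Runs.storeMany (I := fun t => s.reg 2 * k + t) (V := dig n τ) ?_ ?_).mono ?_)
  · intro t ht s' hr _
    refine ⟨.add (.mul (.reg (by rw [hr]) (by omega)) (.lit (by omega)) (by omega))
      (.lit (by omega)) (by omega), ?_⟩
    exact .digit (by rw [hr]; exact h.card) (by rw [hr]; exact hτ) hW.n_lt hτW
  · intro i _ j _ hij; simpa using hij
  rintro s₁ ⟨hr₁, ha₁, hn₁, ho₁⟩
  refine .seq ((Runs.storeMany (I := dig n τ) (V := fun _ => 4 * k) ?_ hinj).mono ?_)
  · intro t ht s' hr _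
    refine ⟨?_, .lit (by omega)⟩
    exact .digit (by rw [hr, hr₁]; exact h.card) (by rw [hr, hr₁]; exact hτ) hW.n_lt hτW
  rintro s₂ ⟨hr₂, ha₂, hn₂, ho₂⟩
  rw [hr₁] at hr₂
  have hle : s.reg 2 + μ < W := by omega
  refine .set (v := s.reg 2 + μ) (.add (.reg (by rw [hr₂]) (by omega)) (.lit (by omega)) hle) ?_
  have hreg : (s₂.setReg 2 (s.reg 2 + μ)).reg = Function.update s.reg 2 (s.reg 2 + μ) := by
    simp [State.setReg, hr₂]
  have h3eq : s₂.arr 3 = s₁.arr 3 := ha₂ 3 (by omega)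
  have h1eq : s₁.arr 1 = s.arr 1 := ha₁ 1 (by omega)
  have hold : ∀ x < s.reg 2 * k, s₂.arr 3 x = s.arr 3 x := fun x hx => by
    rw [h3eq]; exact ho₁ x fun i _ => by omega
  have hnew : ∀ t < μ * k, s₂.arr 3 (s.reg 2 * k + t) = dig n τ t := fun t ht => by
    rw [h3eq]; exact hn₁ t ht
  have hcase : ∀ x < (s.reg 2 + μ) * k, x < s.reg 2 * k ∨ ∃ t < μ * k, x = s.reg 2 * k + t := by
    intro x hx
    rw [Nat.add_mul] at hx
    rcases lt_or_ge x (s.reg 2 * k) with h' | h'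
    · exact .inl h'
    · exact .inr ⟨x - s.reg 2 * k, by omega, by omega⟩
  have hfresh : ∀ x < s.reg 2 * k, ∀ t < μ * k, s.arr 3 x ≠ dig n τ t := by
    intro x hx t ht he
    exact ((h.mem (Fin.ofNat n (dig n τ t))).2 ⟨x, hx, by rw [he, hval]⟩).2 (hav t ht)
  refine ⟨⟨⟨?_, ?_⟩, ?_, ?_, ?_, ?_, ?_⟩, hreg, hold, hnew⟩
  · rw [hreg]; simpa using h.card
  · have : s₂.arr 0 = s.arr 0 := by rw [ha₂ 0 (by omega), ha₁ 0 (by omega)]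
    simpa [State.setReg, this] using h.table
  · exact Finset.sdiff_subset.trans h.avail_sub
  · intro v
    change s₂.arr 1 v = _
    by_cases hv : ∃ t < μ * k, dig n τ t = v
    · obtain ⟨t, ht, htv⟩ := hv
      rw [← htv, hn₂ t ht, if_neg]
      simp only [Finset.mem_sdiff, Finset.mem_image, Finset.mem_range, not_and, not_not]
      exact fun _ => ⟨t, ht, by ext; rw [hval, htv]⟩
    · rw [ho₂ v fun i hi e => hv ⟨i, hi, e⟩, h1eq, h.label v]
      have : v ∉ (Finset.range (μ * k)).image (fun t => Fin.ofNat n (dig n τ t)) := by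
        simp only [Finset.mem_image, Finset.mem_range, not_exists, not_and]
        rintro t ht rfl
        exact hv ⟨t, ht, (hval t).symm⟩
      simp only [Finset.mem_sdiff, this, not_false_eq_true, and_true]
  · intro x
    change s₂.arr 3 x < n
    by_cases hx : ∃ t < μ * k, s.reg 2 * k + t = x
    · obtain ⟨t, ht, rfl⟩ := hx
      rw [hnew t ht]; exact dig_lt _ _
    · rw [h3eq, ho₁ x fun i hi e => hx ⟨i, hi, e⟩]; exact h.lt x
  · intro x hx y hy hxy
    rw [hreg] at hx hy
    simp only [Function.update_self] at hx hy
    change s₂.arr 3 x = s₂.arr 3 y at hxy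
    rcases hcase x hx with hx | ⟨t, ht, rfl⟩ <;> rcases hcase y hy with hy | ⟨u, hu, rfl⟩
    · rw [hold x hx, hold y hy] at hxy; exact h.inj x hx y hy hxy
    · rw [hold x hx, hnew u hu] at hxy; exact (hfresh x hx u hu hxy).elim
    · rw [hold y hy, hnew t ht] at hxy; exact (hfresh y hy t ht hxy.symm).elim
    · rw [hnew t ht, hnew u hu] at hxy; rw [hinj t ht u hu hxy]
  · intro v
    rw [hreg]
    simp only [Function.update_self, Finset.mem_sdiff, Finset.mem_image, Finset.mem_range, not_and,
      not_not]
    change _ ↔ ∃ x < _, s₂.arr 3 x = v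
    constructor
    · rintro ⟨hvU, hv⟩
      by_cases hva : v ∈ avail
      · obtain ⟨t, ht, rfl⟩ := hv hva
        exact ⟨s.reg 2 * k + t, by rw [Nat.add_mul]; omega, by rw [hnew t ht, hval]⟩
      · obtain ⟨x, hx, hxv⟩ := (h.mem v).1 ⟨hvU, hva⟩
        exact ⟨x, by rw [Nat.add_mul]; omega, by rw [hold x hx, hxv]⟩
    · rintro ⟨x, hx, hxv⟩
      rcases hcase x hx with hx | ⟨t, ht, rfl⟩
      · rw [hold x hx] at hxv
        obtain ⟨h5, h6⟩ := (h.mem v).2 ⟨x, hx, hxv⟩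
        exact ⟨h5, fun h7 => (h6 h7).elim⟩
      · rw [hnew t ht] at hxv
        have : Fin.ofNat n (dig n τ t) = v := by ext; rw [hval, hxv]
        exact ⟨h.avail_sub (this ▸ hav t ht), fun _ => ⟨t, ht, this⟩⟩

end
end WordRAM

theorem Finset.exists_enumeration {V : Type*} [DecidableEq V] [Inhabited V] {e : Finset V} {k : ℕ}
    (he : e.card = k) :
    ∃ c : ℕ → V, (∀ i < k, ∀ j < k, c i = c j → i = j) ∧ (Finset.range k).image c = e := by
  let f := e.equivFinOfCardEq he
  refine ⟨fun i => if h : i < k then (f.symm ⟨i, h⟩ : V) else default, ?_, ?_⟩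
  · intro i hi j hj hij
    simp only [hi, hj, dif_pos] at hij
    simpa using f.symm.injective (Subtype.ext hij)
  · ext v
    simp only [Finset.mem_image, Finset.mem_range]
    constructor
    · rintro ⟨i, hi, rfl⟩
      simp [hi]
    · intro hv
      exact ⟨f ⟨v, hv⟩, (f ⟨v, hv⟩).2, by simp⟩

theorem Fin.ofNat_val_eq {n : ℕ} [NeZero n] (v : Fin n) : Fin.ofNat n (v : ℕ) = v := by
  ext; simp

namespace WordRAM

theorem State.setReg_reg (s : State) (x v y : ℕ) :
    (s.setReg x v).reg y = if y = x then v else s.reg y := by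
  simp [State.setReg, Function.update_apply]

theorem State.setReg_arr (s : State) (x v : ℕ) : (s.setReg x v).arr = s.arr := rfl

section
variable {k n W : ℕ} [NeZero n] {H : KGraph k (Fin n)} {A C U avail : Finset (Fin n)}
  {s s' : State} {τ r : ℕ}

/-- The label of the vertex `v`. -/
def lab (k : ℕ) (A avail : Finset (Fin n)) (v : Fin n) : ℕ :=
  if v ∈ avail then (if v ∈ A then 0 else 2) else 4 * k

omit [NeZero n] in
theorem lab_le (hk : 3 ≤ k) (v : Fin n) : lab k A avail v ≤ 4 * k := by
  unfold lab; split_ifs <;> omega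

theorem Emitted.evals_digit (hW : Large k n W) (h : Emitted H A U avail s) (hτ : s.reg 3 = τ)
    (hτW : τ < W) (t : ℕ) : Evals W s (.digit t) (dig n τ t) :=
  .digit h.card hτ hW.n_lt hτW

theorem Emitted.evals_label (hW : Large k n W) (h : Emitted H A U avail s) (hτ : s.reg 3 = τ)
    (hτW : τ < W) (t : ℕ) :
    Evals W s (.get 1 (.digit t)) (lab k A avail (Fin.ofNat n (dig n τ t))) := by
  refine .get (h.evals_digit hW hτ hτW t) ?_ ?_
  · have := h.label (Fin.ofNat n (dig n τ t))
    rw [Fin.val_ofNat, Nat.mod_eq_of_lt (dig_lt _ _)] at this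
    exact this
  · have h1 := lab_le (A := A) (avail := avail) hW.three_le (Fin.ofNat n (dig n τ t))
    have := hW.n_le
    have := hW.two_mul_lt
    have := hW.three_le
    omega

theorem ofNat_injOn {m : ℕ} {d : ℕ → ℕ} (hd : ∀ t, d t < n)
    (h : ∀ i < m, ∀ j < m, d i = d j → i = j) :
    Set.InjOn (fun t => Fin.ofNat n (d t)) (Finset.range m : Set ℕ) := by
  intro i hi j hj hij
  simp only [Fin.ext_iff, Fin.val_ofNat, Nat.mod_eq_of_lt (hd _)] at hij
  exact h i (by simpa using hi) j (by simpa using hj) hij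

theorem card_sdiff_inter {α : Type*} [DecidableEq α] {a b c : Finset α} (h : b ⊆ a) :
    ((a \ b) ∩ c).card + (b ∩ c).card = (a ∩ c).card := by
  rw [← Finset.card_union_of_disjoint]
  · congr 1
    ext x
    simp only [Finset.mem_union, Finset.mem_inter, Finset.mem_sdiff]
    have := @h x
    tauto
  · exact (Finset.sdiff_disjoint.mono Finset.inter_subset_left Finset.inter_subset_left)

theorem card_sdiff_sdiff {α : Type*} [DecidableEq α] {a b c : Finset α} (h : b ⊆ a) :
    ((a \ b) \ c).card + (b \ c).card = (a \ c).card := by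
  rw [← Finset.card_union_of_disjoint]
  · congr 1
    ext x
    simp only [Finset.mem_union, Finset.mem_sdiff]
    have := @h x
    tauto
  · exact (Finset.sdiff_disjoint.mono Finset.sdiff_subset Finset.sdiff_subset)

/-! ### Reducing the slack -/

/-- `d` lists the vertices of two disjoint edges on available vertices, with four vertices
in `A` altogether. -/
structure IsMove (H : KGraph k (Fin n)) (A avail : Finset (Fin n)) (d : ℕ → ℕ) : Prop where
  inj : ∀ i < 2 * k, ∀ j < 2 * k, d i = d j → i = j
  edge₁ : H.IsEdge d
  edge₂ : H.IsEdge fun j => d (k + j)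
  sum : ∑ t ∈ Finset.range (2 * k), lab k A avail (Fin.ofNat n (d t)) = 4 * k - 8

/-- The label 4k of a single unavailable vertex already exceeds the prescribed sum 4k - 8. One test
on the sum thus checks both availability and the number of vertices in A. -/
theorem IsMove.mem {d : ℕ → ℕ} (hk : 3 ≤ k) (h : IsMove H A avail d) {t : ℕ} (ht : t < 2 * k) :
    Fin.ofNat n (d t) ∈ avail := by
  by_contra hn
  have h1 := Finset.single_le_sum (f := fun t => lab k A avail (Fin.ofNat n (d t)))
    (fun _ _ => Nat.zero_le _) (Finset.mem_range.2 ht)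
  rw [h.sum] at h1
  simp only [lab, if_neg hn] at h1
  omega

/-- The available set only shrinks, so a tuple that was rejected can never become a move later. This
is why a single pass over all tuples is enough. -/
theorem IsMove.mono {d : ℕ → ℕ} {avail' : Finset (Fin n)} (hk : 3 ≤ k)
    (h : IsMove H A avail' d) (hs : avail' ⊆ avail) : IsMove H A avail d where
  inj := h.inj
  edge₁ := h.edge₁
  edge₂ := h.edge₂
  sum := by
    rw [← h.sum]
    refine Finset.sum_congr rfl fun t ht => ?_
    have := h.mem hk (Finset.mem_range.1 ht)
    simp only [lab, if_pos this, if_pos (hs this)]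

/-- All labels are 0 or 2, so the sum 4k - 8 means 2k - 4 vertices outside A and four inside. -/
theorem IsMove.card_sdiff {d : ℕ → ℕ} (hd : ∀ t, d t < n) (hk : 3 ≤ k)
    (h : IsMove H A avail d) :
    ((Finset.range (2 * k)).image (fun t => Fin.ofNat n (d t)) \ A).card = 2 * k - 4 ∧
    ((Finset.range (2 * k)).image (fun t => Fin.ofNat n (d t)) ∩ A).card = 4 := by
  set D := (Finset.range (2 * k)).image (fun t => Fin.ofNat n (d t)) with hD
  have hinj := ofNat_injOn hd h.inj
  have h1 : D.card = 2 * k := by rw [hD, Finset.card_image_of_injOn hinj, Finset.card_range]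
  have h2 : ∑ v ∈ D, (if v ∈ A then 0 else 2) = 4 * k - 8 := by
    rw [← h.sum, hD, Finset.sum_image hinj]
    refine Finset.sum_congr rfl fun t ht => ?_
    simp only [lab, if_pos (h.mem hk (Finset.mem_range.1 ht))]
  rw [Finset.sum_ite, Finset.sum_const_zero, Finset.sum_const, ← Finset.sdiff_eq_filter,
    smul_eq_mul] at h2
  have h3 := Finset.card_sdiff_add_card_inter D A
  omega

def moveTests (k : ℕ) : List Expr :=
  [.reg 4] ++ (distinct .digit (2 * k) ++ ([.edge k .digit] ++
    ([.edge k fun j => .digit (k + j)] ++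
      [.op .eq (.sum (fun t => .get 1 (.digit t)) (2 * k)) (.lit (4 * k - 8))])))

def moveStep (k : ℕ) : Prog :=
  guards (moveTests k) (.seq (emit k 2) (.set 4 (.op .sub (.reg 4) (.lit 1))))

def moves (k : ℕ) : Prog := forTo 3 (.pow (2 * k)) (moveStep k)

theorem Emitted.tests_move (hW : Large k n W) (h : Emitted H A U avail s) (hτ : s.reg 3 = τ)
    (hτW : τ < W) (h4 : s.reg 4 < W) :
    Tests W s (moveTests k) (s.reg 4 ≠ 0 ∧ IsMove H A avail (dig n τ)) := by
  have hd := h.evals_digit hW hτ hτW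
  have hW1 : 1 < W := by have := hW.two_le; have := hW.n_lt; omega
  have hlit : 4 * k - 8 < W := by have := hW.n_le; have := hW.n_lt; omega
  -- The sum is at most 2k · 4k = 8k², which is at most n by `Large.le`.
  have hsum : ∑ t ∈ Finset.range (2 * k), lab k A avail (Fin.ofNat n (dig n τ t)) < W := by
    refine lt_of_le_of_lt (Finset.sum_le_card_nsmul _ _ (4 * k)
      fun t _ => lab_le hW.three_le _) ?_
    have := hW.le; have := hW.n_lt
    simp only [Finset.card_range, smul_eq_mul]
    nlinarith
  refine ((Tests.nonzero (.reg rfl h4)).append ((Tests.distinct (fun i _ => hd i) hW1).append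
    ((h.tests_edge hW (fun i _ => hd i) fun i _ => dig_lt _ _).append
    ((h.tests_edge hW (fun i _ => hd (k + i)) fun i _ => dig_lt _ _).append
    (Tests.eq (.sum hsum fun t _ => h.evals_label hW hτ hτW t) (.lit hlit) hW1))))).congr ?_
  exact and_congr_right fun _ => ⟨fun ⟨h1, h2, h3, h4⟩ => ⟨h1, h2, h3, h4⟩,
    fun ⟨h1, h2, h3, h4⟩ => ⟨h1, h2, h3, h4⟩⟩

/-- `Prepared.pair`, applied with the used vertices as the set to avoid, gives two edges. Listing
the first and then the second gives the digits of τ. -/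
theorem exists_isMove (hk : 3 ≤ k) (hP : H.Prepared A C U r) (hsub : avail ⊆ U)
    (hc : (U \ avail).card < 2 * k * r) : ∃ τ < n ^ (2 * k), IsMove H A avail (dig n τ) := by
  obtain ⟨e₁, he₁, e₂, he₂, hdisj, hU, h4⟩ := hP.pair (U \ avail) Finset.sdiff_subset hc
  rw [Finset.sdiff_sdiff_eq_self hsub] at hU
  have : Inhabited (Fin n) := ⟨Fin.ofNat n 0⟩
  obtain ⟨c₁, hi₁, hc₁⟩ := Finset.exists_enumeration (H.card_eq e₁ he₁)
  obtain ⟨c₂, hi₂, hc₂⟩ := Finset.exists_enumeration (H.card_eq e₂ he₂)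
  let d : ℕ → Fin n := fun t => if t < k then c₁ t else c₂ (t - k)
  obtain ⟨τ, hτ, hdig⟩ := exists_dig_eq (n := n) (2 * k) (fun t => (d t : ℕ)) fun t _ => (d t).2
  have hof : ∀ t < 2 * k, Fin.ofNat n (dig n τ t) = d t := fun t ht => by
    rw [hdig t ht, Fin.ofNat_val_eq]
  have hmem₁ : ∀ t < k, c₁ t ∈ e₁ := fun t ht =>
    hc₁ ▸ Finset.mem_image_of_mem _ (Finset.mem_range.2 ht)
  have hmem₂ : ∀ t < k, c₂ t ∈ e₂ := fun t ht =>
    hc₂ ▸ Finset.mem_image_of_mem _ (Finset.mem_range.2 ht)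
  have hinj : ∀ i < 2 * k, ∀ j < 2 * k, d i = d j → i = j := by
    intro i hi j hj hij
    simp only [d] at hij
    split_ifs at hij with h1 h2 h2
    · exact hi₁ i h1 j h2 hij
    · exact (Finset.disjoint_left.1 hdisj (hmem₁ i h1)
        (hij ▸ hmem₂ (j - k) (by omega))).elim
    · exact (Finset.disjoint_left.1 hdisj (hmem₁ j h2)
        (hij ▸ hmem₂ (i - k) (by omega))).elim
    · have := hi₂ (i - k) (by omega) (j - k) (by omega) hij; omega
  have himage : (Finset.range (2 * k)).image d = e₁ ∪ e₂ := by
    ext v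
    rw [← hc₁, ← hc₂]
    simp only [Finset.mem_union, Finset.mem_image, Finset.mem_range]
    constructor
    · rintro ⟨t, ht, rfl⟩
      by_cases h : t < k
      · exact .inl ⟨t, h, by simp [d, h]⟩
      · exact .inr ⟨t - k, by omega, by simp [d, h]⟩
    · rintro (⟨t, ht, rfl⟩ | ⟨t, ht, rfl⟩)
      · exact ⟨t, by omega, by simp [d, ht]⟩
      · exact ⟨k + t, by omega, by simp [d]⟩
  refine ⟨τ, hτ, ⟨fun i hi j hj hij => hinj i hi j hj ?_, ?_, ?_, ?_⟩⟩
  · rw [← hof i hi, ← hof j hj, hij]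
  · unfold KGraph.IsEdge
    rw [Finset.image_congr (g := c₁), hc₁]
    · exact he₁
    · intro t ht
      have ht : t < k := by simpa using ht
      simp only [hof t (by omega), d, if_pos ht]
  · unfold KGraph.IsEdge
    rw [Finset.image_congr (g := c₂), hc₂]
    · exact he₂
    · intro t ht
      have ht : t < k := by simpa using ht
      simp only [hof (k + t) (by omega), d]
      simp
  · have h1 : ∑ t ∈ Finset.range (2 * k), lab k A avail (Fin.ofNat n (dig n τ t)) =
        ∑ v ∈ e₁ ∪ e₂, if v ∈ A then 0 else 2 := by
      rw [← himage, Finset.sum_image fun i hi j hj =>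
        hinj i (by simpa using hi) j (by simpa using hj)]
      refine Finset.sum_congr rfl fun t ht => ?_
      have ht' := Finset.mem_range.1 ht
      have hm : d t ∈ avail := hU (himage ▸ Finset.mem_image_of_mem _ ht)
      rw [hof t ht']
      simp only [lab, if_pos hm]
    rw [h1, Finset.sum_ite, Finset.sum_const_zero, Finset.sum_const, ← Finset.sdiff_eq_filter,
      smul_eq_mul]
    have h2 := Finset.card_sdiff_add_card_inter (e₁ ∪ e₂) A
    rw [h4, Finset.card_union_of_disjoint hdisj, H.card_eq _ he₁, H.card_eq _ he₂] at h2
    omega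

theorem Emitted.isEdge_of_emit (μ : ℕ) {f : ℕ → ℕ} {R : ℕ}
    (hold : ∀ b < R, H.IsEdge fun j => f (b * k + j)) {f' d : ℕ → ℕ}
    (h1 : ∀ x < R * k, f' x = f x) (h2 : ∀ t < μ * k, f' (R * k + t) = d t)
    (hnew : ∀ b < μ, H.IsEdge fun j => d (b * k + j)) :
    ∀ b < R + μ, H.IsEdge fun j => f' (b * k + j) := by
  intro b hb
  rcases lt_or_ge b R with h | h
  · refine (hold b h).congr fun j hj => h1 _ ?_
    have : (b + 1) * k ≤ R * k := Nat.mul_le_mul_right _ h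
    rw [Nat.add_mul] at this; omega
  · obtain ⟨c, rfl⟩ := Nat.exists_eq_add_of_le h
    refine (hnew c (by omega)).congr fun j hj => ?_
    rw [← h2, Nat.add_mul, Nat.add_assoc]
    have : (c + 1) * k ≤ μ * k := Nat.mul_le_mul_right _ (by omega)
    rw [Nat.add_mul] at this; omega

/-- The loop invariant of `moves`. -/
structure MovesInv (H : KGraph k (Fin n)) (A U : Finset (Fin n)) (r τ : ℕ)
    (avail : Finset (Fin n)) (s : State) : Prop extends Emitted H A U avail s where
  counter : s.reg 3 = τ
  count : s.reg 2 + 2 * s.reg 4 = 2 * r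
  edges : ∀ b < s.reg 2, H.IsEdge fun j => s.arr 3 (b * k + j)
  balance : (k - 1) * (avail ∩ A).card = (avail \ A).card + 2 * k * s.reg 4
  -- When register 4 reaches zero every tuple is skipped, so from then on a rejection says nothing
  -- about moves.
  greedy : s.reg 4 = 0 ∨ ∀ τ' < τ, ¬ IsMove H A avail (dig n τ')

theorem MovesInv.next (h : MovesInv H A U r τ avail s)
    (hτ : s.reg 4 = 0 ∨ ¬ IsMove H A avail (dig n τ)) :
    MovesInv H A U r (τ + 1) avail (s.setReg 3 (τ + 1)) where
  toEmitted := h.toEmitted.setReg (by omega) (by omega)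
  counter := by simp [State.setReg_reg]
  count := by simpa [State.setReg_reg, State.setReg_arr] using h.count
  edges := by simpa [State.setReg_reg, State.setReg_arr] using h.edges
  balance := by simpa [State.setReg_reg, State.setReg_arr] using h.balance
  greedy := by
    simp only [State.setReg_reg, Nat.reduceEqDiff, reduceIte]
    rcases hτ with hτ | hτ
    · exact .inl hτ
    · refine h.greedy.imp_right fun hg τ' hτ' => ?_
      rcases Nat.lt_succ_iff_lt_or_eq.1 hτ' with h' | rfl
      · exact hg τ' h'
      · exact hτ

theorem MovesInv.step (hW : Large k n W) (hrW : r < W) (h : MovesInv H A U r τ avail s)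
    (hτW : τ < W) :
    Runs W (moveStep k) s fun s' => s'.reg 3 = τ ∧ ∃ avail',
      MovesInv H A U r (τ + 1) avail' (s'.setReg 3 (τ + 1)) := by
  have hk := hW.three_le
  have h4 : s.reg 4 < W := by have := h.count; omega
  refine Runs.tests (h.tests_move hW h.counter hτW h4) (fun ⟨h0, hm⟩ => ?_) fun hno => ?_
  · refine .seq ((h.toEmitted.emit hW le_rfl h.counter hτW hm.inj fun t ht =>
      hm.mem hk ht).mono ?_)
    rintro s₁ ⟨he, hr, hold, hnew⟩
    have hr4 : s₁.reg 4 = s.reg 4 := by rw [hr]; simp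
    have hr3 : s₁.reg 3 = τ := by rw [hr]; simpa using h.counter
    have hr2 : s₁.reg 2 = s.reg 2 + 2 := by rw [hr]; simp
    refine .set (v := s.reg 4 - 1) (.sub (.reg hr4 h4)
      (.lit (by have := hW.two_le; have := hW.n_lt; omega)) h4) ⟨?_,
        avail \ (Finset.range (2 * k)).image (fun t => Fin.ofNat n (dig n τ t)), ?_⟩
    · simpa [State.setReg_reg, State.setReg_arr] using hr3
    have hcount := h.count
    have hbal := h.balance
    obtain ⟨hc1, hc2⟩ := hm.card_sdiff (fun t => dig_lt τ t) hk
    have hsub : (Finset.range (2 * k)).image (fun t => Fin.ofNat n (dig n τ t)) ⊆ avail := by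
      intro v hv
      obtain ⟨t, ht, rfl⟩ := Finset.mem_image.1 hv
      exact hm.mem hk (Finset.mem_range.1 ht)
    have hc3 := card_sdiff_inter (c := A) hsub
    have hc4 := card_sdiff_sdiff (c := A) hsub
    refine ⟨(he.setReg (by omega) (by omega)).setReg (by omega) (by omega), ?_, ?_, ?_, ?_, ?_⟩
    · simp [State.setReg_reg]
    · simp only [State.setReg_reg, Nat.reduceEqDiff, reduceIte, hr2]
      omega
    · simp only [State.setReg_reg, State.setReg_arr, Nat.reduceEqDiff, reduceIte, hr2]
      refine Emitted.isEdge_of_emit 2 h.edges hold hnew fun b hb => ?_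
      interval_cases b
      · simpa using hm.edge₁
      · simpa using hm.edge₂
    · simp only [State.setReg_reg, Nat.reduceEqDiff, reduceIte]
      -- The left side of the balance drops by 4(k-1) and the cardinality on the right by 2k-4. The
      -- difference 2k is what lowering register 4 by one accounts for.
      obtain ⟨q, hq⟩ := Nat.exists_eq_succ_of_ne_zero h0
      obtain ⟨l, rfl⟩ : ∃ l, k = l + 1 := ⟨k - 1, by omega⟩
      rw [hc2] at hc3
      rw [hc1] at hc4
      rw [← hc3, ← hc4, hq] at hbal
      rw [hq]
      simp only [Nat.add_sub_cancel, Nat.succ_eq_add_one, Nat.mul_add, Nat.add_mul] at hbal ⊢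
      omega
    · refine .inr fun τ' hτ' hm' => ?_
      rcases Nat.lt_succ_iff_lt_or_eq.1 hτ' with h' | rfl
      · rcases h.greedy with h'' | h''
        · exact h0 h''
        · exact h'' τ' h' (hm'.mono hk Finset.sdiff_subset)
      · have := hm'.mem hk (t := 0) (by omega)
        exact (Finset.mem_sdiff.1 this).2
          (Finset.mem_image_of_mem _ (Finset.mem_range.2 (by omega)))
  · refine ⟨h.counter, avail, h.next ?_⟩
    by_contra hc
    push Not at hc
    exact hno hc

theorem moveStep_loopFree : (moveStep k).LoopFree :=
  guards_loopFree (p := .seq (emit k 2) (.set 4 (.op .sub (.reg 4) (.lit 1))))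
    ⟨emit_loopFree _, trivial⟩ _

/-- If register 4 were nonzero at the end, fewer than 2r blocks, hence fewer than 2kr vertices,
would be used. Then `exists_isMove` would give a move among the tuples that the scan has rejected.
-/
theorem Emitted.moves (hW : Large k n W) (hP : H.Prepared A C U r) (h : Emitted H A U U s)
    (hR : s.reg 2 = 0) (hr : s.reg 4 = r) :
    RunsIn W ((n ^ (2 * k) + 1) * ((moveStep k).bound + (Expr.pow (2 * k)).cost + 9))
      (moves k) s fun s' => ∃ avail,
      Emitted H A U avail s' ∧ s'.reg 2 = 2 * r ∧
      (∀ b < 2 * r, H.IsEdge fun j => s'.arr 3 (b * k + j)) ∧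
      (k - 1) * (avail ∩ A).card = (avail \ A).card := by
  have hk := hW.three_le
  -- The balance gives 2kr ≤ (k-1)|U ∩ A| ≤ kn.
  have hrW : r < W := by
    have h1 := hP.balance
    have h2 : (U ∩ A).card ≤ n := (Finset.card_le_univ _).trans (by simp)
    have h3 : (k - 1) * (U ∩ A).card ≤ k * n := Nat.mul_le_mul (by omega) h2
    have h4 : k * r ≤ k * n := by nlinarith
    exact lt_of_le_of_lt (Nat.le_of_mul_le_mul_left h4 (by omega)) hW.n_lt
  have hpow : n ^ (2 * k) + 1 < W := by
    have h1 := hW.lt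
    have h2 := hW.two_le
    have h3 : 0 < n ^ (2 * k) := Nat.pow_pos (by omega)
    rw [pow_succ] at h1
    nlinarith
  refine (RunsIn.forTo (Inv := fun τ s => ∃ avail, MovesInv H A U r τ avail s) hpow
    ⟨U, h.setReg (by omega) (by omega), ?_, ?_, ?_, ?_, ?_⟩ ?_ ?_).mono le_rfl ?_
  · simp [State.setReg_reg]
  · simp [State.setReg_reg, hR, hr]
  · simp [State.setReg_reg, State.setReg_arr, hR]
  · simpa [State.setReg_reg, State.setReg_arr, hr] using hP.balance
  · exact .inr fun τ' hτ' => by omega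
  · rintro τ s - ⟨avail, hs⟩
    exact ⟨hs.counter, .pow hs.card hW.two_le (by omega) hW.n_lt⟩
  · rintro τ s hτ ⟨avail, hs⟩
    exact (hs.step hW hrW (by omega)).runsIn moveStep_loopFree
  · rintro s' ⟨avail, hs⟩
    have h0 : s'.reg 4 = 0 := by
      by_contra h4
      have hcount := hs.count
      have hlt : (U \ avail).card < 2 * k * r := by
        rw [hs.card_used]
        have : s'.reg 2 < 2 * r := by omega
        have := Nat.mul_lt_mul_of_pos_right this (show 0 < k by omega)
        linarith
      obtain ⟨τ, hτ, hm⟩ := exists_isMove hk hP hs.avail_sub hlt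
      exact hs.greedy.elim h4 fun hg => hg τ hτ hm
    have hcount := hs.count
    rw [h0] at hcount
    have h2 : s'.reg 2 = 2 * r := by omega
    refine ⟨avail, hs.toEmitted, h2, h2 ▸ hs.edges, ?_⟩
    simpa [h0] using hs.balance
end
end WordRAM

namespace WordRAM
section
variable {k n W : ℕ} [NeZero n] {H : KGraph k (Fin n)} {A C U avail : Finset (Fin n)}
  {s s' : State} {τ r R₀ : ℕ}

/-! ### Completing the family of blocks -/

/-- `d` lists available vertices, one in `A` followed by `k - 1` not in `A`. -/
structure IsFill (k : ℕ) (A avail : Finset (Fin n)) (d : ℕ → ℕ) : Prop where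
  inj : ∀ i < k, ∀ j < k, d i = d j → i = j
  lab_eq : ∀ t < k, lab k A avail (Fin.ofNat n (d t)) = if t = 0 then 0 else 2

theorem IsFill.mem {d : ℕ → ℕ} (hk : 3 ≤ k) (h : IsFill k A avail d) {t : ℕ} (ht : t < k) :
    Fin.ofNat n (d t) ∈ avail := by
  by_contra hn
  have h1 := h.lab_eq t ht
  simp only [lab, if_neg hn] at h1
  split_ifs at h1 <;> omega

theorem IsFill.mem_iff {d : ℕ → ℕ} (hk : 3 ≤ k) (h : IsFill k A avail d) {t : ℕ} (ht : t < k) :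
    Fin.ofNat n (d t) ∈ A ↔ t = 0 := by
  have h1 := h.lab_eq t ht
  simp only [lab, if_pos (h.mem hk ht)] at h1
  split_ifs at h1 <;> simp_all

theorem IsFill.mono {d : ℕ → ℕ} {avail' : Finset (Fin n)} (hk : 3 ≤ k)
    (h : IsFill k A avail' d) (hs : avail' ⊆ avail) : IsFill k A avail d where
  inj := h.inj
  lab_eq t ht := by
    rw [← h.lab_eq t ht]
    have := h.mem hk ht
    simp only [lab, if_pos this, if_pos (hs this)]

def fillTests (k : ℕ) : List Expr :=
  distinct .digit k ++ (List.range k).flatMap fun t =>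
    [.op .eq (.get 1 (.digit t)) (.lit (if t = 0 then 0 else 2))]

def fillStep (k : ℕ) : Prog := guards (fillTests k) (emit k 1)

def fill (k : ℕ) : Prog := forTo 3 (.pow k) (fillStep k)

theorem Emitted.tests_fill (hW : Large k n W) (h : Emitted H A U avail s) (hτ : s.reg 3 = τ)
    (hτW : τ < W) : Tests W s (fillTests k) (IsFill k A avail (dig n τ)) := by
  have hd := h.evals_digit hW hτ hτW
  have h8 := hW.n_le
  have hn := hW.n_lt
  have hk := hW.three_le
  refine ((Tests.distinct (fun i _ => hd i) (by omega)).append (Tests.ofFn fun t _ =>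
    Tests.eq (h.evals_label hW hτ hτW t) (.lit (by split_ifs <;> omega)) (by omega))).congr ?_
  exact ⟨fun ⟨h1, h2⟩ => ⟨h1, h2⟩, fun ⟨h1, h2⟩ => ⟨h1, h2⟩⟩

/-- In a balanced set without vertices of A nothing lies outside A either. So a nonempty balanced
set has a vertex in A, and then at least k-1 vertices outside. -/
theorem exists_isFill (hk : 3 ≤ k) (hne : avail.Nonempty)
    (hbal : (k - 1) * (avail ∩ A).card = (avail \ A).card) :
    ∃ τ < n ^ k, IsFill k A avail (dig n τ) := by
  have h1 := Finset.card_sdiff_add_card_inter avail A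
  have h2 := hne.card_pos
  have h3 : 0 < (avail ∩ A).card := by
    by_contra h
    have h4 : (avail ∩ A).card = 0 := by omega
    rw [h4] at hbal; omega
  have h4 : k - 1 ≤ (avail \ A).card := hbal ▸ Nat.le_mul_of_pos_right _ h3
  obtain ⟨a, ha⟩ := Finset.card_pos.1 h3
  obtain ⟨Q, hQ, hQc⟩ := Finset.exists_subset_card_eq h4
  have : Inhabited (Fin n) := ⟨a⟩
  obtain ⟨c, hi, hc⟩ := Finset.exists_enumeration hQc
  rw [Finset.mem_inter] at ha
  have hcQ : ∀ t < k, t ≠ 0 → c (t - 1) ∈ avail ∧ c (t - 1) ∉ A := fun t ht h0 => by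
    have := hQ (hc ▸ Finset.mem_image_of_mem c (Finset.mem_range.2 (show t - 1 < k - 1 by omega)))
    exact Finset.mem_sdiff.1 this
  let d : ℕ → Fin n := fun t => if t = 0 then a else c (t - 1)
  obtain ⟨τ, hτ, hdig⟩ := exists_dig_eq (n := n) k (fun t => (d t : ℕ)) fun t _ => (d t).2
  refine ⟨τ, hτ, ⟨fun i hi' j hj hij => ?_, fun t ht => ?_⟩⟩
  · rw [hdig i hi', hdig j hj, ← Fin.ext_iff] at hij
    simp only [d] at hij
    split_ifs at hij with h5 h6 h6
    · omega
    · exact ((hcQ j hj h6).2 (hij ▸ ha.2)).elim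
    · exact ((hcQ i hi' h5).2 (hij ▸ ha.2)).elim
    · have := hi (i - 1) (by omega) (j - 1) (by omega) hij; omega
  · rw [hdig t ht, Fin.ofNat_val_eq]
    by_cases h0 : t = 0
    · simp [h0, d, lab, ha]
    · simp [h0, d, lab, hcQ t ht h0]

/-- From number `R₀` on, the blocks consist of a vertex in `A` and `k - 1` vertices not in `A`. -/
def Shaped (k : ℕ) (A U : Finset (Fin n)) (R₀ R : ℕ) (f : ℕ → ℕ) : Prop :=
  ∀ b < R, R₀ ≤ b → ∀ p < k,
    Fin.ofNat n (f (b * k + p)) ∈ U ∧ (Fin.ofNat n (f (b * k + p)) ∈ A ↔ p = 0)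

/-- The loop invariant of `fill`. -/
structure FillInv (H : KGraph k (Fin n)) (A U : Finset (Fin n)) (R₀ τ : ℕ)
    (avail : Finset (Fin n)) (s : State) : Prop extends Emitted H A U avail s where
  counter : s.reg 3 = τ
  start : s.reg 5 = R₀
  le : R₀ ≤ s.reg 2
  edges : ∀ b < R₀, H.IsEdge fun j => s.arr 3 (b * k + j)
  shaped : Shaped k A U R₀ (s.reg 2) (s.arr 3)
  balance : (k - 1) * (avail ∩ A).card = (avail \ A).card
  greedy : ∀ τ' < τ, ¬ IsFill k A avail (dig n τ')

theorem FillInv.step (hW : Large k n W) (h : FillInv H A U R₀ τ avail s) (hτW : τ < W) :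
    Runs W (fillStep k) s fun s' => s'.reg 3 = τ ∧ ∃ avail',
      FillInv H A U R₀ (τ + 1) avail' (s'.setReg 3 (τ + 1)) := by
  have hk := hW.three_le
  refine Runs.tests (h.tests_fill hW h.counter hτW) (fun hm => ?_) fun hno => ?_
  · refine (h.toEmitted.emit (μ := 1) hW (by omega) h.counter hτW (by simpa using hm.inj)
      fun t ht => hm.mem hk (by simpa using ht)).mono ?_
    rintro s₁ ⟨he, hr, hold, hnew⟩
    rw [Nat.one_mul] at he hnew
    have hr3 : s₁.reg 3 = τ := by rw [hr]; simpa using h.counter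
    have hr2 : s₁.reg 2 = s.reg 2 + 1 := by rw [hr]; simp
    have hr5 : s₁.reg 5 = R₀ := by rw [hr]; simpa using h.start
    refine ⟨hr3, avail \ (Finset.range k).image (fun t => Fin.ofNat n (dig n τ t)), ?_⟩
    have hinj := ofNat_injOn (fun t => dig_lt τ t) hm.inj
    have hsub : (Finset.range k).image (fun t => Fin.ofNat n (dig n τ t)) ⊆ avail := by
      intro v hv
      obtain ⟨t, ht, rfl⟩ := Finset.mem_image.1 hv
      exact hm.mem hk (Finset.mem_range.1 ht)
    have hc1 : ((Finset.range k).image (fun t => Fin.ofNat n (dig n τ t)) ∩ A).card = 1 := by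
      rw [Finset.card_eq_one]
      refine ⟨Fin.ofNat n (dig n τ 0), ?_⟩
      ext v
      simp only [Finset.mem_inter, Finset.mem_image, Finset.mem_range, Finset.mem_singleton]
      constructor
      · rintro ⟨⟨t, ht, rfl⟩, hA⟩
        rw [(hm.mem_iff hk ht).1 hA]
      · rintro rfl
        exact ⟨⟨0, by omega, rfl⟩, (hm.mem_iff hk (by omega)).2 rfl⟩
    have hc2 := Finset.card_sdiff_add_card_inter
      ((Finset.range k).image (fun t => Fin.ofNat n (dig n τ t))) A
    rw [Finset.card_image_of_injOn hinj, Finset.card_range, hc1] at hc2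
    have hc3 := card_sdiff_inter (c := A) hsub
    have hc4 := card_sdiff_sdiff (c := A) hsub
    have hbal := h.balance
    have hlt : ∀ b < s.reg 2, ∀ p < k, b * k + p < s.reg 2 * k := fun b hb p hp => by
      have : (b + 1) * k ≤ s.reg 2 * k := Nat.mul_le_mul_right _ hb
      rw [Nat.add_mul] at this; omega
    refine ⟨he.setReg (by omega) (by omega), ?_, ?_, ?_, ?_, ?_, ?_, ?_⟩
    · simp [State.setReg_reg]
    · simpa [State.setReg_reg] using hr5
    · have := h.le
      simp only [State.setReg_reg, Nat.reduceEqDiff, reduceIte, hr2]; omega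
    · intro b hb
      exact (h.edges b hb).congr fun j hj => hold _ (hlt b (hb.trans_le h.le) j hj)
    · intro b hb hb0 p hp
      simp only [State.setReg_reg, State.setReg_arr, Nat.reduceEqDiff, reduceIte, hr2] at hb ⊢
      rcases Nat.lt_succ_iff_lt_or_eq.1 hb with hb | rfl
      · rw [hold _ (hlt b hb p hp)]
        exact h.shaped b hb hb0 p hp
      · rw [hnew p hp]
        exact ⟨h.avail_sub (hm.mem hk hp), hm.mem_iff hk hp⟩
    · obtain ⟨l, rfl⟩ : ∃ l, k = l + 1 := ⟨k - 1, by omega⟩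
      rw [hc1] at hc3
      rw [← hc3, ← hc4] at hbal
      simp only [Nat.add_sub_cancel, Nat.mul_add] at hbal ⊢
      omega
    · intro τ' hτ' hm'
      rcases Nat.lt_succ_iff_lt_or_eq.1 hτ' with h' | rfl
      · exact h.greedy τ' h' (hm'.mono hk Finset.sdiff_subset)
      · have := hm'.mem hk (t := 0) (by omega)
        exact (Finset.mem_sdiff.1 this).2
          (Finset.mem_image_of_mem _ (Finset.mem_range.2 (by omega)))
  · refine ⟨h.counter, avail, h.setReg (by omega) (by omega), ?_, ?_, ?_, h.edges, ?_,
      h.balance, ?_⟩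
    · simp [State.setReg_reg]
    · simpa [State.setReg_reg] using h.start
    · simpa [State.setReg_reg] using h.le
    · simpa [State.setReg_reg, State.setReg_arr] using h.shaped
    · intro τ' hτ'
      rcases Nat.lt_succ_iff_lt_or_eq.1 hτ' with h' | rfl
      · exact h.greedy τ' h'
      · exact hno

theorem fillStep_loopFree : (fillStep k).LoopFree := guards_loopFree (emit_loopFree _) _

/-- All of `U` is split into blocks, and the blocks from number `R₀` on are shaped. -/
structure Complete (H : KGraph k (Fin n)) (A U : Finset (Fin n)) (R₀ : ℕ) (s : State) : Prop
    extends Emitted H A U ∅ s where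
  start : s.reg 5 = R₀
  start_le : R₀ ≤ s.reg 2
  edges : ∀ b < R₀, H.IsEdge fun j => s.arr 3 (b * k + j)
  shaped : Shaped k A U R₀ (s.reg 2) (s.arr 3)

/-- Each new block preserves the balance, so a nonempty remainder at the end would contain a fill
that the scan has rejected. -/
theorem Emitted.fill (hW : Large k n W) (h : Emitted H A U avail s)
    (hR : s.reg 2 = R₀) (h5 : s.reg 5 = R₀)
    (hedges : ∀ b < R₀, H.IsEdge fun j => s.arr 3 (b * k + j))
    (hbal : (k - 1) * (avail ∩ A).card = (avail \ A).card) :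
    RunsIn W ((n ^ k + 1) * ((fillStep k).bound + (Expr.pow k).cost + 9)) (fill k) s
      (Complete H A U R₀) := by
  have hk := hW.three_le
  have hpow : n ^ k + 1 < W := by
    have h1 := hW.pow_lt (m := k + 1) (by omega)
    have h2 := hW.two_le
    have h3 : 0 < n ^ k := Nat.pow_pos (by omega)
    rw [pow_succ] at h1
    nlinarith
  refine (RunsIn.forTo (Inv := fun τ s => ∃ avail, FillInv H A U R₀ τ avail s) hpow
    ⟨avail, h.setReg (by omega) (by omega), ?_, ?_, ?_, hedges, ?_, hbal, ?_⟩ ?_ ?_).mono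
    le_rfl ?_
  · simp [State.setReg_reg]
  · simpa [State.setReg_reg] using h5
  · simp [State.setReg_reg, hR]
  · intro b hb hb'
    simp only [State.setReg_reg, Nat.reduceEqDiff, reduceIte, hR] at hb
    omega
  · intro τ' hτ'; omega
  · rintro τ s - ⟨avail, hs⟩
    exact ⟨hs.counter, .pow hs.card hW.two_le (by omega) hW.n_lt⟩
  · rintro τ s hτ ⟨avail, hs⟩
    exact (hs.step hW (by omega)).runsIn fillStep_loopFree
  · rintro s' ⟨avail, hs⟩
    obtain rfl : avail = ∅ := by
      by_contra hne
      obtain ⟨τ, hτ, hm⟩ := exists_isFill hk (Finset.nonempty_iff_ne_empty.2 hne) hs.balance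
      exact hs.greedy τ hτ hm
    exact ⟨hs.toEmitted, hs.start, hs.le, hs.edges, hs.shaped⟩

end
end WordRAM

namespace WordRAM
section
variable {k n W : ℕ} [NeZero n] {H : KGraph k (Fin n)} {A C U : Finset (Fin n)}
  {s s' : State} {τ r R₀ R j : ℕ}

/-! ### Exchanges between blocks -/

/-- The blocks `B 0, …, B (k - 1)` can be exchanged, so that all of them, and in particular `B 0`,
become edges. -/
structure IsExchange (H : KGraph k (Fin n)) (R₀ R : ℕ) (f B : ℕ → ℕ) : Prop where
  not_edge : ¬ H.IsEdge fun p => f (B 0 * k + p)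
  lt : ∀ t < k, B t < R
  le : ∀ t < k, R₀ ≤ B t
  inj : ∀ i < k, ∀ j < k, B i = B j → i = j
  edges : ∀ b < k, H.IsEdge fun p => f (B (srcBlock k b p) * k + srcPos b p)

/-- `f'` results from `f` by the exchange between the blocks `B 0, …, B (k - 1)`. -/
structure Exchanged (k : ℕ) (f B f' : ℕ → ℕ) : Prop where
  new : ∀ b < k, ∀ p < k, f' (B b * k + p) = f (B (srcBlock k b p) * k + srcPos b p)
  old : ∀ x, (∀ b < k, B b ≠ x / k) → f' x = f x

theorem cell_lt {b p R : ℕ} (hb : b < R) (hp : p < k) : b * k + p < R * k := by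
  have : (b + 1) * k ≤ R * k := Nat.mul_le_mul_right _ hb
  rw [Nat.add_mul] at this; omega

theorem cell_div {b p : ℕ} (hp : p < k) : (b * k + p) / k = b := by
  rw [Nat.add_comm, Nat.add_mul_div_right _ _ (by omega), Nat.div_eq_of_lt hp, Nat.zero_add]

theorem cell_mod {b p : ℕ} (hp : p < k) : (b * k + p) % k = p := by
  rw [Nat.add_comm, Nat.add_mul_mod_self_right, Nat.mod_eq_of_lt hp]

theorem cell_inj {b p b' p' : ℕ} (hp : p < k) (hp' : p' < k) (h : b * k + p = b' * k + p') :
    b = b' ∧ p = p' := by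
  have h1 := congrArg (· / k) h
  have h2 := congrArg (· % k) h
  simp only [cell_div hp, cell_div hp', cell_mod hp, cell_mod hp'] at h1 h2
  exact ⟨h1, h2⟩

/-- An exchange permutes the cells in use: the map from a new cell to its source is injective by
`src_injective` and the distinctness of the blocks, and surjective by finiteness. Distinctness and
coverage of the listed vertices carry over along it. -/
theorem Exchanged.exists_perm {f B f' : ℕ → ℕ} (hk : 3 ≤ k) (hE : Exchanged k f B f')
    (hlt : ∀ t < k, B t < R) (hinj : ∀ i < k, ∀ j < k, B i = B j → i = j) :
    ∃ φ : ℕ → ℕ, (∀ x < R * k, φ x < R * k) ∧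
      (∀ x < R * k, ∀ y < R * k, φ x = φ y → x = y) ∧ (∀ x < R * k, f' x = f (φ x)) ∧
      ∀ y < R * k, ∃ x < R * k, φ x = y := by
  classical
  have hspec : ∀ x : ℕ, ∃ y, (∃ b < k, B b = x / k ∧
      y = B (srcBlock k b (x % k)) * k + srcPos b (x % k)) ∨ ((∀ b < k, B b ≠ x / k) ∧ y = x) := by
    intro x
    by_cases h : ∃ b < k, B b = x / k
    · obtain ⟨b, hb, hbx⟩ := h
      exact ⟨_, .inl ⟨b, hb, hbx, rfl⟩⟩
    · push Not at h
      exact ⟨x, .inr ⟨h, rfl⟩⟩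
  choose φ hφ using hspec
  have hx : ∀ x, x / k * k + x % k = x := fun x => Nat.div_add_mod' x k
  have hmod : ∀ x, x % k < k := fun x => Nat.mod_lt _ (by omega)
  have h1 : ∀ x < R * k, φ x < R * k := by
    intro x hxR
    rcases hφ x with ⟨b, hb, -, he⟩ | ⟨-, he⟩
    · rw [he]
      exact cell_lt (hlt _ (srcBlock_lt hk hb (hmod x))) (srcPos_lt hk hb (hmod x))
    · rwa [he]
  have h2 : ∀ x, ∀ y, φ x = φ y → x = y := by
    intro x y hxy
    rcases hφ x with ⟨b, hb, hbx, he⟩ | ⟨hn, he⟩ <;> rcases hφ y with ⟨c, hc, hcy, he'⟩ | ⟨hn', he'⟩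
    · rw [he, he'] at hxy
      obtain ⟨h3, h4⟩ := cell_inj (srcPos_lt hk hb (hmod x)) (srcPos_lt hk hc (hmod y)) hxy
      obtain ⟨rfl, h5⟩ := src_injective hb hc
        (hinj _ (srcBlock_lt hk hb (hmod x)) _ (srcBlock_lt hk hc (hmod y)) h3) h4
      rw [← hx x, ← hx y, h5, ← hbx, ← hcy]
    · refine (hn' _ (srcBlock_lt hk hb (hmod x)) ?_).elim
      rw [← he', ← hxy, he, cell_div (srcPos_lt hk hb (hmod x))]
    · refine (hn _ (srcBlock_lt hk hc (hmod y)) ?_).elim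
      rw [← he, hxy, he', cell_div (srcPos_lt hk hc (hmod y))]
    · rw [← he, ← he', hxy]
  refine ⟨φ, h1, fun x _ y _ => h2 x y, fun x _ => ?_, fun y hy => ?_⟩
  · rcases hφ x with ⟨b, hb, hbx, he⟩ | ⟨hn, he⟩
    · rw [he, ← hE.new b hb _ (hmod x), hbx, hx]
    · rw [he, hE.old x hn]
  · have h3 : (Finset.range (R * k)).image φ = Finset.range (R * k) := by
      refine Finset.eq_of_subset_of_card_le (fun z hz => ?_) ?_
      · obtain ⟨x, hx, rfl⟩ := Finset.mem_image.1 hz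
        exact Finset.mem_range.2 (h1 x (Finset.mem_range.1 hx))
      · rw [Finset.card_image_of_injective _ h2]
    have := Finset.mem_range.2 hy
    rw [← h3] at this
    obtain ⟨x, hx, rfl⟩ := Finset.mem_image.1 this
    exact ⟨x, Finset.mem_range.1 hx, rfl⟩

/-- Blocks that take part become edges and the others are untouched, so progress on earlier blocks
is never lost. -/
theorem Exchanged.isEdge {f B f' : ℕ → ℕ} (hE : Exchanged k f B f') (hX : IsExchange H R₀ R f B)
    {b : ℕ} (h : H.IsEdge fun p => f (b * k + p)) : H.IsEdge fun p => f' (b * k + p) := by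
  by_cases hb : ∃ t < k, B t = b
  · obtain ⟨t, ht, rfl⟩ := hb
    exact (hX.edges t ht).congr fun p hp => hE.new t ht p hp
  · push Not at hb
    exact h.congr fun p hp => hE.old _ fun t ht => by rw [cell_div hp]; exact hb t ht

theorem Exchanged.shaped {f B f' : ℕ → ℕ} (hk : 3 ≤ k) (hE : Exchanged k f B f')
    (hX : IsExchange H R₀ R f B) (h : Shaped k A U R₀ R f) : Shaped k A U R₀ R f' := by
  intro b hb hb' p hp
  by_cases hbt : ∃ t < k, B t = b
  · obtain ⟨t, ht, rfl⟩ := hbt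
    rw [hE.new t ht p hp, ← srcPos_eq_zero_iff (b := t) (p := p)]
    exact h _ (hX.lt _ (srcBlock_lt hk ht hp)) (hX.le _ (srcBlock_lt hk ht hp)) _
      (srcPos_lt hk ht hp)
  · push Not at hbt
    rw [hE.old _ fun t ht => by rw [cell_div hp]; exact hbt t ht]
    exact h b hb hb' p hp

theorem Complete.exchange (hk : 3 ≤ k) (h : Complete H A U R₀ s) {B : ℕ → ℕ}
    (hX : IsExchange H R₀ (s.reg 2) (s.arr 3) B) (hE : Exchanged k (s.arr 3) B (s'.arr 3))
    (hr : s'.reg = s.reg) (h0 : s'.arr 0 = s.arr 0) (h1 : s'.arr 1 = s.arr 1) :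
    Complete H A U R₀ s' := by
  obtain ⟨φ, hφlt, hφinj, hφ, hφsurj⟩ := hE.exists_perm hk hX.lt hX.inj
  refine ⟨⟨h.toHasGraph.congr (by rw [hr]) h0, h.avail_sub, h1 ▸ h.label, ?_, ?_, ?_⟩, ?_, ?_, ?_, ?_⟩
  · intro x
    by_cases hb : ∃ t < k, B t = x / k
    · obtain ⟨t, ht, hb⟩ := hb
      rw [← Nat.div_add_mod' x k, ← hb, hE.new t ht _ (Nat.mod_lt _ (by omega))]
      exact h.lt _
    · push Not at hb
      rw [hE.old x hb]
      exact h.lt x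
  · rw [hr]
    intro x hx y hy hxy
    rw [hφ x hx, hφ y hy] at hxy
    exact hφinj x hx y hy (h.inj _ (hφlt x hx) _ (hφlt y hy) hxy)
  · intro v
    rw [h.mem, hr]
    constructor
    · rintro ⟨y, hy, hyv⟩
      obtain ⟨x, hx, rfl⟩ := hφsurj y hy
      exact ⟨x, hx, (hφ x hx).trans hyv⟩
    · rintro ⟨x, hx, hxv⟩
      exact ⟨φ x, hφlt x hx, by rw [← hφ x hx, hxv]⟩
  · rw [hr]; exact h.start
  · rw [hr]; exact h.start_le
  · exact fun b hb => hE.isEdge hX (h.edges b hb)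
  · rw [hr]; exact hE.shaped hk hX h.shaped

/-- The number of the `t`-th block of an exchange: the block in register 6 for `t = 0`, and
otherwise a digit of the number in register 3. -/
def blockExpr (t : ℕ) : Expr := if t = 0 then .reg 6 else .digit (t - 1)

def blockNum (n j τ t : ℕ) : ℕ := if t = 0 then j else dig n τ (t - 1)

/-- Position `p` in the `b`-th block of an exchange. -/
def cellExpr (k b p : ℕ) : Expr := .op .add (.op .mul (blockExpr b) (.lit k)) (.lit p)

def exchangeTests (k : ℕ) : List Expr :=
  [.op .eq (.edge k fun p => .get 3 (cellExpr k 0 p)) (.lit 0)] ++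
    (((List.range k).flatMap fun t => [.op .lt (blockExpr t) (.reg 2)]) ++
    -- The condition R₀ ≤ B t, expressed as R₀ < B t + 1.
    (((List.range k).flatMap fun t => [.op .lt (.reg 5) (.op .add (blockExpr t) (.lit 1))]) ++
    (distinct blockExpr k ++
    ((List.range k).flatMap fun b => [.edge k fun p => .get 5 (.lit (b * k + p))]))))

/-- The sources and targets of an exchange are the same cells of array 3. The new contents are
therefore first assembled in array 5, where they are tested and from where they are copied back. -/
def exchangeStep (k : ℕ) : Prog :=
  .seq (storeMany 5 .lit (fun i => .get 3 (cellExpr k (srcBlock k (i / k) (i % k))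
      (srcPos (i / k) (i % k)))) (k * k))
    (guards (exchangeTests k) (storeMany 3 (fun i => cellExpr k (i / k) (i % k))
      (fun i => .get 5 (.lit i)) (k * k)))

theorem exchangeStep_loopFree : (exchangeStep k).LoopFree :=
  ⟨storeMany_loopFree _ _ _ _, guards_loopFree (storeMany_loopFree _ _ _ _) _⟩

omit [NeZero n] in
theorem evals_block (hW : Large k n W) (h0 : s.reg 0 = n) (h3 : s.reg 3 = τ) (hτ : τ < W)
    (h6 : s.reg 6 = j) (hj : j < n) (t : ℕ) : Evals W s (blockExpr t) (blockNum n j τ t) := by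
  unfold blockExpr blockNum
  split_ifs
  · exact .reg h6 (hj.trans hW.n_lt)
  · exact .digit h0 h3 hW.n_lt hτ

theorem blockNum_lt (hj : j < n) (t : ℕ) : blockNum n j τ t < n := by
  unfold blockNum; split_ifs; exacts [hj, dig_lt _ _]

theorem evals_cell (hW : Large k n W) (h0 : s.reg 0 = n) (h3 : s.reg 3 = τ) (hτ : τ < W)
    (h6 : s.reg 6 = j) (hj : j < n) (t : ℕ) {p : ℕ} (hp : p < k) :
    Evals W s (cellExpr k t p) (blockNum n j τ t * k + p) := by
  have h8 := hW.n_le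
  have hn := hW.n_lt
  have h1 : blockNum n j τ t * k + p < W := by
    refine lt_of_lt_of_le (cell_lt (blockNum_lt hj t) hp) (le_trans ?_ hW.sq_lt.le)
    rw [sq]; exact Nat.mul_le_mul_left _ (by omega)
  exact .add (.mul (evals_block hW h0 h3 hτ h6 hj t) (.lit (by omega)) (by omega))
    (.lit (by omega)) h1

/-- The loop invariant of the search for an exchange that makes block `j` an edge. -/
structure ExchangeInv (H : KGraph k (Fin n)) (A U : Finset (Fin n)) (R₀ R j τ : ℕ) (s : State) :
    Prop extends Complete H A U R₀ s where
  number : s.reg 2 = R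
  current : s.reg 6 = j
  counter : s.reg 3 = τ
  done : ∀ b < j, H.IsEdge fun p => s.arr 3 (b * k + p)
  greedy : (H.IsEdge fun p => s.arr 3 (j * k + p)) ∨
    ∀ τ' < τ, ¬ IsExchange H R₀ R (s.arr 3) (blockNum n j τ')

theorem Complete.congr (h : Complete H A U R₀ s) (h0 : s'.reg 0 = s.reg 0)
    (h2 : s'.reg 2 = s.reg 2) (h5 : s'.reg 5 = s.reg 5) (ha0 : s'.arr 0 = s.arr 0)
    (ha1 : s'.arr 1 = s.arr 1) (ha3 : s'.arr 3 = s.arr 3) : Complete H A U R₀ s' where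
  toEmitted := h.toEmitted.congr h0 h2 ha0 ha1 ha3
  start := h5 ▸ h.start
  start_le := h2 ▸ h.start_le
  edges := ha3 ▸ h.edges
  shaped := by rw [ha3, h2]; exact h.shaped

theorem ExchangeInv.tests (hW : Large k n W) (h : ExchangeInv H A U R₀ R j τ s) (hj : j < R)
    (hτ : τ < W) {s₁ : State} (hr : s₁.reg = s.reg) (ha : ∀ b ≠ 5, s₁.arr b = s.arr b)
    (h5 : ∀ i < k * k, s₁.arr 5 i = s.arr 3 (blockNum n j τ (srcBlock k (i / k) (i % k)) * k +
      srcPos (i / k) (i % k))) :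
    Tests W s₁ (exchangeTests k) (IsExchange H R₀ R (s.arr 3) (blockNum n j τ)) := by
  classical
  have hk := hW.three_le
  have h8 := hW.n_le
  have hn := hW.n_lt
  have hW1 : 1 < W := by omega
  have hRn : R ≤ n := by
    have := h.reg_two_mul_le
    rw [h.number] at this
    exact le_trans (Nat.le_mul_of_pos_right _ (by omega)) this
  have hjn : j < n := by omega
  have e0 : s₁.reg 0 = n := by rw [hr]; exact h.toHasGraph.card
  have e3 : s₁.reg 3 = τ := by rw [hr]; exact h.counter
  have e6 : s₁.reg 6 = j := by rw [hr]; exact h.current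
  have hG : HasGraph H s₁ := h.toHasGraph.congr (by rw [hr]) (ha 0 (by omega))
  have hblk := fun t => evals_block hW e0 e3 hτ e6 hjn t
  have hkk : k * k < W := by
    have := hW.le
    have : k * k ≤ n := by nlinarith
    omega
  have hcell : ∀ t, ∀ p < k, Evals W s₁ (.get 3 (cellExpr k t p))
      (s.arr 3 (blockNum n j τ t * k + p)) := fun t p hp =>
    .get (evals_cell hW e0 e3 hτ e6 hjn t hp) (by rw [ha 3 (by omega)])
      ((h.lt _).trans hn)
  have t1 : Tests W s₁ [.op .eq (.edge k fun p => .get 3 (cellExpr k 0 p)) (.lit 0)]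
      (¬ H.IsEdge fun p => s.arr 3 (blockNum n j τ 0 * k + p)) :=
    (Tests.eq (hG.evals_edge hW (hcell 0) fun _ _ => h.lt _) (.lit (by omega)) hW1).congr
      (by split_ifs <;> simp_all)
  have t2 : Tests W s₁ ((List.range k).flatMap fun t => [.op .lt (blockExpr t) (.reg 2)])
      (∀ t < k, blockNum n j τ t < R) :=
    Tests.ofFn fun t _ => Tests.lt (hblk t) (.reg (by rw [hr]; exact h.number) (by omega)) hW1
  have hle : R₀ < W := by
    have := h.start_le
    rw [h.number] at this
    omega
  have t3 : Tests W s₁ ((List.range k).flatMap fun t =>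
      [.op .lt (.reg 5) (.op .add (blockExpr t) (.lit 1))]) (∀ t < k, R₀ ≤ blockNum n j τ t) :=
    Tests.ofFn fun t _ => (Tests.lt (.reg (by rw [hr]; exact h.start) hle)
      ((hblk t).add (.lit hW1) (by have := blockNum_lt (τ := τ) hjn t; omega)) hW1).congr
      Nat.lt_succ_iff
  have t4 := Tests.distinct (m := k) (fun i _ => hblk i) hW1
  have t5 : Tests W s₁ ((List.range k).flatMap fun b =>
      [.edge k fun p => .get 5 (.lit (b * k + p))]) (∀ b < k, H.IsEdge fun p =>
      s.arr 3 (blockNum n j τ (srcBlock k b p) * k + srcPos b p)) :=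
    Tests.ofFn fun b hb => hG.tests_edge hW (fun p hp => .get (.lit ((cell_lt hb hp).trans hkk))
      (by rw [h5 _ (cell_lt hb hp), cell_div hp, cell_mod hp]) ((h.lt _).trans hn))
      fun _ _ => h.lt _
  refine (t1.append (t2.append (t3.append (t4.append t5)))).congr ?_
  exact ⟨fun ⟨h1, h2, h3, h4, h5⟩ => ⟨h1, h2, h3, h4, h5⟩,
    fun ⟨h1, h2, h3, h4, h5⟩ => ⟨h1, h2, h3, h4, h5⟩⟩

theorem ExchangeInv.step (hW : Large k n W) (h : ExchangeInv H A U R₀ R j τ s) (hj : j < R)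
    (hτ : τ < W) :
    Runs W (exchangeStep k) s fun s' => s'.reg 3 = τ ∧
      ExchangeInv H A U R₀ R j (τ + 1) (s'.setReg 3 (τ + 1)) := by
  have hk := hW.three_le
  have h8 := hW.n_le
  have hn := hW.n_lt
  have hRn : R ≤ n := by
    have := h.reg_two_mul_le
    rw [h.number] at this
    exact le_trans (Nat.le_mul_of_pos_right _ (by omega)) this
  have hjn : j < n := by omega
  have hkk : k * k < W := by
    have := hW.le
    have : k * k ≤ n := by nlinarith
    omega
  have hdiv : ∀ i < k * k, i / k < k := fun i hi => Nat.div_lt_of_lt_mul hi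
  have hmod : ∀ i, i % k < k := fun i => Nat.mod_lt _ (by omega)
  refine .seq ((Runs.storeMany (I := fun i => i)
    (V := fun i => s.arr 3 (blockNum n j τ (srcBlock k (i / k) (i % k)) * k +
      srcPos (i / k) (i % k))) ?_ fun _ _ _ _ h => h).mono ?_)
  · intro i hi s' hr ha
    refine ⟨.lit (hi.trans hkk), .get (evals_cell hW (by rw [hr]; exact h.toHasGraph.card)
      (by rw [hr]; exact h.counter) hτ (by rw [hr]; exact h.current) hjn _
      (srcPos_lt hk (hdiv i hi) (hmod i))) (by rw [ha 3 (by omega)]) ((h.lt _).trans hn)⟩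
  rintro s₁ ⟨hr, ha, h5, -⟩
  have hc₁ : Complete H A U R₀ s₁ := h.toComplete.congr (by rw [hr]) (by rw [hr]) (by rw [hr])
    (ha 0 (by omega)) (ha 1 (by omega)) (ha 3 (by omega))
  have h3 : s₁.arr 3 = s.arr 3 := ha 3 (by omega)
  refine Runs.tests (h.tests hW hj hτ hr ha h5) (fun hX => ?_) fun hno => ?_
  · refine (Runs.storeMany (I := fun i => blockNum n j τ (i / k) * k + i % k)
      (V := fun i => s₁.arr 5 i) ?_ ?_).mono ?_
    · intro i hi s' hr' ha'
      refine ⟨evals_cell hW (by rw [hr', hr]; exact h.toHasGraph.card)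
        (by rw [hr', hr]; exact h.counter) hτ (by rw [hr', hr]; exact h.current) hjn _ (hmod i),
        .get (.lit (hi.trans hkk)) (by rw [ha' 5 (by omega)]) ?_⟩
      rw [h5 i hi]
      exact (h.lt _).trans hn
    · intro i hi i' hi' hii
      obtain ⟨e1, e2⟩ := cell_inj (hmod i) (hmod i') hii
      have e3 := hX.inj _ (hdiv i hi) _ (hdiv i' hi') e1
      rw [← Nat.div_add_mod' i k, ← Nat.div_add_mod' i' k, e3, e2]
    rintro s₂ ⟨hr₂, ha₂, hn₂, ho₂⟩
    have hE : Exchanged k (s₁.arr 3) (blockNum n j τ) (s₂.arr 3) := by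
      refine ⟨fun b hb p hp => ?_, fun x hx => ho₂ x fun i hi e => ?_⟩
      · have := hn₂ (b * k + p) (cell_lt hb hp)
        rw [h5 _ (cell_lt hb hp)] at this
        simp only [cell_div hp, cell_mod hp] at this
        rw [this, h3]
      · refine hx _ (hdiv i hi) ?_
        rw [← e, cell_div (hmod i)]
    have hrr : s₂.reg = s.reg := hr₂.trans hr
    have hR₁ : s₁.reg 2 = R := by rw [hr]; exact h.number
    rw [← h3] at hX
    have hc₂ : Complete H A U R₀ s₂ := hc₁.exchange hk (by rwa [hR₁]) hE hr₂ (ha₂ 0 (by omega))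
      (ha₂ 1 (by omega))
    refine ⟨by rw [hrr]; exact h.counter,
      hc₂.congr (by simp [State.setReg_reg]) (by simp [State.setReg_reg])
        (by simp [State.setReg_reg]) rfl rfl rfl, ?_, ?_, ?_, ?_, ?_⟩
    · simpa [State.setReg_reg, hrr] using h.number
    · simpa [State.setReg_reg, hrr] using h.current
    · simp [State.setReg_reg]
    · intro b hb
      exact hE.isEdge hX (h3 ▸ h.done b hb)
    -- The first new block is written in place of block j, which is thereby an edge; `not_edge` then
    -- makes all later tuples fail.
    · left
      exact (hX.edges 0 (by omega)).congr fun p hp => hE.new 0 (by omega) p hp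
  · refine ⟨by rw [hr]; exact h.counter,
      hc₁.congr (by simp [State.setReg_reg]) (by simp [State.setReg_reg])
        (by simp [State.setReg_reg]) rfl rfl rfl, ?_, ?_, ?_, ?_, ?_⟩
    · simpa [State.setReg_reg, hr] using h.number
    · simpa [State.setReg_reg, hr] using h.current
    · simp [State.setReg_reg]
    · rw [State.setReg_arr, h3]; exact h.done
    · rw [State.setReg_arr, h3]
      refine h.greedy.imp_right fun hg τ' hτ' => ?_
      rcases Nat.lt_succ_iff_lt_or_eq.1 hτ' with h' | rfl
      · exact hg τ' h'
      · exact hno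

/-- The first 2r blocks are edges, so a block that is not one has the shape that `Prepared.exchange`
requires. That field numbers the shaped blocks from 0, hence the shift by 2r in the digits. -/
theorem exists_isExchange (hk : 3 ≤ k) (hP : H.Prepared A C U r)
    (h : Complete H A U (2 * r) s) (hj : j < s.reg 2)
    (hne : ¬ H.IsEdge fun p => s.arr 3 (j * k + p)) :
    ∃ τ < n ^ (k - 1), IsExchange H (2 * r) (s.reg 2) (s.arr 3) (blockNum n j τ) := by
  have hj0 : 2 * r ≤ j := by
    by_contra hc
    exact hne (h.edges j (by omega))
  have hcard := h.card_add
  rw [Finset.card_empty, Nat.add_zero] at hcard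
  have hle := h.start_le
  obtain ⟨m, hm⟩ := Nat.exists_eq_add_of_le hle
  obtain ⟨j', rfl⟩ := Nat.exists_eq_add_of_le hj0
  have hRn := h.reg_two_mul_le
  have hshape := fun b (hb : b < m) => h.shaped (2 * r + b) (by omega) (by omega)
  have hm' : k * m + 2 * k * r = U.card := by
    rw [hm] at hcard
    linarith
  obtain ⟨i, hi0, hilt, hiinj, hie⟩ := hP.exchange m
    (fun b p => Fin.ofNat n (s.arr 3 ((2 * r + b) * k + p))) hm'
    (fun b hb p hp b' hb' p' hp' he => by
      simp only [Fin.ext_iff, Fin.val_ofNat, Nat.mod_eq_of_lt (h.lt _)] at he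
      obtain ⟨h1, h2⟩ := cell_inj hp hp' (h.inj _ (cell_lt (by omega) hp) _
        (cell_lt (by omega) hp') he)
      exact ⟨by omega, h2⟩)
    (fun b hb => (hshape b hb 0 (by omega)).2.2 rfl)
    (fun b hb p hp hp0 => by
      obtain ⟨h1, h2⟩ := hshape b hb p hp
      exact (Finset.mem_union.1 (hP.sub h1)).resolve_left fun h3 => hp0 (h2.1 h3))
    j' (by omega)
  obtain ⟨τ, hτ, hdig⟩ := exists_dig_eq (n := n) (k - 1) (fun t => 2 * r + i (t + 1))
    fun t ht => by
      have h1 := hilt (t + 1) (by omega)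
      have h2 : s.reg 2 ≤ s.reg 2 * k := Nat.le_mul_of_pos_right _ (by omega)
      omega
  have hB : ∀ t < k, blockNum n (2 * r + j') τ t = 2 * r + i t := by
    intro t ht
    unfold blockNum
    split_ifs with h0
    · rw [h0, hi0]
    · rw [hdig _ (by omega), Nat.sub_add_cancel (by omega)]
  refine ⟨τ, hτ, ⟨by simpa [blockNum] using hne, fun t ht => ?_, fun t ht => ?_, ?_, ?_⟩⟩
  · rw [hB t ht]; have := hilt t ht; omega
  · rw [hB t ht]; omega
  · intro a ha b hb hab
    rw [hB a ha, hB b hb] at hab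
    exact hiinj a ha b hb (by omega)
  · intro b hb
    unfold KGraph.IsEdge
    rw [Finset.image_congr (g := fun p => Fin.ofNat n (s.arr 3
      ((2 * r + i (srcBlock k b p)) * k + srcPos b p)))]
    · exact hie b hb
    · intro p hp
      have hp : p < k := by simpa using hp
      simp only [hB _ (srcBlock_lt hk hb hp)]

def exchangeSearch (k : ℕ) : Prog := forTo 3 (.pow (k - 1)) (exchangeStep k)

def exchangeSearchTime (k n : ℕ) : ℕ :=
  (n ^ (k - 1) + 1) * ((exchangeStep k).bound + (Expr.pow (k - 1)).cost + 9)

def exchangeAll (k : ℕ) : Prog := forTo 6 (.reg 2) (exchangeSearch k)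

/-- The blocks do not change until a tuple is accepted. If block j were still no edge at the end,
all tuples would have failed for the present blocks, contrary to `exists_isExchange`. -/
theorem Complete.exchangeSearch (hW : Large k n W) (hP : H.Prepared A C U r)
    (h : Complete H A U (2 * r) s) (hR : s.reg 2 = R) (hjR : j < R) (h6 : s.reg 6 = j)
    (hdone : ∀ b < j, H.IsEdge fun p => s.arr 3 (b * k + p)) :
    RunsIn W (exchangeSearchTime k n) (exchangeSearch k) s fun s' =>
      Complete H A U (2 * r) s' ∧ s'.reg 2 = R ∧ s'.reg 6 = j ∧
      ∀ b < j + 1, H.IsEdge fun p => s'.arr 3 (b * k + p) := by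
  have hk := hW.three_le
  have hpow : n ^ (k - 1) + 1 < W := by
    have h1 := hW.pow_lt (m := k - 1 + 1) (by omega)
    have h2 := hW.two_le
    have h3 : 0 < n ^ (k - 1) := Nat.pow_pos (by omega)
    rw [pow_succ] at h1
    nlinarith
  refine (RunsIn.forTo (Inv := ExchangeInv H A U (2 * r) R j) hpow
    ⟨h.congr ?_ ?_ ?_ rfl rfl rfl, ?_, ?_, ?_, hdone, .inr fun τ' hτ' => by omega⟩ ?_ ?_).mono
    le_rfl ?_
  · simp [State.setReg_reg]
  · simp [State.setReg_reg]
  · simp [State.setReg_reg]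
  · simpa [State.setReg_reg] using hR
  · simpa [State.setReg_reg] using h6
  · simp [State.setReg_reg]
  · intro τ s _ hs
    exact ⟨hs.counter, .pow hs.toHasGraph.card hW.two_le (by omega) hW.n_lt⟩
  · intro τ s hτ hs
    exact (hs.step hW hjR (by omega)).runsIn exchangeStep_loopFree
  · intro s' hs
    refine ⟨hs.toComplete, hs.number, hs.current, fun b hb => ?_⟩
    rcases Nat.lt_succ_iff_lt_or_eq.1 hb with hb | rfl
    · exact hs.done b hb
    · by_contra hne
      have hR' := hs.number
      obtain ⟨τ, hτ, hX⟩ := exists_isExchange hk hP hs.toComplete (by omega) hne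
      rw [hR'] at hX
      exact hs.greedy.elim hne fun hg => hg τ hτ hX

theorem Complete.exchangeAll (hW : Large k n W) (hP : H.Prepared A C U r)
    (h : Complete H A U (2 * r) s) :
    RunsIn W ((n + 1) * (exchangeSearchTime k n + 10)) (exchangeAll k) s fun s' =>
      Complete H A U (2 * r) s' ∧ ∀ b < s'.reg 2, H.IsEdge fun p => s'.arr 3 (b * k + p) := by
  have hk := hW.three_le
  have h2n := hW.two_mul_lt
  have hn2 := hW.two_le
  have hRn : s.reg 2 ≤ n := le_trans (Nat.le_mul_of_pos_right _ (by omega)) h.reg_two_mul_le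
  refine (RunsIn.forTo (T := exchangeSearchTime k n) (Inv := fun j s' => Complete H A U (2 * r) s' ∧
    s'.reg 2 = s.reg 2 ∧ s'.reg 6 = j ∧ ∀ b < j, H.IsEdge fun p => s'.arr 3 (b * k + p))
    (N := s.reg 2) (by omega) ⟨h.congr ?_ ?_ ?_ rfl rfl rfl, ?_, ?_, ?_⟩ ?_ ?_).mono
    (Nat.mul_le_mul (by omega) le_rfl) ?_
  · simp [State.setReg_reg]
  · simp [State.setReg_reg]
  · simp [State.setReg_reg]
  · simp [State.setReg_reg]
  · simp [State.setReg_reg]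
  · intro b hb; omega
  · rintro j s' - ⟨-, h2, h6, -⟩
    exact ⟨h6, .reg h2 (by omega)⟩
  · rintro j s' hj ⟨hc, h2, h6, hd⟩
    refine (hc.exchangeSearch hW hP h2 hj h6 hd).mono le_rfl ?_
    rintro s'' ⟨hc', h2', h6', hd'⟩
    refine ⟨h6', hc'.congr ?_ ?_ ?_ rfl rfl rfl, ?_, ?_, hd'⟩ <;> simp [State.setReg_reg, h2']
  · rintro s' ⟨hc, h2, -, hd⟩
    exact ⟨hc, by rwa [h2]⟩

end
end WordRAM

theorem mem_coveredBy {V : Type*} [DecidableEq V] {M : Finset (Finset V)} {v : V} :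
    v ∈ coveredBy M ↔ ∃ e ∈ M, v ∈ e := by simp [coveredBy]

theorem KGraph.IsMatching.card_coveredBy {k : ℕ} {V : Type*} [DecidableEq V] {H : KGraph k V}
    {M : Finset (Finset V)} (hM : H.IsMatching M) : (coveredBy M).card = M.card * k := by
  rw [coveredBy, Finset.card_biUnion fun e he e' he' hne => hM.2 he he' hne]
  exact Finset.sum_const_nat fun e he => H.card_eq e (hM.1 he)

theorem KGraph.IsMatching.card_mul_le {k n : ℕ} {H : KGraph k (Fin n)}
    {M : Finset (Finset (Fin n))} (hM : H.IsMatching M) : M.card * k ≤ n := by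
  rw [← hM.card_coveredBy]
  exact (Finset.card_le_univ _).trans (by simp)

namespace WordRAM
section
variable {k n W : ℕ} [NeZero n] {H : KGraph k (Fin n)} {A B C U : Finset (Fin n)}
  {M : Finset (Finset (Fin n))} {s s' : State} {τ r : ℕ}

/-! ### Initialization -/

omit [NeZero n] in
-- The definition of `Lists` does not directly say that each of the m groups of cells holds a member
-- of M. But choosing a group for each member is injective, and |M| = m, so every group is chosen.
theorem Lists.exists_mem (hk : 0 < k) {a : ℕ → ℕ} {m : ℕ} (h : Lists k a m M) {x : ℕ}
    (hx : x < m * k) : ∃ v ∈ coveredBy M, a x = v := by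
  classical
  obtain ⟨hm, hM⟩ := h
  have h1 : ∀ e ∈ M, ∃ i < m, e.map Fin.valEmbedding =
      (Finset.range k).image (fun j => a (i * k + j)) := fun e he => (hM e).1 he
  choose! i hi hie using h1
  have h2 : Set.InjOn i (M : Set (Finset (Fin n))) := by
    intro e he e' he' hee
    refine Finset.map_injective Fin.valEmbedding ?_
    rw [hie e he, hie e' he', hee]
  have h3 : M.image i = Finset.range m := by
    refine Finset.eq_of_subset_of_card_le (fun z hz => ?_) ?_
    · obtain ⟨e, he, rfl⟩ := Finset.mem_image.1 hz
      exact Finset.mem_range.2 (hi e he)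
    · rw [Finset.card_image_of_injOn h2, hm, Finset.card_range]
  have h4 : x / k ∈ M.image i := by
    rw [h3]; exact Finset.mem_range.2 (Nat.div_lt_of_lt_mul (by rwa [Nat.mul_comm]))
  obtain ⟨e, he, hex⟩ := Finset.mem_image.1 h4
  have h5 : a x ∈ e.map Fin.valEmbedding := by
    rw [hie e he, hex]
    refine Finset.mem_image.2 ⟨x % k, Finset.mem_range.2 (Nat.mod_lt _ hk), ?_⟩
    rw [Nat.div_add_mod']
  obtain ⟨w, hw, hwv⟩ := Finset.mem_map.1 h5
  exact ⟨w, mem_coveredBy.2 ⟨e, he, hw⟩, hwv.symm⟩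

omit [NeZero n] in
theorem Lists.mem_coveredBy_iff (hk : 0 < k) {a : ℕ → ℕ} {m : ℕ} (h : Lists k a m M) (v : Fin n) :
    v ∈ coveredBy M ↔ ∃ x < m * k, a x = v := by
  constructor
  · intro hv
    obtain ⟨e, he, hv⟩ := mem_coveredBy.1 hv
    obtain ⟨i, hi, hie⟩ := (h.2 e).1 he
    have h1 : (v : ℕ) ∈ e.map Fin.valEmbedding := Finset.mem_map_of_mem _ hv
    rw [hie] at h1
    obtain ⟨p, hp, hpv⟩ := Finset.mem_image.1 h1
    exact ⟨i * k + p, cell_lt hi (Finset.mem_range.1 hp), hpv⟩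
  · rintro ⟨x, hx, hxv⟩
    obtain ⟨w, hw, hxw⟩ := h.exists_mem hk hx
    rwa [Fin.ext (hxv.symm.trans hxw)]

omit [NeZero n] in
theorem Lists.lt (hk : 0 < k) {a : ℕ → ℕ} {m : ℕ} (h : Lists k a m M) {x : ℕ}
    (hx : x < m * k) : a x < n := by
  obtain ⟨w, -, hxw⟩ := h.exists_mem hk hx
  rw [hxw]; exact w.2

def markStep (k : ℕ) : Prog := .store 1 (.get 2 (.reg 3)) (.lit (4 * k))

/-- Mark the vertices covered by the given matching as not available. -/
def mark (k : ℕ) : Prog := forTo 3 (.op .mul (.reg 1) (.lit k)) (markStep k)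

open scoped Classical in
/-- The loop invariant of `mark`. -/
structure MarkInv (H : KGraph k (Fin n)) (A B : Finset (Fin n)) (m : ℕ) (a : ℕ → ℕ) (τ : ℕ)
    (s : State) : Prop extends HasGraph H s where
  size : s.reg 1 = m
  number : s.reg 2 = 0
  counter : s.reg 3 = τ
  count : s.reg 4 = 0
  list : s.arr 2 = a
  empty : ∀ x, s.arr 3 x = 0
  label : ∀ v : Fin n, s.arr 1 v =
    if ∃ x < τ, a x = v then 4 * k else if v ∈ A then 0 else if v ∈ B then 1 else 2

theorem IsInput.mark (hW : Large k n W) (h : IsInput H A B M s) (hM : H.IsMatching M)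
    (hB : B ⊆ coveredBy M) :
    RunsIn W ((n + 1) * ((markStep k).bound + 12)) (mark k) s fun s' =>
      Emitted H A (Finset.univ \ coveredBy M) (Finset.univ \ coveredBy M) s' ∧
      s'.reg 1 = M.card ∧ s'.reg 2 = 0 ∧ s'.reg 4 = 0 := by
  classical
  have hk := hW.three_le
  have hn2 := hW.two_mul_lt
  have h8 := hW.n_le
  have hMk := hM.card_mul_le
  have hMn : M.card ≤ n := le_trans (Nat.le_mul_of_pos_right _ (by omega)) hMk
  refine (RunsIn.forTo (Inv := MarkInv H A B M.card (s.arr 2)) (N := M.card * k)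
    (T := (markStep k).bound) (by omega)
    ⟨h.hasGraph.congr ?_ rfl, ?_, ?_, ?_, ?_, rfl, h.arr_other 3 le_rfl, ?_⟩ ?_ ?_).mono
    (Nat.mul_le_mul (by omega) le_rfl) ?_
  · simp [State.setReg_reg]
  · simpa [State.setReg_reg] using h.reg_one
  · simpa [State.setReg_reg] using h.reg_other 2 le_rfl
  · simp [State.setReg_reg]
  · simpa [State.setReg_reg] using h.reg_other 4 (by omega)
  · intro v
    simp only [State.setReg_arr, Nat.not_lt_zero, false_and, exists_false, if_false]
    rw [h.label v]
  · intro τ s' _ hs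
    exact ⟨hs.counter, .mul (.reg hs.size (by omega)) (.lit (by omega)) (by omega)⟩
  · intro τ s' hτ hs
    have hlt := h.list.lt (by omega) hτ
    refine Runs.runsIn (.store (j := s.arr 2 τ) (v := 4 * k)
      (.get (.reg hs.counter (by omega)) (by rw [hs.list]) (by omega)) (.lit (by omega))
      ⟨hs.counter, hs.toHasGraph.congr ?_ ?_, ?_, ?_, ?_, ?_, ?_, ?_, ?_⟩) trivial
    · simp [State.setReg_reg, State.setArr]
    · simp [State.setReg_arr, State.setArr]
    · simpa [State.setReg_reg, State.setArr] using hs.size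
    · simpa [State.setReg_reg, State.setArr] using hs.number
    · simp [State.setReg_reg]
    · simpa [State.setReg_reg, State.setArr] using hs.count
    · simpa [State.setReg_arr, State.setArr] using hs.list
    · simpa [State.setReg_arr, State.setArr] using hs.empty
    · intro v
      simp only [State.setReg_arr, State.setArr, Function.update_self]
      by_cases hv : (v : ℕ) = s.arr 2 τ
      · rw [hv, Function.update_self, if_pos ⟨τ, by omega, rfl⟩]
      · rw [Function.update_of_ne hv, hs.label v]
        have : (∃ x < τ, s.arr 2 x = v) ↔ ∃ x < τ + 1, s.arr 2 x = v := by
          refine exists_congr fun x => ⟨fun ⟨h1, h2⟩ => ⟨by omega, h2⟩, fun ⟨h1, h2⟩ => ⟨?_, h2⟩⟩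
          rcases Nat.lt_succ_iff_lt_or_eq.1 h1 with h1 | rfl
          · exact h1
          · exact (hv h2.symm).elim
        simp only [this]
  · intro s' hs
    refine ⟨⟨hs.toHasGraph, subset_rfl, fun v => ?_, fun x => ?_, fun x hx => ?_, fun v => ?_⟩,
      hs.size, hs.number, hs.count⟩
    · rw [hs.label v]
      have hiff := h.list.mem_coveredBy_iff (by omega) v
      by_cases hv : v ∈ coveredBy M
      · rw [if_pos (hiff.1 hv)]; simp [hv]
      · rw [if_neg fun h' => hv (hiff.2 h')]
        -- The label 1 does not survive, since M covers B.
        have hvB : v ∉ B := fun hvB => hv (hB hvB)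
        simp [hv, hvB]
    · rw [hs.empty]; omega
    · rw [hs.number] at hx; omega
    · rw [hs.number]; simp

def countStep : Prog :=
  .set 4 (.op .add (.reg 4) (.op .eq (.get 1 (.reg 3)) (.lit 0)))

/-- Count the available vertices in `A`. -/
def count : Prog := forTo 3 (.reg 0) countStep

theorem Emitted.count (hW : Large k n W) (h : Emitted H A U U s) {m : ℕ} (h1 : s.reg 1 = m)
    (h2 : s.reg 2 = 0) (h4 : s.reg 4 = 0) :
    RunsIn W ((n + 1) * (countStep.bound + 10)) count s fun s' =>
      Emitted H A U U s' ∧ s'.reg 1 = m ∧ s'.reg 2 = 0 ∧ s'.reg 4 = (U ∩ A).card := by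
  have hk := hW.three_le
  have hn2 := hW.two_mul_lt
  have h8 := hW.n_le
  refine (RunsIn.forTo (Inv := fun τ s' => Emitted H A U U s' ∧ s'.reg 1 = m ∧ s'.reg 2 = 0 ∧
    s'.reg 3 = τ ∧ s'.reg 4 = ((U ∩ A).filter fun v : Fin n => (v : ℕ) < τ).card) (N := n)
    (T := countStep.bound) (by omega)
    ⟨h.setReg (by omega) (by omega), ?_, ?_, ?_, ?_⟩ ?_ ?_).mono le_rfl ?_
  · simpa [State.setReg_reg] using h1
  · simpa [State.setReg_reg] using h2
  · simp [State.setReg_reg]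
  · simpa [State.setReg_reg] using h4
  · rintro τ s' - ⟨hs, -, -, h3, -⟩
    exact ⟨h3, .reg hs.toHasGraph.card hW.n_lt⟩
  · rintro τ s' hτ ⟨hs, h1', h2', h3', h4'⟩
    have hle : ((U ∩ A).filter fun v : Fin n => (v : ℕ) < τ).card ≤ n :=
      (Finset.card_le_univ _).trans (by simp)
    have hlab : s'.arr 1 τ = lab k A U ⟨τ, hτ⟩ := hs.label ⟨τ, hτ⟩
    have hlabn := lab_le (A := A) (avail := U) hk ⟨τ, hτ⟩
    have hif : (if lab k A U ⟨τ, hτ⟩ = 0 then 1 else 0) ≤ 1 := by split_ifs <;> omega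
    refine Runs.runsIn (.set (.add (.reg h4' (by omega))
      (.eq (.get (.reg h3' (by omega)) hlab (by omega)) (.lit (by omega)) (by omega)) (by omega))
      ⟨?_, (hs.setReg (by omega) (by omega)).setReg (by omega) (by omega), ?_, ?_, ?_, ?_⟩) trivial
    · simpa [State.setReg_reg] using h3'
    · simpa [State.setReg_reg] using h1'
    · simpa [State.setReg_reg] using h2'
    · simp [State.setReg_reg]
    · simp only [State.setReg_reg, Nat.reduceEqDiff, reduceIte]
      by_cases hv : (⟨τ, hτ⟩ : Fin n) ∈ U ∩ A
      · have e1 : ((U ∩ A).filter fun v : Fin n => (v : ℕ) < τ + 1) =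
            insert ⟨τ, hτ⟩ ((U ∩ A).filter fun v : Fin n => (v : ℕ) < τ) := by
          ext v
          simp only [Finset.mem_filter, Finset.mem_insert, Nat.lt_succ_iff_lt_or_eq]
          constructor
          · rintro ⟨h5, h6 | h6⟩
            · exact .inr ⟨h5, h6⟩
            · exact .inl (Fin.ext h6)
          · rintro (rfl | ⟨h5, h6⟩)
            · exact ⟨hv, .inr rfl⟩
            · exact ⟨h5, .inl h6⟩
        rw [e1, Finset.card_insert_of_notMem (by simp)]
        have hv' := Finset.mem_inter.1 hv
        simp [lab, hv'.1, hv'.2]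
      · have e1 : ((U ∩ A).filter fun v : Fin n => (v : ℕ) < τ + 1) =
            (U ∩ A).filter fun v : Fin n => (v : ℕ) < τ := by
          refine Finset.filter_congr fun v hvm => ?_
          rw [Nat.lt_succ_iff_lt_or_eq]
          exact ⟨fun h => h.resolve_right fun h' => hv (by
            rwa [← (Fin.ext h' : v = ⟨τ, hτ⟩)]), .inl⟩
        rw [e1, if_neg, Nat.add_zero]
        intro h0
        unfold lab at h0
        split_ifs at h0 with h5 h6
        · exact hv (Finset.mem_inter.2 ⟨h5, h6⟩)
        · omega
  · rintro s' ⟨hs, h1', h2', -, h4'⟩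
    refine ⟨hs, h1', h2', h4'.trans ?_⟩
    rw [Finset.filter_true_of_mem fun v _ => v.2]

/-! ### The program -/

/-- Half of the slack, where register 4 holds the number of available vertices in `A`. -/
def halfSlack (k : ℕ) : Expr :=
  .op .div (.op .sub (.op .add (.reg 4) (.reg 1)) (.op .div (.reg 0) (.lit k))) (.lit 2)

def program (k : ℕ) : Prog :=
  .seq (mark k) (.seq count (.seq (.set 4 (halfSlack k)) (.seq (moves k)
    (.seq (.set 5 (.reg 2)) (.seq (fill k) (exchangeAll k))))))

/-- The factors 2 and 4 absorb n^m + 1 ≤ 2X and (n+1)(n^(k-1)+1) ≤ 4X, where X = n^(4(k-1)). -/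
def timeFactor (k : ℕ) : ℕ :=
  2 * ((markStep k).bound + 12) + 2 * (countStep.bound + 10) + (halfSlack k).cost + 3 +
    2 * ((moveStep k).bound + (Expr.pow (2 * k)).cost + 9) +
    2 * ((fillStep k).bound + (Expr.pow k).cost + 9) +
    4 * ((exchangeStep k).bound + (Expr.pow (k - 1)).cost + 9) + 20

theorem Complete.output (hk : 3 ≤ k) {R₀ : ℕ} (h : Complete H A U R₀ s)
    (hE : ∀ b < s.reg 2, H.IsEdge fun p => s.arr 3 (b * k + p)) :
    ∃ N, IsOutput k N s ∧ H.IsPerfectMatchingOn U N := by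
  classical
  let blk : ℕ → Finset (Fin n) := fun b =>
    (Finset.range k).image fun p => Fin.ofNat n (s.arr 3 (b * k + p))
  have hval : ∀ x, (Fin.ofNat n (s.arr 3 x) : ℕ) = s.arr 3 x := fun x => by
    rw [Fin.val_ofNat, Nat.mod_eq_of_lt (h.lt x)]
  have hdisj : ∀ b < s.reg 2, ∀ b' < s.reg 2, ∀ v, v ∈ blk b → v ∈ blk b' → b = b' := by
    intro b hb b' hb' v hv hv'
    obtain ⟨p, hp, rfl⟩ := Finset.mem_image.1 hv
    obtain ⟨q, hq, hpq⟩ := Finset.mem_image.1 hv'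
    rw [Finset.mem_range] at hp hq
    rw [Fin.ext_iff, hval, hval] at hpq
    exact (cell_inj hq hp (h.inj _ (cell_lt hb' hq) _ (cell_lt hb hp) hpq)).1.symm
  have hne : ∀ b, Fin.ofNat n (s.arr 3 (b * k + 0)) ∈ blk b := fun b =>
    Finset.mem_image_of_mem (fun p => Fin.ofNat n (s.arr 3 (b * k + p)))
      (Finset.mem_range.2 (by omega))
  have hinj : ∀ b < s.reg 2, ∀ b' < s.reg 2, blk b = blk b' → b = b' := fun b hb b' hb' he =>
    hdisj b hb b' hb' _ (hne b) (he ▸ hne b)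
  refine ⟨(Finset.range (s.reg 2)).image blk, ⟨?_, fun e => ?_⟩, ⟨?_, ?_⟩, ?_⟩
  · rw [Finset.card_image_of_injOn, Finset.card_range]
    intro b hb b' hb' he
    exact hinj b (by simpa using hb) b' (by simpa using hb') he
  · have hmap : ∀ b, (blk b).map Fin.valEmbedding =
        (Finset.range k).image fun j => s.arr 3 (b * k + j) := by
      intro b
      rw [Finset.map_eq_image, Finset.image_image]
      exact Finset.image_congr fun p _ => hval _
    constructor
    · intro he
      obtain ⟨b, hb, rfl⟩ := Finset.mem_image.1 he
      exact ⟨b, Finset.mem_range.1 hb, hmap b⟩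
    · rintro ⟨b, hb, he⟩
      rw [← hmap b] at he
      exact Finset.mem_image.2 ⟨b, Finset.mem_range.2 hb,
        (Finset.map_injective Fin.valEmbedding he).symm⟩
  · intro e he
    obtain ⟨b, hb, rfl⟩ := Finset.mem_image.1 he
    exact hE b (Finset.mem_range.1 hb)
  · intro e he e' he' hne'
    obtain ⟨b, hb, rfl⟩ := Finset.mem_image.1 (Finset.mem_coe.1 he)
    obtain ⟨b', hb', rfl⟩ := Finset.mem_image.1 (Finset.mem_coe.1 he')
    refine Finset.disjoint_left.2 fun v hv hv' => hne' ?_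
    rw [hdisj b (Finset.mem_range.1 hb) b' (Finset.mem_range.1 hb') v hv hv']
  · ext v
    rw [mem_coveredBy]
    have hmem := h.mem v
    simp only [Finset.notMem_empty, not_false_eq_true, and_true] at hmem
    rw [hmem]
    constructor
    · rintro ⟨e, he, hv⟩
      obtain ⟨b, hb, rfl⟩ := Finset.mem_image.1 he
      obtain ⟨p, hp, rfl⟩ := Finset.mem_image.1 hv
      exact ⟨_, cell_lt (Finset.mem_range.1 hb) (Finset.mem_range.1 hp), (hval _).symm⟩
    · rintro ⟨x, hx, hxv⟩
      refine ⟨blk (x / k), Finset.mem_image_of_mem _ (Finset.mem_range.2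
        (Nat.div_lt_of_lt_mul (by rwa [Nat.mul_comm]))), Finset.mem_image.2
        ⟨x % k, Finset.mem_range.2 (Nat.mod_lt _ (by omega)), ?_⟩⟩
      rw [Nat.div_add_mod', Fin.ext_iff, hval, hxv]

theorem program_correct (hW : Large k n W) (h : IsInput H A B M s) (hM : H.IsMatching M)
    (hB : B ⊆ coveredBy M) (hP : H.Prepared A C (Finset.univ \ coveredBy M) r)
    (hr : ((Finset.univ \ coveredBy M) ∩ A).card + M.card = n / k + 2 * r) :
    RunsIn W (timeFactor k * n ^ (4 * (k - 1))) (program k) s fun s' =>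
      ∃ N, IsOutput k N s' ∧ H.IsPerfectMatchingOn (Finset.univ \ coveredBy M) N := by
  have hk := hW.three_le
  have hn2 := hW.two_mul_lt
  have h8 := hW.n_le
  have hmark := h.mark hW hM hB
  generalize Finset.univ \ coveredBy M = U at hr hP hmark ⊢
  have hUA : (U ∩ A).card ≤ n := (Finset.card_le_univ _).trans (by simp)
  have hMn : M.card ≤ n :=
    le_trans (Nat.le_mul_of_pos_right _ (by omega)) (hM.card_mul_le)
  have run : RunsIn W ((n + 1) * ((markStep k).bound + 12) + ((n + 1) * (countStep.bound + 10) +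
      (((halfSlack k).cost + 1) + ((n ^ (2 * k) + 1) * ((moveStep k).bound +
      (Expr.pow (2 * k)).cost + 9) + (2 + ((n ^ k + 1) * ((fillStep k).bound +
      (Expr.pow k).cost + 9) + (n + 1) * (exchangeSearchTime k n + 10))))))) (program k) s
      fun s' => ∃ N, IsOutput k N s' ∧ H.IsPerfectMatchingOn U N := by
    refine .seq (hmark.mono le_rfl ?_)
    rintro s₁ ⟨h1, hm₁, hR₁, hc₁⟩
    refine .seq ((h1.count hW hm₁ hR₁ hc₁).mono le_rfl ?_)
    rintro s₂ ⟨h2, hm₂, hR₂, hc₂⟩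
    refine .seq ((Runs.runsIn (Runs.set (v := r) ?_ (Q := fun s' => s' = s₂.setReg 4 r) rfl)
      trivial).mono le_rfl ?_)
    · have e : r = ((U ∩ A).card + M.card - n / k) / 2 := by omega
      rw [e]
      exact .div (.sub (.add (.reg hc₂ (by omega)) (.reg hm₂ (by omega)) (by omega))
        (.div (.reg h2.toHasGraph.card (by omega)) (.lit (by omega)) (by omega)) (by omega))
        (.lit (by omega)) (lt_of_le_of_lt (Nat.sub_le _ _) (by omega))
    rintro s₃ rfl
    refine .seq (((h2.setReg (by omega) (by omega)).moves hW hP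
      (by simpa [State.setReg_reg] using hR₂) (by simp [State.setReg_reg])).mono le_rfl ?_)
    rintro s₄ ⟨avail, h4, hR₄, hE₄, hbal⟩
    have h2r : 2 * r < W := by
      have h5 := h4.reg_two_mul_le
      rw [hR₄] at h5
      have h6 : 2 * r ≤ 2 * r * k := Nat.le_mul_of_pos_right _ (by omega)
      exact lt_of_le_of_lt (h6.trans h5) hW.n_lt
    refine .seq ((Runs.runsIn (Runs.set (v := 2 * r) (.reg hR₄ h2r)
      (Q := fun s' => s' = s₄.setReg 5 (2 * r)) rfl) trivial).mono le_rfl ?_)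
    rintro s₅ rfl
    refine .seq (((h4.setReg (by omega) (by omega)).fill (R₀ := 2 * r) hW
      (by simpa [State.setReg_reg] using hR₄) (by simp [State.setReg_reg]) hE₄ hbal).mono
      le_rfl ?_)
    intro s₆ h6
    refine (h6.exchangeAll hW hP).mono le_rfl ?_
    rintro s₇ ⟨h7, hE₇⟩
    exact h7.output hk hE₇
  refine run.mono ?_ fun _ h => h
  have hn0 : 0 < n := by omega
  set X := n ^ (4 * (k - 1)) with hX
  have hX1 : 1 ≤ X := Nat.one_le_pow _ _ hn0
  -- The largest exponent that occurs is 2k, from the search for moves, and 2k ≤ 4(k-1).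
  have hpw : ∀ m ≤ 4 * (k - 1), n ^ m ≤ X := fun m hm => Nat.pow_le_pow_right hn0 hm
  have b1 : n + 1 ≤ 2 * X := by have := hpw 1 (by omega); rw [pow_one] at this; omega
  have b2 : n ^ (2 * k) + 1 ≤ 2 * X := by have := hpw (2 * k) (by omega); omega
  have b3 : n ^ k + 1 ≤ 2 * X := by have := hpw k (by omega); omega
  have b4 : (n + 1) * (n ^ (k - 1) + 1) ≤ 4 * X := by
    have e1 : n ^ k = n * n ^ (k - 1) := by rw [← pow_succ', Nat.sub_add_cancel (by omega)]
    have e2 := hpw k (by omega)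
    have e3 := hpw (k - 1) (by omega)
    have e4 := hpw 1 (by omega)
    rw [pow_one] at e4
    rw [e1] at e2
    nlinarith
  have b5 : (n + 1) * exchangeSearchTime k n ≤
      4 * X * ((exchangeStep k).bound + (Expr.pow (k - 1)).cost + 9) := by
    unfold exchangeSearchTime
    rw [← Nat.mul_assoc]
    exact Nat.mul_le_mul_right _ b4
  have c1 := Nat.mul_le_mul_right ((markStep k).bound + 12) b1
  have c2 := Nat.mul_le_mul_right (countStep.bound + 10) b1
  have c3 := Nat.mul_le_mul_right ((moveStep k).bound + (Expr.pow (2 * k)).cost + 9) b2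
  have c4 := Nat.mul_le_mul_right ((fillStep k).bound + (Expr.pow k).cost + 9) b3
  have c5 : (halfSlack k).cost + 3 ≤ X * ((halfSlack k).cost + 3) := Nat.le_mul_of_pos_left _ hX1
  unfold timeFactor
  linarith

end
end WordRAM

/-! ### Counting tuples -/

open Finset in
-- Since s ≠ t, the entries other than T t determine the set bad (T s), which leaves at most D
-- values for T t.
theorem card_filter_mem_le {ι I : Type*} [Fintype ι] [DecidableEq ι] [Fintype I] [DecidableEq I]
    {D : ℕ} (bad : I → Finset I) (hbad : ∀ a, (bad a).card ≤ D) {s t : ι} (hst : s ≠ t) :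
    (univ.filter fun T : ι → I => T t ∈ bad (T s)).card ≤
      D * Fintype.card I ^ (Fintype.card ι - 1) := by
  have h1 : (univ.filter fun T : ι → I => T t ∈ bad (T s)).card ≤
      ((univ : Finset ({i // i ≠ t} → I)).sigma fun h => bad (h ⟨s, hst⟩)).card := by
    refine card_le_card_of_injOn
      (fun T => (⟨fun i => T i, T t⟩ : (_ : {i // i ≠ t} → I) × I)) ?_ ?_
    · intro T hT
      simpa using hT
    · intro T _ T' _ h
      simp only [Sigma.mk.injEq, heq_eq_eq] at h
      funext i
      by_cases hi : i = t
      · rw [hi]; exact h.2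
      · exact congrFun h.1 ⟨i, hi⟩
  refine h1.trans ?_
  rw [card_sigma]
  refine (sum_le_card_nsmul _ _ D fun h _ => hbad _).trans ?_
  rw [card_univ, Fintype.card_fun, smul_eq_mul, Nat.mul_comm]
  simp [Fintype.card_subtype_compl]

open Finset in
/-- A union bound for functions that avoid an exceptional set and pairwise constraints. -/
theorem exists_avoiding {ι I : Type*} [Fintype ι] [DecidableEq ι] [Fintype I] [DecidableEq I]
    {D : ℕ} (bad : ι → ι → I → Finset I) (hbad : ∀ s t a, (bad s t a).card ≤ D)
    (K : Finset (ι → I))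
    (h : K.card + Fintype.card ι ^ 2 * (D * Fintype.card I ^ (Fintype.card ι - 1)) <
      Fintype.card I ^ Fintype.card ι) :
    ∃ T : ι → I, T ∉ K ∧ ∀ s t, s ≠ t → T t ∉ bad s t (T s) := by
  by_contra hc
  push Not at hc
  let P : Finset (ι × ι) := univ.filter fun p => p.1 ≠ p.2
  let E : ι × ι → Finset (ι → I) := fun p => univ.filter fun T => T p.2 ∈ bad p.1 p.2 (T p.1)
  have h1 : (univ : Finset (ι → I)) ⊆ K ∪ P.biUnion E := by
    intro T _
    by_cases hT : T ∈ K
    · exact mem_union_left _ hT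
    · obtain ⟨s, t, hst, hb⟩ := hc T hT
      exact mem_union_right _ (mem_biUnion.2 ⟨(s, t), by simpa [P] using hst, by simpa [E] using hb⟩)
  have h2 : (P.biUnion E).card ≤
      P.card * (D * Fintype.card I ^ (Fintype.card ι - 1)) := by
    refine card_biUnion_le_card_mul _ _ _ fun p hp => ?_
    exact card_filter_mem_le (bad p.1 p.2) (hbad p.1 p.2) (by simpa [P] using hp)
  have h3 : P.card ≤ Fintype.card ι ^ 2 := by
    refine (card_le_univ _).trans ?_
    rw [Fintype.card_prod, sq]
  have h4 := (card_le_card h1).trans (card_union_le _ _)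
  rw [card_univ, Fintype.card_fun] at h4
  have h5 := Nat.mul_le_mul_right (D * Fintype.card I ^ (Fintype.card ι - 1)) h3
  omega

open Finset in
/-- The number of injective tuples whose set of entries lies in a given family. -/
theorem card_filter_image_mem_le {d : ℕ} {I V : Type*} [Fintype I] [DecidableEq I] [DecidableEq V]
    (r : I → V) (hr : Function.Injective r) (F : Finset (Finset V)) (hF : ∀ Q ∈ F, Q.card = d) :
    (univ.filter fun T : Fin d → I => univ.image (fun t => r (T t)) ∈ F).card ≤
      d ^ d * F.card := by
  refine card_le_mul_card_image_of_maps_to (f := fun T : Fin d → I => univ.image fun t => r (T t))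
    ?_ _ fun Q hQ => ?_
  · intro T hT
    simpa using hT
  -- Each tuple whose set of entries is Q gives a map from d positions into the d elements of Q.
  have h1 : (Fintype.piFinset fun _ : Fin d => Q).card = d ^ d := by
    simp [Fintype.card_piFinset, hF Q hQ]
  rw [← h1]
  refine card_le_card_of_injOn (fun T t => r (T t)) ?_ ?_
  · intro T hT
    have hT : univ.image (fun t => r (T t)) = Q := by simpa using (mem_filter.1 hT).2
    simp only [Finset.mem_coe, Fintype.mem_piFinset]
    intro t
    rw [← hT]
    exact mem_image_of_mem _ (mem_univ t)
  · intro T _ T' _ h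
    funext t
    exact hr (congrFun h t)

/-! ### The approximate extremal structure -/

namespace KGraph

section
variable {k n : ℕ} {H : KGraph k (Fin n)} {A C U : Finset (Fin n)} {α : ℝ}

/-- The vertices that form an edge with `Q`. -/
def nbr (H : KGraph k (Fin n)) (Q : Finset (Fin n)) : Finset (Fin n) :=
  Finset.univ.filter fun x => insert x Q ∈ H.edges

theorem mem_nbr {Q : Finset (Fin n)} {x : Fin n} : x ∈ H.nbr Q ↔ insert x Q ∈ H.edges := by
  simp [nbr]

theorem notMem_of_mem_nbr (hk : 0 < k) {Q : Finset (Fin n)} (hQ : Q.card = k - 1) {x : Fin n}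
    (h : x ∈ H.nbr Q) : x ∉ Q := by
  intro hx
  have h1 := H.card_eq _ (mem_nbr.1 h)
  rw [Finset.insert_eq_of_mem hx] at h1
  omega

theorem degree_eq_card_nbr (hk : 0 < k) {Q : Finset (Fin n)} (hQ : Q.card = k - 1) :
    H.degree Q = (H.nbr Q).card := by
  unfold degree
  have : H.neighbourhood Q = (H.nbr Q).image fun x => {x} := by
    ext T
    simp only [neighbourhood, Finset.mem_filter, Finset.mem_powerset, Finset.mem_image, mem_nbr]
    constructor
    · rintro ⟨hT, he⟩
      have hdisj : Disjoint Q T := Finset.disjoint_left.2 fun v hv hv' =>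
        (Finset.mem_sdiff.1 (hT hv')).2 hv
      have h1 := H.card_eq _ he
      rw [Finset.card_union_of_disjoint hdisj, hQ] at h1
      obtain ⟨x, rfl⟩ := Finset.card_eq_one.1 (show T.card = 1 by omega)
      exact ⟨x, by rwa [Finset.insert_eq, Finset.union_comm], rfl⟩
    · rintro ⟨x, hx, rfl⟩
      refine ⟨?_, by rwa [Finset.union_comm, ← Finset.insert_eq]⟩
      have := notMem_of_mem_nbr hk hQ (mem_nbr.2 hx)
      simpa using this
  rw [this, Finset.card_image_of_injective _ Finset.singleton_injective]

theorem minDegree_le_card_nbr (hk : 0 < k) {Q : Finset (Fin n)} (hQ : Q.card = k - 1) :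
    H.minDegree (k - 1) ≤ (H.nbr Q).card :=
  Nat.sInf_le ⟨Q, hQ, degree_eq_card_nbr hk hQ⟩

theorem degInto_eq {x : Fin n} (hx : x ∉ C) : H.degInto x C =
    ((C.powersetCard (k - 1)).filter fun Q => insert x Q ∈ H.edges).card := by
  unfold degInto
  refine Finset.card_bij' (fun e _ => e.erase x) (fun Q _ => insert x Q) ?_ ?_ ?_ ?_
  · intro e he
    obtain ⟨he, hxe, hs⟩ := Finset.mem_filter.1 he
    rw [Finset.mem_filter, Finset.mem_powersetCard, Finset.card_erase_of_mem hxe, H.card_eq e he,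
      Finset.insert_erase hxe]
    rw [Finset.sdiff_singleton_eq_erase] at hs
    exact ⟨⟨hs, rfl⟩, he⟩
  · intro Q hQ
    obtain ⟨hQ, he⟩ := Finset.mem_filter.1 hQ
    obtain ⟨hQC, hQc⟩ := Finset.mem_powersetCard.1 hQ
    rw [Finset.mem_filter, Finset.sdiff_singleton_eq_erase,
      Finset.erase_insert fun h => hx (hQC h)]
    exact ⟨he, by simp, hQC⟩
  · intro e he
    exact Finset.insert_erase (Finset.mem_filter.1 he).2.1
  · intro Q hQ
    exact Finset.erase_insert fun h =>
      hx ((Finset.mem_powersetCard.1 (Finset.mem_filter.1 hQ).1).1 h)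

theorem nbr_subset_compl (hC : H.IsIndep C) {Q : Finset (Fin n)} (hQ : Q ⊆ C) :
    H.nbr Q ⊆ Finset.univ \ C := by
  intro x hx
  simp only [Finset.mem_sdiff, Finset.mem_univ, true_and]
  exact fun hxC => hC _ (mem_nbr.1 hx) (Finset.insert_subset hxC hQ)

/-- Both sides count pairs of a vertex x and a (k-1)-subset Q of C forming an edge; independence
forces x to lie outside C. -/
theorem sum_degInto (hC : H.IsIndep C) :
    ∑ x ∈ Finset.univ \ C, H.degInto x C = ∑ Q ∈ C.powersetCard (k - 1), (H.nbr Q).card := by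
  have h := Finset.sum_card_bipartiteAbove_eq_sum_card_bipartiteBelow
    (s := Finset.univ \ C) (t := C.powersetCard (k - 1)) (fun x Q => insert x Q ∈ H.edges)
  rw [Finset.sum_congr rfl fun x hx => degInto_eq (Finset.mem_sdiff.1 hx).2]
  refine h.trans (Finset.sum_congr rfl fun Q hQ => ?_)
  congr 1
  ext x
  simp only [Finset.bipartiteBelow, Finset.mem_filter, mem_nbr]
  exact ⟨fun h => h.2, fun h => ⟨nbr_subset_compl hC (Finset.mem_powersetCard.1 hQ).1
    (mem_nbr.2 h), h⟩⟩

/-- The vertices are divided into `A`, the independent set `C` and a small rest, almost as in the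
extremal example. -/
structure Extremal (H : KGraph k (Fin n)) (A C : Finset (Fin n)) (α : ℝ) : Prop where
  disj : Disjoint A C
  indep : H.IsIndep C
  codeg : ∀ Q : Finset (Fin n), Q.card = k - 1 → (1 - α ^ 3) * (n / k) ≤ ((H.nbr Q).card : ℝ)
  compl_le : ((Finset.univ \ C).card : ℝ) ≤ n / k + α ^ 3 * n
  le_compl : (1 - α ^ 3) * (n / k) ≤ ((Finset.univ \ C).card : ℝ)
  rest_le : ((Finset.univ \ (A ∪ C)).card : ℝ) ≤ α ^ 2 * n
  link : ∀ x ∈ A, (((C.powersetCard (k - 1)).filter fun Q => insert x Q ∉ H.edges).card : ℝ) ≤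
    α * n ^ (k - 1)

theorem partA_subset : H.partA α C ⊆ Finset.univ \ C := Finset.filter_subset _ _

/-- The main point is the bound on B. In the double count a vertex of A contributes at most b, the
number of (k-1)-subsets of C, and a vertex of B at most (1-α)b. So |A| + (1-α)|B| ≥ (1-α³)n/k, while
|A| + |B| = n - |C| is at most n/k + α³(n - n/k). -/
theorem extremal_of_minDegree (hk : 3 ≤ k) (hα : 0 < α) (hα1 : α ^ 3 ≤ 1 / 4) (hn : 4 * k ≤ n)
    (hdeg : (1 - α ^ 3) * (n / k) ≤ (H.minDegree (k - 1) : ℝ)) (hC : H.IsIndep C)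
    (hCcard : (1 - α ^ 3) * (((k : ℝ) - 1) / k * n) ≤ (C.card : ℝ)) :
    H.Extremal (H.partA α C) C α := by
  have hk0 : 0 < k := by omega
  have hkR : (3 : ℝ) ≤ k := by exact_mod_cast hk
  have hnR : 4 * (k : ℝ) ≤ n := by exact_mod_cast hn
  have hu : (n : ℝ) / k * k = n := div_mul_cancel₀ _ (by positivity)
  have hu0 : 0 ≤ (n : ℝ) / k := by positivity
  have hucard : ((k : ℝ) - 1) / k * n = n - n / k := by field_simp
  rw [hucard] at hCcard
  have hα3 : 0 < α ^ 3 := by positivity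
  have hcodeg : ∀ Q : Finset (Fin n), Q.card = k - 1 →
      (1 - α ^ 3) * (n / k) ≤ ((H.nbr Q).card : ℝ) := fun Q hQ =>
    hdeg.trans (by exact_mod_cast minDegree_le_card_nbr hk0 hQ)
  have hcompl : ((Finset.univ \ C).card : ℝ) = n - C.card := by
    have : (Finset.univ \ C).card + C.card = n := by
      rw [Finset.card_sdiff_add_card_eq_card (Finset.subset_univ C)]; simp
    have : ((Finset.univ \ C).card : ℝ) + C.card = n := by exact_mod_cast this
    linarith
  have hCk : k - 1 ≤ C.card := by
    have h1 : (k : ℝ) ≤ C.card := by nlinarith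
    have h2 : k ≤ C.card := by exact_mod_cast h1
    omega
  set b := C.card.choose (k - 1) with hb
  have hb0 : (0 : ℝ) < b := by exact_mod_cast Nat.choose_pos hCk
  have hpart : ∀ x ∈ H.partA α C, (1 - α) * (b : ℝ) ≤ H.degInto x C := by
    intro x hx
    exact (Finset.mem_filter.1 hx).2
  have hdisj : Disjoint (H.partA α C) C :=
    Finset.disjoint_left.2 fun x hx => (Finset.mem_sdiff.1 (partA_subset hx)).2
  have hcompl_le : ((Finset.univ \ C).card : ℝ) ≤ n / k + α ^ 3 * n := by
    rw [hcompl]; nlinarith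
  have hle : ∀ x ∈ Finset.univ \ C, H.degInto x C ≤ b := by
    intro x hx
    rw [degInto_eq (Finset.mem_sdiff.1 hx).2, hb, ← Finset.card_powersetCard]
    exact Finset.card_filter_le _ _
  refine ⟨hdisj, hC, hcodeg, hcompl_le, ?_, ?_, ?_⟩
  · obtain ⟨Q, hQ, hQc⟩ := Finset.exists_subset_card_eq hCk
    refine (hcodeg Q hQc).trans ?_
    exact_mod_cast Finset.card_le_card (nbr_subset_compl hC hQ)
  · set B := Finset.univ \ (H.partA α C ∪ C) with hB
    have hsplit : Finset.univ \ C = H.partA α C ∪ B := by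
      ext x
      have := @partA_subset k n H C α x
      simp only [hB, Finset.mem_sdiff, Finset.mem_univ, true_and, Finset.mem_union] at this ⊢
      tauto
    have hAB : Disjoint (H.partA α C) B := Finset.disjoint_left.2 fun x hx hxB => by
      simp [hB, hx] at hxB
    have h1 : (∑ x ∈ Finset.univ \ C, (H.degInto x C : ℝ)) =
        ∑ Q ∈ C.powersetCard (k - 1), ((H.nbr Q).card : ℝ) := by
      exact_mod_cast sum_degInto hC
    have h2 : (b : ℝ) * ((1 - α ^ 3) * (n / k)) ≤
        ∑ Q ∈ C.powersetCard (k - 1), ((H.nbr Q).card : ℝ) := by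
      have := Finset.card_nsmul_le_sum (C.powersetCard (k - 1))
        (fun Q => ((H.nbr Q).card : ℝ)) _ fun Q hQ => hcodeg Q (Finset.mem_powersetCard.1 hQ).2
      rwa [Finset.card_powersetCard, nsmul_eq_mul] at this
    rw [← h1, hsplit, Finset.sum_union hAB] at h2
    have h3 : ∑ x ∈ H.partA α C, (H.degInto x C : ℝ) ≤ (H.partA α C).card * b := by
      have := Finset.sum_le_card_nsmul (H.partA α C) (fun x => (H.degInto x C : ℝ)) b
        fun x hx => by exact_mod_cast hle x (partA_subset hx)
      rwa [nsmul_eq_mul] at this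
    have h4 : ∑ x ∈ B, (H.degInto x C : ℝ) ≤ B.card * ((1 - α) * b) := by
      have := Finset.sum_le_card_nsmul B (fun x => (H.degInto x C : ℝ)) ((1 - α) * b)
        fun x hx => by
          simp only [hB, Finset.mem_sdiff, Finset.mem_univ, true_and, Finset.mem_union, not_or]
            at hx
          by_contra hc
          refine hx.1 (Finset.mem_filter.2 ⟨by simp [hx.2], ?_⟩)
          exact (not_le.1 hc).le
      rwa [nsmul_eq_mul] at this
    have h5 : ((Finset.univ \ C).card : ℝ) = (H.partA α C).card + B.card := by
      rw [hsplit, Finset.card_union_of_disjoint hAB]; push_cast; ring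
    have h6 : (b : ℝ) * ((1 - α ^ 3) * (n / k)) ≤
        b * ((H.partA α C).card + B.card * (1 - α)) := by nlinarith
    have h7 := le_of_mul_le_mul_left h6 hb0
    -- The left side is the difference of |A| + |B| and |A| + (1-α)|B|; the right side equals α³n.
    have h8 : α * B.card ≤ α ^ 3 * (n - n / k) + α ^ 3 * (n / k) := by
      rw [hcompl] at h5; nlinarith
    have h9 : α * B.card ≤ α * (α ^ 2 * n) := by nlinarith
    exact le_of_mul_le_mul_left h9 hα
  · intro x hx
    have h1 := hpart x hx
    have hxC := (Finset.mem_sdiff.1 (partA_subset hx)).2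
    rw [degInto_eq hxC] at h1
    have h2 := Finset.card_filter_add_card_filter_not (s := C.powersetCard (k - 1))
      (fun Q => insert x Q ∈ H.edges)
    rw [Finset.card_powersetCard, ← hb] at h2
    have h3 : (((C.powersetCard (k - 1)).filter fun Q => insert x Q ∉ H.edges).card : ℝ) ≤
        α * b := by
      have h2' : ((((C.powersetCard (k - 1)).filter fun Q => insert x Q ∈ H.edges).card : ℝ)) +
        ((C.powersetCard (k - 1)).filter fun Q => insert x Q ∉ H.edges).card = b := by
        exact_mod_cast h2
      linarith
    refine h3.trans (mul_le_mul_of_nonneg_left ?_ hα.le)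
    have h4 : b ≤ n ^ (k - 1) := (Nat.choose_le_pow _ _).trans
      (Nat.pow_le_pow_left ((Finset.card_le_univ C).trans (by simp)) _)
    exact_mod_cast h4

end
end KGraph

/-! ### Numerical conditions, and edges with few vertices in A -/

namespace KGraph
section
variable {k n : ℕ} {H : KGraph k (Fin n)} {A C U : Finset (Fin n)} {α : ℝ}
  {M : Finset (Finset (Fin n))} {r : ℕ}

/-- The parameter `α` is small and `n` is large in terms of `k`. -/
structure SmallParam (k n : ℕ) (α : ℝ) : Prop where
  three_le : 3 ≤ k
  pos : 0 < α
  le : α * (4 * (2 * (k : ℝ) ^ 2) ^ k) ≤ 1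
  large : 100 * k ^ 3 ≤ n

section Numerics
variable (h : SmallParam k n α)
include h

theorem SmallParam.three_leR : (3 : ℝ) ≤ k := by exact_mod_cast h.three_le

theorem SmallParam.le_pow_six : α * (32 * (k : ℝ) ^ 6) ≤ 1 := by
  have hk := h.three_leR
  refine le_trans (mul_le_mul_of_nonneg_left ?_ h.pos.le) h.le
  have h1 : (2 * (k : ℝ) ^ 2) ^ 3 ≤ (2 * (k : ℝ) ^ 2) ^ k :=
    pow_le_pow_right₀ (by nlinarith) h.three_le
  calc 32 * (k : ℝ) ^ 6 = 4 * (2 * (k : ℝ) ^ 2) ^ 3 := by ring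
    _ ≤ _ := by linarith

theorem SmallParam.mul_le : α * k ≤ 1 / 32 := by
  have hk := h.three_leR
  have h1 : (k : ℝ) ^ 1 ≤ (k : ℝ) ^ 6 := pow_le_pow_right₀ (by linarith) (by norm_num)
  have h2 := mul_le_mul_of_nonneg_left h1 h.pos.le
  have h3 := h.le_pow_six
  rw [pow_one] at h2
  linarith

theorem SmallParam.le_one : α ≤ 1 / 96 := by
  have hk := h.three_leR
  have := h.mul_le
  have := mul_le_mul_of_nonneg_left hk h.pos.le
  linarith

theorem SmallParam.sq_mul_le : k * α ^ 2 * n ≤ (n : ℝ) / k / 1024 := by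
  have hk := h.three_leR
  have h1 : (α * k) ^ 2 ≤ (1 / 32) ^ 2 :=
    pow_le_pow_left₀ (mul_nonneg h.pos.le (by linarith)) h.mul_le 2
  have hu : (n : ℝ) / k * k = n := div_mul_cancel₀ _ (by linarith)
  have hu0 : (0 : ℝ) ≤ n / k := by positivity
  calc k * α ^ 2 * n = (α * k) ^ 2 * ((n : ℝ) / k) := by nth_rw 1 [← hu]; ring
    _ ≤ (1 / 32) ^ 2 * ((n : ℝ) / k) := mul_le_mul_of_nonneg_right h1 hu0
    _ = _ := by ring

theorem SmallParam.sq_le : α ^ 2 * n ≤ (n : ℝ) / k / 1024 := by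
  refine le_trans ?_ h.sq_mul_le
  have hk := h.three_leR
  have : 0 ≤ α ^ 2 * (n : ℝ) := by positivity
  nlinarith

theorem SmallParam.cube_le_sq : α ^ 3 * n ≤ α ^ 2 * n := by
  have h1 : α ^ 3 ≤ α ^ 2 :=
    pow_le_pow_of_le_one h.pos.le (by linarith [h.le_one]) (by norm_num)
  exact mul_le_mul_of_nonneg_right h1 (Nat.cast_nonneg n)

theorem SmallParam.cube_le : α ^ 3 ≤ 1 / 1000 := by
  have h1 : α ^ 3 ≤ (1 / 96) ^ 3 := pow_le_pow_left₀ h.pos.le h.le_one 3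
  linarith

theorem SmallParam.le_div : 100 * (k : ℝ) ^ 2 ≤ n / k := by
  have hk := h.three_leR
  rw [le_div_iff₀ (by linarith)]
  have h1 : ((100 * k ^ 3 : ℕ) : ℝ) ≤ n := by exact_mod_cast h.large
  push_cast at h1
  linarith [h1, show (k : ℝ) ^ 2 * k = k ^ 3 by ring]

theorem SmallParam.mul_le_div : 300 * (k : ℝ) ≤ n / k := by
  have hk := h.three_leR
  have := h.le_div
  nlinarith

end Numerics

/-- Take k-1 vertices of C outside X. They have more neighbours than X has elements, all outside C;
one that avoids X also avoids the rest B ⊆ X, so it lies in A. -/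
theorem Extremal.exists_edge_one (hE : H.Extremal A C α) (hp : SmallParam k n α)
    {X : Finset (Fin n)} (hX : (X.card : ℝ) ≤ (n : ℝ) / k / 100)
    (hAX : Finset.univ \ (A ∪ C) ⊆ X) :
    ∃ e ∈ H.edges, Disjoint e X ∧ (e ∩ A).card = 1 := by
  have hk := hp.three_leR
  have hk3 := hp.three_le
  have hu := hp.mul_le_div
  have hu3 : (n : ℝ) / k * k = n := div_mul_cancel₀ _ (by linarith)
  have h1 : k - 1 ≤ (C \ X).card := by
    have h2 : C.card ≤ (C \ X).card + X.card := by
      have := Finset.le_card_sdiff X C; omega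
    have h3 : (C.card : ℝ) ≤ (C \ X).card + X.card := by exact_mod_cast h2
    have h4 : ((Finset.univ \ C).card : ℝ) + C.card = n := by
      have := Finset.card_sdiff_add_card_eq_card (Finset.subset_univ C)
      rw [Finset.card_univ, Fintype.card_fin] at this
      exact_mod_cast this
    have h5 := hE.compl_le
    have h6 := hp.cube_le_sq
    have h7 := hp.sq_le
    have h8 : (k : ℝ) ≤ (C \ X).card := by nlinarith
    have h9 : k ≤ (C \ X).card := by exact_mod_cast h8
    omega
  obtain ⟨Q, hQ, hQc⟩ := Finset.exists_subset_card_eq h1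
  have h2 : X.card < (H.nbr Q).card := by
    have h3 := hE.codeg Q hQc
    have h4 := hp.cube_le
    have : (X.card : ℝ) < (H.nbr Q).card := by nlinarith
    exact_mod_cast this
  obtain ⟨x, hx, hxX⟩ := Finset.exists_mem_notMem_of_card_lt_card h2
  have hQC : Q ⊆ C := hQ.trans Finset.sdiff_subset
  have hxC := (Finset.mem_sdiff.1 (nbr_subset_compl hE.indep hQC hx)).2
  have hxA : x ∈ A := by
    by_contra hxA
    exact hxX (hAX (by simp [hxA, hxC]))
  refine ⟨insert x Q, mem_nbr.1 hx, ?_, ?_⟩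
  · rw [Finset.disjoint_insert_left]
    exact ⟨hxX, Finset.disjoint_left.2 fun v hv => (Finset.mem_sdiff.1 (hQ hv)).2⟩
  · have : insert x Q ∩ A = {x} := by
      ext v
      simp only [Finset.mem_inter, Finset.mem_insert, Finset.mem_singleton]
      constructor
      · rintro ⟨rfl | hv, hvA⟩
        · rfl
        · exact (Finset.disjoint_left.1 hE.disj hvA (hQC hv)).elim
      · rintro rfl
        exact ⟨.inl rfl, hxA⟩
    rw [this, Finset.card_singleton]

theorem Extremal.le_card_sdiff (hE : H.Extremal A C α) (hp : SmallParam k n α)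
    {X : Finset (Fin n)} (hX : (X.card : ℝ) ≤ (n : ℝ) / k / 100) : 2 ≤ (A \ X).card := by
  have hk := hp.three_leR
  have hu := hp.mul_le_div
  have h2 : A.card ≤ (A \ X).card + X.card := by
    have := Finset.le_card_sdiff X A; omega
  have h3 : (A.card : ℝ) ≤ (A \ X).card + X.card := by exact_mod_cast h2
  have h4 : (Finset.univ \ C).card ≤ A.card + (Finset.univ \ (A ∪ C)).card := by
    refine le_trans (Finset.card_le_card ?_) (Finset.card_union_le _ _)
    intro v
    simp only [Finset.mem_sdiff, Finset.mem_union, Finset.mem_univ, true_and]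
    tauto
  have h5 : ((Finset.univ \ C).card : ℝ) ≤ A.card + (Finset.univ \ (A ∪ C)).card := by
    exact_mod_cast h4
  have h6 := hE.le_compl
  have h7 := hE.rest_le
  have h8 := hp.sq_le
  have h9 := hp.cube_le
  have h10 : (2 : ℝ) ≤ (A \ X).card := by nlinarith
  exact_mod_cast h10

/-- Two vertices of A and k-3 of C have a common neighbour outside X, but there is no control over
whether it belongs to A. -/
theorem Extremal.exists_edge_two_or_three (hE : H.Extremal A C α) (hp : SmallParam k n α)
    {X : Finset (Fin n)} (hX : (X.card : ℝ) ≤ (n : ℝ) / k / 100) :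
    ∃ e ∈ H.edges, Disjoint e X ∧ ((e ∩ A).card = 2 ∨ (e ∩ A).card = 3) := by
  have hk := hp.three_leR
  have hk3 := hp.three_le
  have hu := hp.mul_le_div
  have hu3 : (n : ℝ) / k * k = n := div_mul_cancel₀ _ (by linarith)
  have h1 : k - 3 ≤ (C \ X).card := by
    have h2 : C.card ≤ (C \ X).card + X.card := by
      have := Finset.le_card_sdiff X C; omega
    have h3 : (C.card : ℝ) ≤ (C \ X).card + X.card := by exact_mod_cast h2
    have h4 : ((Finset.univ \ C).card : ℝ) + C.card = n := by
      have := Finset.card_sdiff_add_card_eq_card (Finset.subset_univ C)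
      rw [Finset.card_univ, Fintype.card_fin] at this
      exact_mod_cast this
    have h5 := hE.compl_le
    have h6 := hp.cube_le_sq
    have h7 := hp.sq_le
    have h8 : (k : ℝ) ≤ (C \ X).card := by nlinarith
    have h9 : k ≤ (C \ X).card := by exact_mod_cast h8
    omega
  obtain ⟨Q, hQ, hQc⟩ := Finset.exists_subset_card_eq h1
  obtain ⟨P, hP, hPc⟩ := Finset.exists_subset_card_eq (hE.le_card_sdiff hp hX)
  have hPA : P ⊆ A := hP.trans Finset.sdiff_subset
  have hQC : Q ⊆ C := hQ.trans Finset.sdiff_subset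
  have hPQ : (P ∪ Q).card = k - 1 := by
    rw [Finset.card_union_of_disjoint (hE.disj.mono hPA hQC)]; omega
  have h2 : X.card < (H.nbr (P ∪ Q)).card := by
    have h3 := hE.codeg _ hPQ
    have h4 := hp.cube_le
    have : (X.card : ℝ) < (H.nbr (P ∪ Q)).card := by nlinarith
    exact_mod_cast this
  obtain ⟨x, hx, hxX⟩ := Finset.exists_mem_notMem_of_card_lt_card h2
  have hxn := notMem_of_mem_nbr (by omega) hPQ hx
  rw [Finset.mem_union, not_or] at hxn
  refine ⟨insert x (P ∪ Q), mem_nbr.1 hx, ?_, ?_⟩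
  · rw [Finset.disjoint_insert_left, Finset.disjoint_union_left]
    exact ⟨hxX, Finset.disjoint_left.2 fun v hv => (Finset.mem_sdiff.1 (hP hv)).2,
      Finset.disjoint_left.2 fun v hv => (Finset.mem_sdiff.1 (hQ hv)).2⟩
  · have hinter : (P ∪ Q) ∩ A = P := by
      ext v
      simp only [Finset.mem_inter, Finset.mem_union]
      constructor
      · rintro ⟨hv | hv, hvA⟩
        · exact hv
        · exact (Finset.disjoint_left.1 hE.disj hvA (hQC hv)).elim
      · exact fun hv => ⟨.inl hv, hPA hv⟩
    by_cases hxA : x ∈ A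
    · right
      rw [Finset.insert_inter_of_mem hxA, hinter, Finset.card_insert_of_notMem hxn.1, hPc]
    · left
      rw [Finset.insert_inter_of_notMem hxA, hinter, hPc]

/-- Four is either 2 + 2 or 3 + 1: as soon as an edge with three vertices in A turns up, it is
paired with one from `exists_edge_one`. The room of k in `hX` is for the first edge, which the
second has to avoid. -/
theorem Extremal.exists_pair (hE : H.Extremal A C α) (hp : SmallParam k n α)
    {X : Finset (Fin n)} (hX : (X.card : ℝ) + k ≤ (n : ℝ) / k / 100)
    (hAX : Finset.univ \ (A ∪ C) ⊆ X) :
    ∃ e₁ ∈ H.edges, ∃ e₂ ∈ H.edges, Disjoint e₁ e₂ ∧ Disjoint (e₁ ∪ e₂) X ∧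
      ((e₁ ∪ e₂) ∩ A).card = 4 := by
  have hX0 : (X.card : ℝ) ≤ (n : ℝ) / k / 100 := by linarith [hp.three_leR]
  have hgrow : ∀ e ∈ H.edges, ((X ∪ e).card : ℝ) ≤ (n : ℝ) / k / 100 := by
    intro e he
    have h1 := Finset.card_union_le X e
    rw [H.card_eq e he] at h1
    have h2 : ((X ∪ e).card : ℝ) ≤ X.card + k := by exact_mod_cast h1
    linarith
  have hcomb : ∀ e₁ e₂ : Finset (Fin n), Disjoint e₁ X → Disjoint e₂ (X ∪ e₁) →
      (e₁ ∩ A).card + (e₂ ∩ A).card = 4 → Disjoint e₁ e₂ ∧ Disjoint (e₁ ∪ e₂) X ∧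
      ((e₁ ∪ e₂) ∩ A).card = 4 := by
    intro e₁ e₂ h1 h2 h3
    rw [Finset.disjoint_union_right] at h2
    refine ⟨h2.2.symm, Finset.disjoint_union_left.2 ⟨h1, h2.1⟩, ?_⟩
    rw [Finset.union_inter_distrib_right, Finset.card_union_of_disjoint, h3]
    exact h2.2.symm.mono Finset.inter_subset_left Finset.inter_subset_left
  have hone : ∀ e ∈ H.edges, Disjoint e X → (e ∩ A).card = 3 →
      ∃ e₁ ∈ H.edges, ∃ e₂ ∈ H.edges, Disjoint e₁ e₂ ∧ Disjoint (e₁ ∪ e₂) X ∧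
      ((e₁ ∪ e₂) ∩ A).card = 4 := by
    intro e he hd h3
    obtain ⟨f, hf, hfd, h1⟩ := hE.exists_edge_one hp (hgrow e he)
      (hAX.trans Finset.subset_union_left)
    exact ⟨e, he, f, hf, hcomb e f hd hfd (by omega)⟩
  obtain ⟨e₁, he₁, hd₁, h1 | h1⟩ := hE.exists_edge_two_or_three hp hX0
  · obtain ⟨e₂, he₂, hd₂, h2 | h2⟩ := hE.exists_edge_two_or_three hp (hgrow e₁ he₁)
    · exact ⟨e₁, he₁, e₂, he₂, hcomb e₁ e₂ hd₁ hd₂ (by omega)⟩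
    · exact hone e₂ he₂ (hd₂.mono_right Finset.subset_union_left) h2
  · exact hone e₁ he₁ hd₁ h1

/-- For `Q ⊆ C` there are few vertices outside `C` that do not form an edge with `Q`. -/
theorem Extremal.card_compl_sdiff_nbr_le (hE : H.Extremal A C α) (hp : SmallParam k n α)
    {Q : Finset (Fin n)} (hQ : Q ⊆ C) (hQc : Q.card = k - 1) :
    (((Finset.univ \ C) \ H.nbr Q).card : ℝ) ≤ 2 * α ^ 3 * n := by
  have hk := hp.three_leR
  have h1 := Finset.card_sdiff_add_card_eq_card (nbr_subset_compl hE.indep hQ)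
  have h2 : (((Finset.univ \ C) \ H.nbr Q).card : ℝ) + (H.nbr Q).card =
    (Finset.univ \ C).card := by exact_mod_cast h1
  have h3 := hE.compl_le
  have h4 := hE.codeg Q hQc
  have h5 : (n : ℝ) / k ≤ n := div_le_self (Nat.cast_nonneg n) (by linarith)
  have h6 : α ^ 3 * ((n : ℝ) / k) ≤ α ^ 3 * n :=
    mul_le_mul_of_nonneg_left h5 (pow_nonneg hp.pos.le 3)
  linarith

end
end KGraph

/-! ### Existence of exchanges -/

namespace KGraph
section
variable {k n : ℕ} {H : KGraph k (Fin n)} {A C U : Finset (Fin n)} {α : ℝ}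
  {M : Finset (Finset (Fin n))} {r : ℕ}

/-- Each of the two terms is at most a quarter of m^(k-1). For the first, n ≤ 2km turns the bound
into α(2k²)^(k-1) m^(k-1), which explains the form of `SmallParam.le`; for the second, D is a small
fraction of m. -/
theorem SmallParam.count_lt (hp : SmallParam k n α) {m D F : ℕ} (hm : n ≤ 2 * k * m)
    (hD : (D : ℝ) ≤ 2 * α ^ 3 * n) (hF : (F : ℝ) ≤ α * n ^ (k - 1)) :
    (k - 1) ^ (k - 1) * F + (k - 1) ^ 2 * ((D + 2) * m ^ (k - 1 - 1)) < m ^ (k - 1) := by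
  have hk3 := hp.three_le
  have hk := hp.three_leR
  have hα := hp.pos
  obtain ⟨d, rfl⟩ : ∃ d, k = d + 2 := ⟨k - 2, by omega⟩
  simp only [show d + 2 - 1 = d + 1 by omega, show d + 1 - 1 = d by omega] at hF ⊢
  set q : ℝ := ((d + 2 : ℕ) : ℝ) with hq
  have hqd : ((d + 1 : ℕ) : ℝ) ≤ q := by rw [hq]; push_cast; linarith
  have hmR : (n : ℝ) ≤ 2 * q * m := by rw [hq]; exact_mod_cast hm
  have hm0 : (0 : ℝ) ≤ m := Nat.cast_nonneg m
  have hmlarge : 50 * q ^ 2 ≤ m := by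
    have h1 := hp.le_div
    rw [le_div_iff₀ (by linarith)] at h1
    have h2 : (2 * q) * (50 * q ^ 2) ≤ (2 * q) * m := by linarith
    exact le_of_mul_le_mul_left h2 (by linarith)
  have hm1 : (0 : ℝ) < m := lt_of_lt_of_le (by positivity) hmlarge
  have b1 : ((d + 1 : ℕ) : ℝ) ^ (d + 1) * F ≤ (m : ℝ) ^ (d + 1) / 4 := by
    have e1 : (n : ℝ) ^ (d + 1) ≤ (2 * q * m) ^ (d + 1) :=
      pow_le_pow_left₀ (Nat.cast_nonneg n) hmR _
    have e2 : ((d + 1 : ℕ) : ℝ) ^ (d + 1) ≤ q ^ (d + 1) :=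
      pow_le_pow_left₀ (Nat.cast_nonneg _) hqd _
    have e3 : (2 * q ^ 2) ^ (d + 1) ≤ (2 * q ^ 2) ^ (d + 2) :=
      pow_le_pow_right₀ (by nlinarith) (by omega)
    have e4 : α * (4 * (2 * q ^ 2) ^ (d + 1)) ≤ 1 :=
      le_trans (mul_le_mul_of_nonneg_left (by linarith) hα.le) hp.le
    calc ((d + 1 : ℕ) : ℝ) ^ (d + 1) * F ≤ q ^ (d + 1) * (α * (2 * q * m) ^ (d + 1)) :=
          mul_le_mul e2 (hF.trans (mul_le_mul_of_nonneg_left e1 hα.le)) (Nat.cast_nonneg F)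
            (by positivity)
      _ = (α * (4 * (2 * q ^ 2) ^ (d + 1))) * ((m : ℝ) ^ (d + 1) / 4) := by
          rw [show 2 * q ^ 2 = q * (2 * q) by ring, mul_pow, mul_pow q (2 * q)]; ring
      _ ≤ 1 * ((m : ℝ) ^ (d + 1) / 4) := mul_le_mul_of_nonneg_right e4 (by positivity)
      _ = _ := one_mul _
  have b2 : ((d + 1 : ℕ) : ℝ) ^ 2 * (((D : ℝ) + 2) * (m : ℝ) ^ d) ≤ (m : ℝ) ^ (d + 1) / 4 := by
    have e1 : ((d + 1 : ℕ) : ℝ) ^ 2 ≤ q ^ 2 := pow_le_pow_left₀ (Nat.cast_nonneg _) hqd _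
    have e2 : (α * q) ^ 3 ≤ (1 / 32) ^ 3 :=
      pow_le_pow_left₀ (mul_nonneg hα.le (by linarith)) hp.mul_le 3
    have e3 : (D : ℝ) ≤ 2 * α ^ 3 * (2 * q * m) :=
      hD.trans (mul_le_mul_of_nonneg_left hmR (by positivity))
    have e4 : q ^ 2 * (D + 2) ≤ m / 4 := by
      calc q ^ 2 * ((D : ℝ) + 2) ≤ q ^ 2 * (2 * α ^ 3 * (2 * q * m) + 2) :=
            mul_le_mul_of_nonneg_left (by linarith) (by positivity)
        _ = 4 * (α * q) ^ 3 * m + 2 * q ^ 2 := by ring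
        _ ≤ 4 * (1 / 32) ^ 3 * m + 2 * q ^ 2 := by
            have := mul_le_mul_of_nonneg_right e2 hm0; linarith
        _ ≤ m / 4 := by linarith
    calc ((d + 1 : ℕ) : ℝ) ^ 2 * (((D : ℝ) + 2) * (m : ℝ) ^ d)
        ≤ q ^ 2 * (((D : ℝ) + 2) * (m : ℝ) ^ d) :=
          mul_le_mul_of_nonneg_right e1 (by positivity)
      _ = (q ^ 2 * (D + 2)) * (m : ℝ) ^ d := by ring
      _ ≤ (m / 4) * (m : ℝ) ^ d := mul_le_mul_of_nonneg_right e4 (by positivity)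
      _ = _ := by ring
  have b3 : (0 : ℝ) < (m : ℝ) ^ (d + 1) := by positivity
  have : ((d + 1 : ℕ) : ℝ) ^ (d + 1) * F + ((d + 1 : ℕ) : ℝ) ^ 2 * (((D : ℝ) + 2) * (m : ℝ) ^ d) <
    (m : ℝ) ^ (d + 1) := by linarith
  exact_mod_cast this

open Finset in
-- Union bound over the (k-1)-tuples T of blocks. The new block 0 is a condition on all of T,
-- controlled by the link of the A-vertex of block j. Every other new block involves only two
-- entries of T, and for a given first entry the codegree condition excludes few values of the
-- second.
theorem Extremal.exists_exchange (hE : H.Extremal A C α) (hp : SmallParam k n α) {m : ℕ}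
    (hm : n ≤ 2 * k * m) {g : ℕ → ℕ → Fin n}
    (hg : ∀ b < m, ∀ p < k, ∀ b' < m, ∀ p' < k, g b p = g b' p' → b = b' ∧ p = p')
    (hA : ∀ b < m, g b 0 ∈ A) (hC : ∀ b < m, ∀ p < k, p ≠ 0 → g b p ∈ C) {j : ℕ} (hj : j < m) :
    ∃ i : ℕ → ℕ, i 0 = j ∧ (∀ t < k, i t < m) ∧ (∀ s < k, ∀ t < k, i s = i t → s = t) ∧
      ∀ b < k, (range k).image (fun p => g (i (srcBlock k b p)) (srcPos b p)) ∈ H.edges := by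
  have hk := hp.three_le
  -- The C-vertices of the new block b when block β is its own old block: position b of block j, and
  -- positions 2, …, k-1 of β.
  let R : ℕ → ℕ → Finset (Fin n) := fun b β => insert (g j b) ((Ico 2 k).image (g β))
  have hRC : ∀ b < k, b ≠ 0 → ∀ β < m, R b β ⊆ C := by
    intro b hb hb0 β hβ
    refine insert_subset (hC j hj b hb hb0) fun v hv => ?_
    obtain ⟨p, hp, rfl⟩ := mem_image.1 hv
    rw [mem_Ico] at hp
    exact hC β hβ p hp.2 (by omega)
  have hRcard : ∀ b < k, ∀ β < m, β ≠ j → (R b β).card = k - 1 := by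
    intro b hb β hβ hne
    rw [card_insert_of_notMem, card_image_of_injOn, Nat.card_Ico]
    · omega
    · intro p hp q hq hpq
      rw [coe_Ico, Set.mem_Ico] at hp hq
      exact (hg β hβ p hp.2 β hβ q hq.2 hpq).2
    · intro hv
      obtain ⟨p, hp, hpe⟩ := mem_image.1 hv
      rw [mem_Ico] at hp
      exact hne (hg β hβ p hp.2 j hj b hb hpe).1
  -- For β = j the set R b β can have fewer than k-1 elements, so the codegree bound is not
  -- available. The default is harmless, as j is excluded by `bad`.
  let far : ℕ → Fin m → Finset (Fin m) := fun b β =>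
    if (β : ℕ) = j then ∅ else univ.filter fun γ => insert (g γ 0) (R b β) ∉ H.edges
  -- The two extra elements force the entries to be distinct and different from j. The condition is
  -- imposed for all ordered pairs of indices, although only cyclically consecutive ones are needed.
  let bad : Fin (k - 1) → Fin (k - 1) → Fin m → Finset (Fin m) := fun s _ β =>
    far (s + 1) β ∪ {β, ⟨j, hj⟩}
  set D := ⌊2 * α ^ 3 * (n : ℝ)⌋₊ with hD
  have hfar : ∀ b < k, b ≠ 0 → ∀ β, (far b β).card ≤ D := by
    intro b hb hb0 β
    by_cases hβ : (β : ℕ) = j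
    · simp [far, hβ]
    · refine Nat.le_floor (le_trans ?_ (hE.card_compl_sdiff_nbr_le hp (hRC b hb hb0 β β.2)
        (hRcard b hb β β.2 hβ)))
      simp only [far, if_neg hβ]
      norm_cast
      refine card_le_card_of_injOn (fun γ : Fin m => g γ 0) ?_ ?_
      · intro γ hγ
        have hγ := (mem_filter.1 (mem_coe.1 hγ)).2
        simp only [coe_sdiff, Set.mem_sdiff, mem_coe, mem_univ, true_and, mem_nbr]
        exact ⟨disjoint_left.1 hE.disj (hA γ γ.2), hγ⟩
      · intro γ _ γ' _ h
        exact Fin.ext (hg γ γ.2 0 (by omega) γ' γ'.2 0 (by omega) h).1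
  have hbad : ∀ s t β, (bad s t β).card ≤ D + 2 := by
    intro s t β
    refine (card_union_le _ _).trans (Nat.add_le_add (hfar _ (by omega) (by omega) β) ?_)
    exact card_le_two
  let F := (C.powersetCard (k - 1)).filter fun Q => insert (g j 0) Q ∉ H.edges
  have hr : Function.Injective fun β : Fin m => g β 1 := fun β γ h =>
    Fin.ext (hg β β.2 1 (by omega) γ γ.2 1 (by omega) h).1
  let K : Finset (Fin (k - 1) → Fin m) := univ.filter fun T => univ.image (fun t => g (T t) 1) ∈ F
  have hK : K.card ≤ (k - 1) ^ (k - 1) * F.card :=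
    card_filter_image_mem_le (fun β : Fin m => g β 1) hr F fun Q hQ =>
      (mem_powersetCard.1 (mem_filter.1 hQ).1).2
  obtain ⟨T, hTK, hT⟩ := exists_avoiding bad hbad K (by
    rw [Fintype.card_fin, Fintype.card_fin]
    refine lt_of_le_of_lt (Nat.add_le_add_right hK _) (hp.count_lt hm ?_ (hE.link _ (hA j hj)))
    have := hp.pos
    exact Nat.floor_le (by positivity))
  have hTinj : ∀ s t, s ≠ t → T s ≠ T t := by
    intro s t hst he
    refine hT s t hst ?_
    simp [bad, he]
  have hTj : ∀ t, (T t : ℕ) ≠ j := by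
    intro t he
    -- A second index exists because k - 1 ≥ 2, and its constraint keeps T t away from j.
    obtain ⟨s, hs⟩ : ∃ s : Fin (k - 1), s ≠ t := by
      by_cases h0 : t = ⟨0, by omega⟩
      · exact ⟨⟨1, by omega⟩, by rw [h0]; simp⟩
      · exact ⟨⟨0, by omega⟩, fun h => h0 h.symm⟩
    refine hT s t hs ?_
    have : T t = ⟨j, hj⟩ := Fin.ext he
    simp [bad, this]
  have hTfar : ∀ s t, s ≠ t → insert (g (T t) 0) (R (s + 1) (T s)) ∈ H.edges := by
    intro s t hst
    by_contra hc
    refine hT s t hst (mem_union_left _ ?_)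
    simp only [far, if_neg (hTj s), mem_filter, mem_univ, true_and]
    exact hc
  have hT0 : insert (g j 0) (univ.image fun t => g (T t) 1) ∈ H.edges := by
    by_contra hc
    refine hTK (mem_filter.2 ⟨mem_univ _, mem_filter.2 ⟨mem_powersetCard.2 ⟨?_, ?_⟩, hc⟩⟩)
    · intro v hv
      obtain ⟨t, -, rfl⟩ := mem_image.1 hv
      exact hC _ (T t).2 1 (by omega) (by omega)
    · rw [card_image_of_injective, card_univ, Fintype.card_fin]
      intro s t hst
      by_contra hne
      exact hTinj s t hne (hr hst)
  let i : ℕ → ℕ := fun t => if h : t ≠ 0 ∧ t < k then T ⟨t - 1, by omega⟩ else j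
  have hi0 : i 0 = j := by simp [i]
  have hi : ∀ t (ht : t ≠ 0 ∧ t < k), i t = T ⟨t - 1, by omega⟩ := fun t ht => by
    simp only [i, dif_pos ht]
  refine ⟨i, hi0, fun t ht => ?_, fun s hs t ht hst => ?_, fun b hb => ?_⟩
  · by_cases h0 : t = 0
    · rw [h0, hi0]; exact hj
    · rw [hi t ⟨h0, ht⟩]; exact (T _).2
  · by_cases hs0 : s = 0 <;> by_cases ht0 : t = 0
    · omega
    · rw [hs0, hi0, hi t ⟨ht0, ht⟩] at hst
      exact (hTj _ hst.symm).elim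
    · rw [ht0, hi0, hi s ⟨hs0, hs⟩] at hst
      exact (hTj _ hst).elim
    · rw [hi s ⟨hs0, hs⟩, hi t ⟨ht0, ht⟩] at hst
      by_contra hne
      exact hTinj ⟨s - 1, by omega⟩ ⟨t - 1, by omega⟩ (by simp; omega) (Fin.ext hst)
  · by_cases hb0 : b = 0
    · subst hb0
      convert hT0 using 1
      ext v
      simp only [mem_image, mem_range, mem_insert, mem_univ, true_and, srcBlock, srcPos, if_true]
      constructor
      · rintro ⟨p, hp, rfl⟩
        by_cases h0 : p = 0
        · left; rw [if_pos h0, h0, hi0]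
        · right; exact ⟨⟨p - 1, by omega⟩, by rw [if_neg h0, hi p ⟨h0, hp⟩]⟩
      · rintro (rfl | ⟨t, rfl⟩)
        · exact ⟨0, by omega, by rw [if_pos rfl, hi0]⟩
        · refine ⟨t + 1, by omega, ?_⟩
          rw [if_neg (by omega), hi _ ⟨by omega, by omega⟩]
          rfl
    · set s : Fin (k - 1) := ⟨b - 1, by omega⟩ with hs
      -- The cyclic successor of b in 1, …, k-1, which differs from b because k ≥ 3.
      set b' := if b + 1 < k then b + 1 else 1 with hb'
      have hb'0 : b' ≠ 0 ∧ b' < k := by rw [hb']; split_ifs <;> omega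
      have hne : s ≠ ⟨b' - 1, by omega⟩ := by
        rw [hs, Ne, Fin.mk.injEq, hb']; split_ifs <;> omega
      have hedge := hTfar s _ hne
      convert hedge using 1
      have hsb : (s : ℕ) + 1 = b := Nat.sub_add_cancel (by omega)
      rw [hsb, ← hi b' hb'0, ← hi b ⟨hb0, hb⟩]
      ext v
      simp only [R, mem_image, mem_range, mem_insert, mem_Ico, srcBlock, srcPos, if_neg hb0]
      rw [← hb']
      constructor
      · rintro ⟨p, hp, rfl⟩
        by_cases h0 : p = 0
        · left; simp [h0]
        · by_cases h1 : p = 1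
          · right; left; simp [h1, hi0]
          · right; right; exact ⟨p, ⟨by omega, hp⟩, by simp [h0, h1]⟩
      · rintro (rfl | rfl | ⟨p, hp, rfl⟩)
        · exact ⟨0, by omega, by simp⟩
        · exact ⟨1, by omega, by simp [hi0]⟩
        · exact ⟨p, hp.2, by rw [if_neg (by omega), if_neg (by omega), if_neg (by omega),
            if_neg (by omega)]⟩

end
end KGraph

/-! ### Preparing the vertices outside a cleaner -/

namespace KGraph
section
variable {k n : ℕ} {H : KGraph k (Fin n)} {A C : Finset (Fin n)} {α : ℝ}
  {M : Finset (Finset (Fin n))} {r : ℕ}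

/-- M covers at most 2kα²n vertices and the pairs that remove the slack at most 3kα²n. Both are tiny
compared with n/k, so `exists_pair` applies throughout the first phase and enough blocks remain for
`exists_exchange`. -/
theorem Extremal.prepared (hE : H.Extremal A C α) (hp : SmallParam k n α) (hkn : k ∣ n)
    (hM : H.IsMatching M) (hcov : Finset.univ \ (A ∪ C) ⊆ coveredBy M)
    (hMc : (M.card : ℝ) ≤ 2 * α ^ 2 * n)
    (hr : ((Finset.univ \ coveredBy M) ∩ A).card + M.card = n / k + 2 * r) :
    H.Prepared A C (Finset.univ \ coveredBy M) r := by
  have hk := hp.three_le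
  have hkR := hp.three_leR
  obtain ⟨q, hq⟩ := hkn
  have hqk : n / k = q := by rw [hq, Nat.mul_div_cancel_left _ (by omega)]
  have hqR : (n : ℝ) / k = q := by
    rw [hq]; push_cast; exact mul_div_cancel_left₀ _ (by linarith)
  rw [hqk] at hr
  have hUcard : (Finset.univ \ coveredBy M).card + M.card * k = k * q := by
    rw [← hM.card_coveredBy, Finset.card_sdiff_add_card_eq_card (Finset.subset_univ _), ← hq]
    simp
  -- From |U ∩ A| ≤ |V \ C| ≤ n/k + α³n and |M| ≤ 2α²n.
  have h2r : (2 * r : ℝ) ≤ 3 * α ^ 2 * n := by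
    have h1 : ((Finset.univ \ coveredBy M) ∩ A).card ≤ (Finset.univ \ C).card := by
      refine Finset.card_le_card fun v hv => ?_
      have := (Finset.mem_inter.1 hv).2
      simpa using Finset.disjoint_left.1 hE.disj this
    have h2 : (((Finset.univ \ coveredBy M) ∩ A).card : ℝ) ≤ (Finset.univ \ C).card := by
      exact_mod_cast h1
    have h3 : (((Finset.univ \ coveredBy M) ∩ A).card : ℝ) + M.card = q + 2 * r := by
      exact_mod_cast hr
    have h4 := hE.compl_le
    have h5 := hp.cube_le_sq
    rw [hqR] at h4
    linarith
  have hsq := hp.sq_mul_le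
  refine ⟨fun v hv => ?_, ?_, fun Y hY hYc => ?_, fun m g hm hg hA hC j hj => ?_⟩
  · by_contra hvn
    exact (Finset.mem_sdiff.1 hv).2 (hcov (by simpa using hvn))
  · have h1 := Finset.card_sdiff_add_card_inter (Finset.univ \ coveredBy M) A
    obtain ⟨d, rfl⟩ : ∃ d, k = d + 1 := ⟨k - 1, by omega⟩
    rw [Nat.add_sub_cancel]
    rw [← h1] at hUcard
    have h2 := congrArg (fun x => x * (d + 1)) hr
    nlinarith
  · obtain ⟨e₁, he₁, e₂, he₂, hd, hX, h4⟩ := hE.exists_pair hp (X := coveredBy M ∪ Y) (by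
      have h1 := Finset.card_union_le (coveredBy M) Y
      rw [hM.card_coveredBy] at h1
      have h2 : (coveredBy M ∪ Y).card ≤ k * M.card + k * (2 * r) := by nlinarith
      have h3 : ((coveredBy M ∪ Y).card : ℝ) ≤ k * M.card + k * (2 * r) := by exact_mod_cast h2
      have h4 : (k : ℝ) * M.card ≤ k * (2 * α ^ 2 * n) :=
        mul_le_mul_of_nonneg_left hMc (by linarith)
      have h5 : (k : ℝ) * (2 * r) ≤ k * (3 * α ^ 2 * n) :=
        mul_le_mul_of_nonneg_left h2r (by linarith)
      have h6 := hp.mul_le_div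
      linarith) (hcov.trans Finset.subset_union_left)
    refine ⟨e₁, he₁, e₂, he₂, hd, fun v hv => ?_, h4⟩
    have := Finset.disjoint_left.1 hX hv
    simpa [not_or] using this
  · refine hE.exists_exchange hp ?_ hg hA hC hj
    -- The shaped blocks, the edges that remove the slack and those of M partition V into n/k sets
    -- of size k, so m is at least n/(2k).
    have h1 : m + 2 * r + M.card = q := by
      rw [← hm] at hUcard
      have : k * (m + 2 * r + M.card) = k * q := by linarith
      exact Nat.eq_of_mul_eq_mul_left (by omega) this
    have h2 : (m : ℝ) + 2 * r + M.card = q := by exact_mod_cast h1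
    have h3 := hp.sq_le
    rw [hqR] at h3
    have h4 : (q : ℝ) ≤ 2 * m := by
      have : (0 : ℝ) ≤ q := Nat.cast_nonneg q
      linarith
    have h5 : q ≤ 2 * m := by exact_mod_cast h4
    rw [hq]
    nlinarith

end
end KGraph

/-! ### Encoding the data as an input -/

namespace WordRAM

/-- An input state is needed because the perfect matching in the purely combinatorial claim is
obtained from a run of the program. -/
theorem exists_isInput {k n : ℕ} [NeZero n] (H : KGraph k (Fin n))
    (A B : Finset (Fin n)) {M : Finset (Finset (Fin n))} (hM : H.IsMatching M) :
    ∃ s, IsInput H A B M s := by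
  classical
  have : Inhabited (Fin n) := ⟨Fin.ofNat n 0⟩
  obtain ⟨c, hcinj, hc⟩ := Finset.exists_enumeration (rfl : M.card = M.card)
  have henum : ∀ e ∈ M, ∃ E : ℕ → Fin n, (Finset.range k).image E = e := fun e he =>
    (Finset.exists_enumeration (H.card_eq e (hM.1 he))).imp fun _ h => h.2
  choose! E hE using henum
  have hcM : ∀ i < M.card, c i ∈ M := fun i hi => by
    have := Finset.mem_image_of_mem c (Finset.mem_range.2 hi)
    rwa [hc] at this
  let table : ℕ → ℕ := fun x => if x < n ^ k then
    (if Finset.univ.image (fun j : Fin k => Fin.ofNat n (dig n x j)) ∈ H.edges then 1 else 0) else 0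
  let label : ℕ → ℕ := fun i => if h : i < n then
    (if (⟨i, h⟩ : Fin n) ∈ A then 0 else if (⟨i, h⟩ : Fin n) ∈ B then 1 else 2) else 0
  let list : ℕ → ℕ := fun x => if x < M.card * k then E (c (x / k)) (x % k) else 0
  refine ⟨⟨fun x => if x = 0 then n else if x = 1 then M.card else 0,
    fun a => if a = 0 then table else if a = 1 then label else if a = 2 then list else 0⟩,
    ⟨rfl, rfl, fun x hx => ?_, fun v => ?_, fun i hi => ?_, fun v => ?_, fun i hi => ?_,
      ⟨rfl, fun e => ?_⟩, fun i hi => ?_, fun a ha i => ?_⟩⟩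
  · simp only
    rw [if_neg (by omega), if_neg (by omega)]
  · have h1 : ∑ j : Fin k, (v j : ℕ) * n ^ (j : ℕ) < n ^ k :=
      (finFunctionFinEquiv v).2
    have h2 : ∀ j : Fin k, Fin.ofNat n (dig n (∑ j : Fin k, (v j : ℕ) * n ^ (j : ℕ)) j) = v j := by
      intro j
      have h := congrArg (fun f : Fin k → Fin n => f j) (finFunctionFinEquiv.symm_apply_apply v)
      ext
      rw [Fin.val_ofNat, Nat.mod_eq_of_lt (dig_lt _ _)]
      exact congrArg Fin.val h
    simp only [if_true, table, if_pos h1, h2]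
  · simp only [if_true, table, if_neg (not_lt.2 hi)]
  · simp [label]
  · simp [label, not_lt.2 hi]
  · have hblock : ∀ i < M.card, (c i).map Fin.valEmbedding =
        (Finset.range k).image fun j => list (i * k + j) := by
      intro i hi
      conv_lhs => rw [← hE (c i) (hcM i hi)]
      rw [Finset.map_eq_image, Finset.image_image]
      refine Finset.image_congr fun j hj => ?_
      have hj : j < k := by simpa using hj
      simp only [list, if_pos (cell_lt hi hj), cell_div hj, cell_mod hj]
      rfl
    change _ ↔ ∃ i < M.card, _ = (Finset.range k).image fun j => list (i * k + j)
    constructor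
    · intro he
      rw [← hc] at he
      obtain ⟨i, hi, rfl⟩ := Finset.mem_image.1 he
      exact ⟨i, Finset.mem_range.1 hi, hblock i (Finset.mem_range.1 hi)⟩
    · rintro ⟨i, hi, he⟩
      rw [← hblock i hi] at he
      rw [Finset.map_injective Fin.valEmbedding he]
      exact hcM i hi
  · simp [list, not_lt.2 hi]
  · simp only
    rw [if_neg (by omega), if_neg (by omega), if_neg (by omega)]
    rfl

end WordRAM

/-! ### The theorem -/

theorem lemma5p2 (k : ℕ) (hk : 3 ≤ k) :
    -- everything chosen here depends on `k` only: the bound on `ε`, the algorithm,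
    -- the constant in the running time and the word length `q * log n`
    ∃ (ε₀ : ℝ) (P : WordRAM.Prog) (K q : ℕ), 0 < ε₀ ∧
      ∀ ε : ℝ, 0 < ε → ε ≤ ε₀ → ∃ n₀ : ℕ, ∀ n : ℕ, n₀ ≤ n → k ∣ n →
      ∀ (c : ℕ) (H : KGraph k (Fin n)), (c : ℝ) ≤ ε * n / k →
        (n : ℝ) / k - c ≤ (H.minDegree (k - 1) : ℝ) →
      ∀ S C : Finset (Fin n), H.IsIndep S →
        (1 - ε) * (((k : ℝ) - 1) / k * n) ≤ (S.card : ℝ) →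
        S ⊆ C → Maximal H.IsIndep C →
      ∀ α : ℝ, α = ε ^ (1 / 3 : ℝ) →
      ∀ M : Finset (Finset (Fin n)), H.IsCleaner α C M →
        (M.card : ℝ) ≤ (H.partB α C).card + α ^ 2 * n →
        (∃ N, H.IsPerfectMatchingOn (Finset.univ \ coveredBy M) N) ∧
        ∀ s : WordRAM.State, WordRAM.IsInput H (H.partA α C) (H.partB α C) M s →
          ∃ (N : Finset (Finset (Fin n))) (s' : WordRAM.State) (t : ℕ),
            WordRAM.Exec (n ^ q) P s s' t ∧ t ≤ K * n ^ (4 * (k - 1)) ∧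
            WordRAM.IsOutput k N s' ∧
            H.IsPerfectMatchingOn (Finset.univ \ coveredBy M) N := by
  have hkR : (3 : ℝ) ≤ k := by exact_mod_cast hk
  set a : ℝ := 1 / (4 * (2 * (k : ℝ) ^ 2) ^ k) with ha
  have ha0 : 0 < a := by positivity
  -- The bound ε ≤ a³ gives α ≤ a, as required by `SmallParam.le`. The word bound n^(2k+2) exceeds
  -- n^(2k+1), leaving room for the counter of the search for moves.
  refine ⟨a ^ 3, WordRAM.program k, WordRAM.timeFactor k, 2 * k + 2, by positivity,
    fun ε hε hεa => ⟨100 * k ^ 3, ?_⟩⟩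
  intro n hn hkn c H hc hdeg S C _ hS hSC hC α hα M hM hMc
  have hα0 : 0 < α := hα ▸ Real.rpow_pos_of_pos hε _
  have hα3 : α ^ 3 = ε := by
    rw [hα, ← Real.rpow_natCast, ← Real.rpow_mul hε.le]
    norm_num
  have hαa : α ≤ a := le_of_pow_le_pow_left₀ (show (3 : ℕ) ≠ 0 by norm_num) ha0.le (by rwa [hα3])
  have hp : KGraph.SmallParam k n α := by
    refine ⟨hk, hα0, ?_, hn⟩
    calc α * (4 * (2 * (k : ℝ) ^ 2) ^ k) ≤ a * (4 * (2 * (k : ℝ) ^ 2) ^ k) :=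
          mul_le_mul_of_nonneg_right hαa (by positivity)
      _ = 1 := by rw [ha]; exact one_div_mul_cancel (by positivity)
  have hk3 : 9 * k ≤ k ^ 3 := by
    have : 3 ^ 2 ≤ k ^ 2 := Nat.pow_le_pow_left hk 2
    nlinarith [Nat.mul_le_mul_right k this]
  have hk2 : k ^ 2 ≤ k ^ 3 := Nat.pow_le_pow_right (by omega) (by norm_num)
  have : NeZero n := ⟨by omega⟩
  have hW : WordRAM.Large k n (n ^ (2 * k + 2)) :=
    ⟨hk, by omega, Nat.pow_lt_pow_right (by omega) (by omega)⟩
  have hE : H.Extremal (H.partA α C) C α := by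
    refine KGraph.extremal_of_minDegree hk hα0 (by linarith [hp.cube_le]) (by omega) ?_ hC.prop ?_
    · refine le_trans (le_of_eq_of_le ?_ (sub_le_sub_left hc _)) hdeg
      rw [hα3]; ring
    · rw [hα3]
      exact hS.trans (by exact_mod_cast Finset.card_le_card hSC)
  obtain ⟨hmatch, hBcov, hs0, r, hr⟩ := hM
  -- As B is covered, only vertices of A count towards the slack.
  have hslack : (H.partA α C ∪ H.partB α C) \ coveredBy M =
      (Finset.univ \ coveredBy M) ∩ H.partA α C := by
    ext v
    have := @hBcov v
    simp only [Finset.mem_sdiff, Finset.mem_union, Finset.mem_inter, Finset.mem_univ, true_and]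
    tauto
  unfold KGraph.slack at hr hs0
  rw [hslack, Fintype.card_fin] at hr hs0
  have hr' : ((Finset.univ \ coveredBy M) ∩ H.partA α C).card + M.card =
      n / k + 2 * r.toNat := by
    have h0 : 0 ≤ r := by omega
    obtain ⟨r', rfl⟩ := Int.eq_ofNat_of_zero_le h0
    rw [Int.toNat_natCast]
    zify
    push_cast at hr
    linarith
  have hMc' : (M.card : ℝ) ≤ 2 * α ^ 2 * n := by
    have := hE.rest_le
    unfold KGraph.partB at hMc
    linarith
  have hP := hE.prepared hp hkn hmatch hBcov hMc' hr'
  have hrun : ∀ s, WordRAM.IsInput H (H.partA α C) (H.partB α C) M s → _ := fun s hs =>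
    WordRAM.program_correct hW hs hmatch hBcov hP hr'
  constructor
  -- The output of the program on an encoding of the data is the required matching.
  · obtain ⟨s, hs⟩ := WordRAM.exists_isInput H (H.partA α C) (H.partB α C) hmatch
    obtain ⟨-, -, -, -, N, -, hN⟩ := hrun s hs
    exact ⟨N, hN⟩
  · intro s hs
    obtain ⟨s', t, hexec, ht, N, hout, hN⟩ := hrun s hs
    exact ⟨N, s', t, hexec, ht, hout, hN⟩
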